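/- \textbf{Model.} Let $\tau,\tau_1,\tau_2,\dots\ge 0$ (inter-claim times) and $\xi,\xi_1,\xi_2,\dots\ge 0$ (claim sizes) be two mutually independent i.i.d. sequences with $0<\mathbb E\tau<\infty$. Put $T_0=0$, $T_n=\tau_1+\dots+\tau_n$, $N(t)=\max\{n\ge 0:T_n\le t\}$. Let the premium rate $v$ be a bounded measurable non-negative function on $\mathbb R$, such that for every $x\in\mathbb R$ the equation $V_x(t)=x+\int_0^t v(V_x(s))\,ds$, $t\ge0$, has a solution $V_x$, where $(x,t)\mapsto V_x(t)$ is a fixed jointly measurable family of continuous solutions. The risk reserve with initial value $R(0)=x$ (before any claim) moves along these solutions between claims and drops by $\xi_n$ at time $T_n$, so that $$R(t)=x+\int_0^t v(R(s))\,ds-\sum_{j=1}^{N(t)}\xi_j ,\qquad t\ge 0,$$ and $\psi(x)=\mathbb P\{R(t)<0\text{ for some }t\ge0\}$ is the ruin probability. Set $v_c=\mathbb E\xi/\mathbb E\tau$. \textbf{Theorem.} Assume that $\inf_{0\le x\le x_0}\psi(x)>0$ for every $x_0\ge 0$. Let $\alpha\in(0,1)$, $\theta>0$, and suppose that $$\Bigl|v(z)-v_c-\frac{\theta}{z^\alpha}\Bigr|\le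 p(z)\quad\text{for all }z>1,$$ where $p>0$ is a decreasing function on $(1,\infty)$ that is integrable at infinity. Let $\gamma=\min\{k\ge 1:k\alpha>1\}$, let $\mathbb E\tau^{\gamma+1}<\infty$, and let $\mathbb E e^{r\xi^{1-\alpha}}<\infty$ for some $r>r_1/(1-\alpha)$, where $$r_1=\frac{2\theta\,\mathbb E\tau}{\operatorname{Var}\xi+v_c^2\operatorname{Var}\tau}.$$ Then there exist real constants $r_2,\dots,r_{\gamma-1}$ and $0<C_1<C_2<\infty$ such that (i) if $\alpha=1/(\gamma-1)$, then for all $x>1$ $$\frac{C_1x^\alpha}{x^{r_{\gamma-1}}}\exp\Bigl\{-\sum_{j=1}^{\gamma-2}\frac{r_j}{1-\alpha j}x^{1-\alpha j}\Bigr\}\le\psi(x)\le\frac{C_2x^\alpha}{x^{r_{\gamma-1}}}\exp\Bigl\{-\sum_{j=1}^{\gamma-2}\frac{r_j}{1-\alpha j}x^{1-\alpha j}\Bigr\};$$ (ii) if $\alpha<1/(\gamma-1)$, then for all $x>1$ $$C_1x^\alpha\exp\Bigl\{-\sum_{j=1}^{\gamma-1}\frac{r_j}{1-\alpha j}x^{1-\alpha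 j}\Bigr\}\le\psi(x)\le C_2x^\alpha\exp\Bigl\{-\sum_{j=1}^{\gamma-1}\frac{r_j}{1-\alpha j}x^{1-\alpha j}\Bigr\}.$$ -/

import Mathlib

open MeasureTheory ProbabilityTheory Set

noncomputable section

namespace LevelDependentRisk

/-- `V x` solves the premium equation `V_x(t) = x + ∫₀ᵗ v(V_x(s)) ds`, `t ≥ 0`, for every initial
value `x`: this is the evolution of the reserve between two consecutive claims. -/
structure IsPremiumFlow (v : ℝ → ℝ) (V : ℝ → ℝ → ℝ) : Prop where
  measurable : Measurable (Function.uncurry V)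
  continuousOn : ∀ x, ContinuousOn (V x) (Ici 0)
  integral_eq : ∀ x t, 0 ≤ t → V x t = x + ∫ s in (0 : ℝ)..t, v (V x s)

variable {Ω : Type*}

/-- The `n`-th claim epoch `T_n = τ_1 + ⋯ + τ_n` (inter-claim times are numbered from `0`, so
`τ 0` is the time until the first claim). -/
def claimEpoch (τ : ℕ → Ω → ℝ) (n : ℕ) (ω : Ω) : ℝ :=
  ∑ i ∈ Finset.range n, τ i ω

/-- The renewal counting process `N(t) = max {n : T_n ≤ t}`. -/
def claimCount (τ : ℕ → Ω → ℝ) (t : ℝ) (ω : Ω) : ℕ :=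
  sSup {n : ℕ | claimEpoch τ n ω ≤ t}

/-- The reserve just after the `n`-th claim, starting from `x`. -/
def reserveAtClaim (V : ℝ → ℝ → ℝ) (τ ξ : ℕ → Ω → ℝ) (x : ℝ) : ℕ → Ω → ℝ
  | 0, _ => x
  | n + 1, ω => V (reserveAtClaim V τ ξ x n ω) (τ n ω) - ξ n ω

/-- The risk reserve `R(t)`, `t ≥ 0`, with `R(0) = x` before any claim: it follows the premium
flow between claims and drops by the claim size at each claim. -/
def riskReserve (V : ℝ → ℝ → ℝ) (τ ξ : ℕ → Ω → ℝ) (x t : ℝ) (ω : Ω) : ℝ :=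
  V (reserveAtClaim V τ ξ x (claimCount τ t ω) ω) (t - claimEpoch τ (claimCount τ t ω) ω)

/-- The ruin probability `ψ(x) = P{R(t) < 0 for some t ≥ 0}`. -/
def ruinProb [MeasurableSpace Ω] (P : Measure Ω) (V : ℝ → ℝ → ℝ) (τ ξ : ℕ → Ω → ℝ) (x : ℝ) : ℝ :=
  P.real {ω | ∃ t : ℝ, 0 ≤ t ∧ riskReserve V τ ξ x t ω < 0}

variable {V : ℝ → ℝ → ℝ} {v : ℝ → ℝ} {τ ξ : ℕ → Ω → ℝ} {ω : Ω}

lemma claimEpoch_mono (hτ : ∀ n, 0 ≤ τ n ω) : Monotone (fun n => claimEpoch τ n ω) :=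
  monotone_nat_of_le_succ fun n => by
    simp only [claimEpoch, Finset.sum_range_succ]; linarith [hτ n]

lemma claimCount_eq (hτ : ∀ n, 0 ≤ τ n ω) {n : ℕ} {t : ℝ} (h1 : claimEpoch τ n ω ≤ t)
    (h2 : t < claimEpoch τ (n + 1) ω) : claimCount τ t ω = n := by
  have : IsGreatest {n : ℕ | claimEpoch τ n ω ≤ t} n := by
    refine ⟨h1, fun m hm => ?_⟩
    by_contra hlt
    have := claimEpoch_mono hτ (show n + 1 ≤ m by omega)
    have hm' : claimEpoch τ m ω ≤ t := hm
    simp only at this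
    linarith
  exact this.csSup_eq

/-- The reserve satisfies the risk equation
`R(t) = x + ∫₀ᵗ v(R(s)) ds - ∑_{i ≤ N(t)} ξ_i` on every path with nonnegative inter-claim times
and claim epochs tending to infinity. -/
theorem riskReserve_eq (hv : Measurable v) (hv0 : ∀ z, 0 ≤ v z) (hM : ∃ M, ∀ z, v z ≤ M)
    (hV : IsPremiumFlow v V) (hτ : ∀ n, 0 ≤ τ n ω)
    (hT : Filter.Tendsto (fun n => claimEpoch τ n ω) Filter.atTop Filter.atTop)
    (x t : ℝ) (ht : 0 ≤ t) :
    riskReserve V τ ξ x t ω = x + (∫ s in (0 : ℝ)..t, v (riskReserve V τ ξ x s ω))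
      - ∑ i ∈ Finset.range (claimCount τ t ω), ξ i ω := by
  obtain ⟨M, hM⟩ := hM
  set R := fun s => riskReserve V τ ξ x s ω with hR
  have hint : ∀ y c, 0 ≤ c → IntervalIntegrable (fun s => v (V y s)) volume 0 c := by
    intro y c hc
    have hm : Measurable (fun s => v (V y s)) :=
      hv.comp (hV.measurable.comp (measurable_const.prodMk measurable_id))
    refine (intervalIntegrable_const (c := M)).mono_fun hm.aestronglyMeasurable ?_
    refine Filter.Eventually.of_forall fun s => ?_
    simp only [Real.norm_eq_abs]
    rw [abs_of_nonneg (hv0 _)]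
    exact (hM _).trans (le_abs_self M)
  have seg : ∀ n s, claimEpoch τ n ω ≤ s → s < claimEpoch τ (n + 1) ω →
      R s = V (reserveAtClaim V τ ξ x n ω) (s - claimEpoch τ n ω) := by
    intro n s h1 h2
    simp only [hR, riskReserve, claimCount_eq hτ h1 h2]
  have piece : ∀ n t, claimEpoch τ n ω ≤ t → t ≤ claimEpoch τ (n + 1) ω →
      IntervalIntegrable (fun s => v (R s)) volume (claimEpoch τ n ω) t ∧
      V (reserveAtClaim V τ ξ x n ω) (t - claimEpoch τ n ω) =
        reserveAtClaim V τ ξ x n ω + ∫ s in (claimEpoch τ n ω)..t, v (R s) := by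
    intro n t h1 h2
    set y := reserveAtClaim V τ ξ x n ω
    set T := claimEpoch τ n ω
    have hi := (hint y (t - T) (by linarith)).comp_sub_right T
    simp only [zero_add, sub_add_cancel] at hi
    have hae : ∀ s ∈ Ioo T t, v (V y (s - T)) = v (R s) := fun s hs => by
      rw [seg n s hs.1.le (hs.2.trans_le h2)]
    refine ⟨hi.congr_uIoo (by rw [uIoo_of_le h1]; exact hae), ?_⟩
    rw [hV.integral_eq y _ (by linarith)]
    congr 1
    have := intervalIntegral.integral_comp_sub_right (a := T) (b := t) (fun s => v (V y s)) T
    rw [sub_self] at this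
    rw [← this]
    exact intervalIntegral.integral_congr_uIoo (by rw [uIoo_of_le h1]; exact hae)
  have epochs : ∀ n, IntervalIntegrable (fun s => v (R s)) volume 0 (claimEpoch τ n ω) ∧
      reserveAtClaim V τ ξ x n ω = x + (∫ s in (0 : ℝ)..(claimEpoch τ n ω), v (R s))
        - ∑ i ∈ Finset.range n, ξ i ω := by
    intro n
    induction n with
    | zero => simp [claimEpoch, reserveAtClaim]
    | succ n ih =>
      have h := piece n _ (claimEpoch_mono hτ n.le_succ) le_rfl
      refine ⟨ih.1.trans h.1, ?_⟩
      have e : claimEpoch τ (n + 1) ω - claimEpoch τ n ω = τ n ω := by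
        simp [claimEpoch, Finset.sum_range_succ]
      rw [e] at h
      rw [← intervalIntegral.integral_add_adjacent_intervals ih.1 h.1, reserveAtClaim, h.2,
        Finset.sum_range_succ]
      linarith [ih.2]
  obtain ⟨n, h1, h2⟩ : ∃ n, claimEpoch τ n ω ≤ t ∧ t < claimEpoch τ (n + 1) ω := by
    have hex : ∃ n, t < claimEpoch τ n ω := (hT.eventually_gt_atTop t).exists
    classical
    have hf := Nat.find_spec hex
    rcases hk : Nat.find hex with _ | k
    · rw [hk] at hf; simp [claimEpoch] at hf; linarith
    · refine ⟨k, ?_, hk ▸ hf⟩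
      exact not_lt.1 (Nat.find_min hex (by omega))
  have h := piece n t h1 h2.le
  rw [claimCount_eq hτ h1 h2, ← intervalIntegral.integral_add_adjacent_intervals (epochs n).1 h.1]
  change R t = _
  rw [seg n t h1 h2, h.2]
  linarith [(epochs n).2]
end LevelDependentRisk

end

/-! ### The Markov chain of post-claim reserves: transition operators. -/

namespace LevelDependentRisk

variable {Ω : Type*} [mΩ : MeasurableSpace Ω]

/-! Observed just after claims, the reserve is a Markov chain with step `x ↦ V x τ - ξ`. Premiums
are nonnegative, so ruin means almost surely that this chain becomes negative (`ruin_iff`,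
`ruinProb_eq`). A nonincreasing function that is superharmonic beyond some level bounds the ruin
probability from above up to a constant (`ruinProb_le_of_stepOp_le`); a subharmonic one vanishing at
infinity bounds it from below (`exists_mul_le_ruinProb`). It remains to find two such functions of
the same order.

At level `x` the step is approximately `A + B u`, where `u = x ^ (-α)`, `A = v_c τ - ξ` is centred
and `B = θ τ`. The candidate is `W x = ∫ₓ^∞ exp (-R)` with `R' = ρ` slowly varying, for which `W (x
+ D) - W x ≈ exp (-R x) (exp (-ρ D) - 1) / ρ`. The Taylor polynomial of this increment has as its
mean a polynomial in `ρ` and `u`. Solving it for `ρ = Q u` up to order `u ^ γ` by successive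
corrections (`exists_poly_taylorIncrement`) gives `Q 0 = 0` and `Q' 0 = 2 E B / E A ^ 2 = r₁`; the
coefficients of `Q` are the constants `r_j`. Here `E A ^ 2 ≠ 0`, since otherwise ruin would be
impossible from high levels (`exists_ruinProb_eq_zero`).

The remaining error in the mean increment is at most a constant times `e = p + u ^ γ + u / x`
(`exists_increment_bound`): `p` comes from the premium rate, `u ^ γ` from the truncation, `u / x`
from the curvature of `R` and the variation of the rate along the flow. Large claims are controlled
by `R x - R z ≤ κ (x - z) ^ (1 - α)`, with `κ` slightly above `r₁ / (1 - α)`, and the exponential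
moment.

Since `e` is decreasing and integrable, replacing `R` by `R ± B ∫ e`, with `B` now a large constant,
changes `W` only by bounded factors. Yet downward steps of a fixed size, which have probability
bounded below, turn it into a drift of either sign that outweighs the error (`gain_of_add`,
`gain_of_sub`, `exists_perturbation`). Finally `W` has the order of `x ^ α exp (-R x)`
(`exists_tail_integral_bounds`). Integrating `Q (x ^ (-α))` term by term gives the powers in the
theorem, or a logarithm from the last term when `α (γ - 1) = 1`. -/

/-- The transition operator of the reserve observed just after claims. -/
noncomputable def stepOp (P : Measure Ω) (V : ℝ → ℝ → ℝ) (t s : Ω → ℝ) (f : ℝ → ℝ) (x : ℝ) : ℝ :=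
  ∫ ω, f (V x (t ω) - s ω) ∂P

/-- The transition operator of the reserve killed at ruin. -/
noncomputable def killedOp (P : Measure Ω) (V : ℝ → ℝ → ℝ) (t s : Ω → ℝ) (f : ℝ → ℝ) : ℝ → ℝ :=
  stepOp P V t s ((Ici 0).indicator f)

/-- The event that no ruin has occurred up to the `n`-th claim. -/
def alive (V : ℝ → ℝ → ℝ) (τ ξ : ℕ → Ω → ℝ) (x : ℝ) (n : ℕ) : Set Ω :=
  {ω | ∀ k ≤ n, 0 ≤ reserveAtClaim V τ ξ x k ω}

section operators

variable {P : Measure Ω} [IsProbabilityMeasure P] {V : ℝ → ℝ → ℝ} {t s : Ω → ℝ}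

lemma measurable_step (hV : Measurable (Function.uncurry V)) (ht : Measurable t)
    (hs : Measurable s) (x : ℝ) : Measurable fun ω => V x (t ω) - s ω :=
  (hV.comp (measurable_const.prodMk ht)).sub hs

lemma measurable_stepOp (hV : Measurable (Function.uncurry V)) (ht : Measurable t)
    (hs : Measurable s) {f : ℝ → ℝ} (hf : Measurable f) : Measurable (stepOp P V t s f) := by
  have h : Measurable (Function.uncurry fun (x : ℝ) (ω : Ω) => f (V x (t ω) - s ω)) := by
    refine hf.comp (Measurable.sub ?_ (hs.comp measurable_snd))
    exact hV.comp (measurable_fst.prodMk (ht.comp measurable_snd))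
  exact (h.stronglyMeasurable.integral_prod_right).measurable

lemma integrable_step (hV : Measurable (Function.uncurry V)) (ht : Measurable t)
    (hs : Measurable s) {f : ℝ → ℝ} (hf : Measurable f) (hf1 : ∀ x, f x ∈ Icc (0 : ℝ) 1) (x : ℝ) :
    Integrable (fun ω => f (V x (t ω) - s ω)) P := by
  refine Integrable.of_bound (hf.comp (measurable_step hV ht hs x)).aestronglyMeasurable 1 ?_
  refine Filter.Eventually.of_forall fun ω => ?_
  rw [Real.norm_eq_abs, abs_of_nonneg (hf1 _).1]
  exact (hf1 _).2

lemma stepOp_mem_Icc (hV : Measurable (Function.uncurry V)) (ht : Measurable t)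
    (hs : Measurable s) {f : ℝ → ℝ} (hf : Measurable f) (hf1 : ∀ x, f x ∈ Icc (0 : ℝ) 1) (x : ℝ) :
    stepOp P V t s f x ∈ Icc (0 : ℝ) 1 := by
  refine ⟨integral_nonneg fun ω => (hf1 _).1, ?_⟩
  calc stepOp P V t s f x ≤ ∫ _, (1 : ℝ) ∂P :=
        integral_mono (integrable_step hV ht hs hf hf1 x) (integrable_const _) fun ω => (hf1 _).2
    _ = 1 := by simp

lemma indicator_mem_Icc {f : ℝ → ℝ} (hf1 : ∀ x, f x ∈ Icc (0 : ℝ) 1) (x : ℝ) :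
    (Ici (0 : ℝ)).indicator f x ∈ Icc (0 : ℝ) 1 := by
  by_cases h : x ∈ Ici (0 : ℝ)
  · rw [indicator_of_mem h]; exact hf1 x
  · rw [indicator_of_notMem h]; simp

lemma killedOp_iterate (hV : Measurable (Function.uncurry V)) (ht : Measurable t)
    (hs : Measurable s) {f : ℝ → ℝ} (hf : Measurable f) (hf1 : ∀ x, f x ∈ Icc (0 : ℝ) 1) (n : ℕ) :
    Measurable ((killedOp P V t s)^[n] f) ∧ ∀ x, (killedOp P V t s)^[n] f x ∈ Icc (0 : ℝ) 1 := by
  induction n with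
  | zero => exact ⟨hf, hf1⟩
  | succ n ih =>
    rw [Function.iterate_succ_apply']
    exact ⟨measurable_stepOp hV ht hs (ih.1.indicator measurableSet_Ici),
      stepOp_mem_Icc hV ht hs (ih.1.indicator measurableSet_Ici) (indicator_mem_Icc ih.2)⟩

/-- By independence the joint law is a product measure, and Fubini applies; bounded `H` makes
integrability automatic. -/
lemma integral_comp_of_indepFun {𝓨 𝓩 : Type*} [MeasurableSpace 𝓨] [MeasurableSpace 𝓩]
    {Y : Ω → 𝓨} {Z : Ω → 𝓩} (hY : Measurable Y) (hZ : Measurable Z) (h : IndepFun Y Z P)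
    {H : 𝓨 × 𝓩 → ℝ} (hH : Measurable H) (hb : ∀ a, H a ∈ Icc (0 : ℝ) 1) :
    ∫ ω, H (Y ω, Z ω) ∂P = ∫ ω, (∫ ω', H (Y ω, Z ω') ∂P) ∂P := by
  have h1 := (indepFun_iff_map_prod_eq_prod_map_map hY.aemeasurable hZ.aemeasurable).1 h
  have : IsProbabilityMeasure (P.map Y) := Measure.isProbabilityMeasure_map hY.aemeasurable
  have : IsProbabilityMeasure (P.map Z) := Measure.isProbabilityMeasure_map hZ.aemeasurable
  have hint : Integrable H ((P.map Y).prod (P.map Z)) := by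
    refine Integrable.of_bound hH.aestronglyMeasurable 1 (Filter.Eventually.of_forall fun a => ?_)
    rw [Real.norm_eq_abs, abs_of_nonneg (hb _).1]
    exact (hb _).2
  rw [← integral_map (φ := fun ω => (Y ω, Z ω)) (hY.prodMk hZ).aemeasurable
    hH.aestronglyMeasurable, h1, integral_prod _ hint, integral_map hY.aemeasurable]
  · refine integral_congr_ae (Filter.Eventually.of_forall fun ω => ?_)
    simp only
    rw [integral_map hZ.aemeasurable]
    exact (hH.comp (measurable_const.prodMk measurable_id)).aestronglyMeasurable
  · exact (hH.stronglyMeasurable.integral_prod_right').aestronglyMeasurable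

end operators

/-! ### The Markov property of the killed chain. -/

section chain

variable {P : Measure Ω} [IsProbabilityMeasure P] {V : ℝ → ℝ → ℝ} {τ ξ : ℕ → Ω → ℝ}

/-- The σ-algebra generated by the first `n` inter-claim times and claim sizes. -/
@[reducible]
def pastAlgebra (τ ξ : ℕ → Ω → ℝ) (n : ℕ) : MeasurableSpace Ω :=
  ⨆ i ∈ {i : ℕ ⊕ ℕ | Sum.elim id id i < n},
    MeasurableSpace.comap (Sum.elim τ ξ i) inferInstance

omit mΩ in
lemma pastAlgebra_mono : Monotone (pastAlgebra τ ξ) := fun _ _ hmn =>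
  biSup_mono fun _ hi => lt_of_lt_of_le hi hmn

omit mΩ in
lemma measurable_pastAlgebra {i : ℕ ⊕ ℕ} {n : ℕ} (hi : Sum.elim id id i < n) :
    Measurable[pastAlgebra τ ξ n] (Sum.elim τ ξ i) := by
  have : MeasurableSpace.comap (Sum.elim τ ξ i) inferInstance ≤ pastAlgebra τ ξ n :=
    le_biSup (fun i => MeasurableSpace.comap (Sum.elim τ ξ i) inferInstance) hi
  exact (comap_measurable _).mono this le_rfl

omit mΩ in
lemma measurable_reserveAtClaim_past (hV : Measurable (Function.uncurry V)) (x : ℝ) (n : ℕ) :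
    Measurable[pastAlgebra τ ξ n] (reserveAtClaim V τ ξ x n) := by
  induction n with
  | zero => exact measurable_const
  | succ n ih =>
    have h1 := ih.mono (pastAlgebra_mono n.le_succ) le_rfl
    have h2 : Measurable[pastAlgebra τ ξ (n + 1)] (τ n) :=
      measurable_pastAlgebra (i := Sum.inl n) (by simp)
    have h3 : Measurable[pastAlgebra τ ξ (n + 1)] (ξ n) :=
      measurable_pastAlgebra (i := Sum.inr n) (by simp)
    exact Measurable.sub (hV.comp (h1.prodMk h2)) h3

omit mΩ in
lemma measurableSet_alive_past (hV : Measurable (Function.uncurry V)) (x : ℝ) (n : ℕ) :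
    MeasurableSet[pastAlgebra τ ξ n] (alive V τ ξ x n) := by
  have : alive V τ ξ x n = ⋂ k ∈ Iic n, reserveAtClaim V τ ξ x k ⁻¹' Ici 0 := by
    ext ω; simp [alive]
  rw [this]
  refine MeasurableSet.biInter (to_countable _) fun k hk => ?_
  exact pastAlgebra_mono hk _ (measurable_reserveAtClaim_past hV x k measurableSet_Ici)

lemma pastAlgebra_le (hτ : ∀ n, Measurable (τ n)) (hξ : ∀ n, Measurable (ξ n)) (n : ℕ) :
    pastAlgebra τ ξ n ≤ mΩ := by
  refine iSup₂_le fun i _ => Measurable.comap_le ?_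
  rcases i with i | i
  exacts [hτ i, hξ i]

-- The two sequences form one independent family indexed by `ℕ ⊕ ℕ`. The past uses the indices below
-- `n` on both sides, the pair uses the two indices `n`, and disjoint subfamilies generate
-- independent σ-algebras.
omit [IsProbabilityMeasure P] in
lemma indepFun_past (hτ : ∀ n, Measurable (τ n)) (hξ : ∀ n, Measurable (ξ n))
    (h : iIndepFun (Sum.elim τ ξ) P) {𝓨 : Type*} [MeasurableSpace 𝓨] {Y : Ω → 𝓨} {n : ℕ}
    (hY : Measurable[pastAlgebra τ ξ n] Y) : IndepFun Y (fun ω => (τ n ω, ξ n ω)) P := by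
  have hle : ∀ i : ℕ ⊕ ℕ, MeasurableSpace.comap (Sum.elim τ ξ i) inferInstance ≤ mΩ := by
    rintro (i | i)
    exacts [(hτ i).comap_le, (hξ i).comap_le]
  have hd : Disjoint {i : ℕ ⊕ ℕ | Sum.elim id id i < n} {Sum.inl n, Sum.inr n} := by
    rw [Set.disjoint_left]
    rintro i hi (rfl | rfl) <;> simp at hi
  have h1 := indep_iSup_of_disjoint hle h hd
  refine indep_of_indep_of_le_left (indep_of_indep_of_le_right h1 ?_) hY.comap_le
  refine Measurable.comap_le ?_
  refine Measurable.prodMk ?_ ?_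
  · exact (comap_measurable (Sum.elim τ ξ (Sum.inl n))).mono
      (le_biSup (fun i => MeasurableSpace.comap (Sum.elim τ ξ i) inferInstance)
        (Set.mem_insert _ _)) le_rfl
  · exact (comap_measurable (Sum.elim τ ξ (Sum.inr n))).mono
      (le_biSup (fun i => MeasurableSpace.comap (Sum.elim τ ξ i) inferInstance)
        (Set.mem_insert_of_mem _ rfl)) le_rfl

lemma identDistrib_pair (h : iIndepFun (Sum.elim τ ξ) P)
    (hτi : ∀ n, IdentDistrib (τ n) (τ 0) P P) (hξi : ∀ n, IdentDistrib (ξ n) (ξ 0) P P) (n : ℕ) :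
    IdentDistrib (fun ω => (τ n ω, ξ n ω)) (fun ω => (τ 0 ω, ξ 0 ω)) P P :=
  (hτi n).prodMk (hξi n) (h.indepFun (i := Sum.inl n) (j := Sum.inr n) (by simp))
    (h.indepFun (i := Sum.inl 0) (j := Sum.inr 0) (by simp))

omit mΩ in
lemma indicator_alive_succ (f : ℝ → ℝ) (x : ℝ) (n : ℕ) (ω : Ω) :
    (alive V τ ξ x (n + 1)).indicator (fun ω => f (reserveAtClaim V τ ξ x (n + 1) ω)) ω =
      (alive V τ ξ x n).indicator 1 ω *
        (Ici 0).indicator f (V (reserveAtClaim V τ ξ x n ω) (τ n ω) - ξ n ω) := by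
  have hiff : ω ∈ alive V τ ξ x (n + 1) ↔
      ω ∈ alive V τ ξ x n ∧ 0 ≤ reserveAtClaim V τ ξ x (n + 1) ω :=
    ⟨fun h => ⟨fun k hk => h k (by omega), h _ le_rfl⟩, fun h k hk => by
      rcases Nat.lt_or_ge k (n + 1) with h' | h'
      · exact h.1 k (by omega)
      · obtain rfl : k = n + 1 := by omega
        exact h.2⟩
  classical
  simp only [Set.indicator_apply, hiff, mem_Ici, reserveAtClaim, Pi.one_apply]
  split_ifs <;> simp_all

/-- The Markov property of the reserve killed at ruin. -/
lemma integral_alive (hV : Measurable (Function.uncurry V))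
    (hτ : ∀ n, Measurable (τ n)) (hξ : ∀ n, Measurable (ξ n)) (h : iIndepFun (Sum.elim τ ξ) P)
    (hτi : ∀ n, IdentDistrib (τ n) (τ 0) P P) (hξi : ∀ n, IdentDistrib (ξ n) (ξ 0) P P)
    {x : ℝ} (hx : 0 ≤ x) (n : ℕ) {f : ℝ → ℝ} (hf : Measurable f)
    (hf1 : ∀ x, f x ∈ Icc (0 : ℝ) 1) :
    ∫ ω, (alive V τ ξ x n).indicator (fun ω => f (reserveAtClaim V τ ξ x n ω)) ω ∂P =
      (killedOp P V (τ 0) (ξ 0))^[n] f x := by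
  induction n generalizing f with
  | zero =>
    have : alive V τ ξ x 0 = univ := by
      ext ω; simp [alive, reserveAtClaim, hx]
    simp [this, reserveAtClaim]
  | succ n ih =>
    have hg : Measurable ((Ici (0 : ℝ)).indicator f) := hf.indicator measurableSet_Ici
    have hg1 := indicator_mem_Icc hf1
    have ih' := ih (measurable_stepOp (P := P) hV (hτ 0) (hξ 0) hg)
      (stepOp_mem_Icc hV (hτ 0) (hξ 0) hg hg1)
    rw [Function.iterate_succ_apply]
    refine Eq.trans ?_ ih'
    simp only [indicator_alive_succ]
    have hYp : Measurable[pastAlgebra τ ξ n] (fun ω =>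
        ((alive V τ ξ x n).indicator (1 : Ω → ℝ) ω, reserveAtClaim V τ ξ x n ω)) :=
      Measurable.prodMk (measurable_const.indicator (measurableSet_alive_past hV x n))
        (measurable_reserveAtClaim_past hV x n)
    have hind := indepFun_past hτ hξ h hYp
    have hY := hYp.mono (pastAlgebra_le hτ hξ n) le_rfl
    let F : ℝ × (ℝ × ℝ) → ℝ := fun a => (Ici 0).indicator f (V a.1 a.2.1 - a.2.2)
    have hF : Measurable F := hg.comp (Measurable.sub
      (hV.comp (measurable_fst.prodMk (measurable_fst.comp measurable_snd)))
      (measurable_snd.comp measurable_snd))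
    -- The first coordinate will be the value of an indicator. Cutting the identity off outside `[0,
    -- 1]` makes `H` bounded everywhere, as `integral_comp_of_indepFun` demands, without changing it
    -- on the values that occur.
    let H : (ℝ × ℝ) × (ℝ × ℝ) → ℝ := fun a => (Icc 0 1).indicator id a.1.1 * F (a.1.2, a.2)
    have hH : Measurable H := Measurable.mul
      ((measurable_id.indicator measurableSet_Icc).comp (measurable_fst.comp measurable_fst))
      (hF.comp ((measurable_snd.comp measurable_fst).prodMk measurable_snd))
    have hI : ∀ a : ℝ, (Icc (0 : ℝ) 1).indicator id a ∈ Icc (0 : ℝ) 1 := fun a => by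
      by_cases ha : a ∈ Icc (0 : ℝ) 1
      · rw [indicator_of_mem ha]; exact ha
      · rw [indicator_of_notMem ha]; simp
    have hH1 : ∀ a, H a ∈ Icc (0 : ℝ) 1 := fun a =>
      ⟨mul_nonneg (hI _).1 (hg1 _).1, mul_le_one₀ (hI _).2 (hg1 _).1 (hg1 _).2⟩
    have hA : ∀ ω, (Icc (0 : ℝ) 1).indicator id ((alive V τ ξ x n).indicator (1 : Ω → ℝ) ω) =
        (alive V τ ξ x n).indicator (1 : Ω → ℝ) ω := fun ω => by
      apply indicator_of_mem
      by_cases hω : ω ∈ alive V τ ξ x n <;> simp [hω]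
    have key := integral_comp_of_indepFun hY ((hτ n).prodMk (hξ n)) hind hH hH1
    simp only [H, F, hA] at key
    rw [key]
    refine integral_congr_ae (Filter.Eventually.of_forall fun ω => ?_)
    simp only
    rw [integral_const_mul]
    have hid := ((identDistrib_pair h hτi hξi n).comp (u := fun a : ℝ × ℝ =>
      F (reserveAtClaim V τ ξ x n ω, a))
      (hF.comp (measurable_const.prodMk measurable_id))).integral_eq
    simp only [F, Function.comp_def] at hid
    rw [hid]
    by_cases hω : ω ∈ alive V τ ξ x n <;> simp [hω, stepOp]

end chain
end LevelDependentRisk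

/-! ### Ruin in continuous time as ruin of the chain. -/

namespace LevelDependentRisk

variable {Ω : Type*} [mΩ : MeasurableSpace Ω]

/-- The standing assumptions on the claim process and the premium flow. -/
structure IsRiskModel (P : Measure Ω) (τ ξ : ℕ → Ω → ℝ) (v : ℝ → ℝ) (V : ℝ → ℝ → ℝ) : Prop where
  measurable_time : ∀ n, Measurable (τ n)
  measurable_claim : ∀ n, Measurable (ξ n)
  indep : iIndepFun (Sum.elim τ ξ) P
  time_ident : ∀ n, IdentDistrib (τ n) (τ 0) P P
  claim_ident : ∀ n, IdentDistrib (ξ n) (ξ 0) P P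
  time_nonneg : ∀ᵐ ω ∂P, 0 ≤ τ 0 ω
  claim_nonneg : ∀ᵐ ω ∂P, 0 ≤ ξ 0 ω
  time_pos : 0 < ∫ ω, τ 0 ω ∂P
  rate_nonneg : ∀ z, 0 ≤ v z
  flow : IsPremiumFlow v V

namespace IsPremiumFlow

variable {v : ℝ → ℝ} {V : ℝ → ℝ → ℝ}

lemma zero (hV : IsPremiumFlow v V) (x : ℝ) : V x 0 = x := by
  simpa using hV.integral_eq x 0 le_rfl

lemma le (hV : IsPremiumFlow v V) (hv : ∀ z, 0 ≤ v z) (x : ℝ) {t : ℝ} (ht : 0 ≤ t) :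
    x ≤ V x t := by
  rw [hV.integral_eq x t ht]
  linarith [intervalIntegral.integral_nonneg (μ := volume) ht (fun s _ => hv (V x s))]

end IsPremiumFlow

section

variable {P : Measure Ω} [IsProbabilityMeasure P] {V : ℝ → ℝ → ℝ} {τ ξ : ℕ → Ω → ℝ} {v : ℝ → ℝ}

/-- The probability of no ruin up to the `n`-th claim. -/
noncomputable def survival (P : Measure Ω) (V : ℝ → ℝ → ℝ) (τ ξ : ℕ → Ω → ℝ) (n : ℕ) : ℝ → ℝ :=
  (killedOp P V (τ 0) (ξ 0))^[n] 1

/-- The probability that ruin never occurs. -/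
noncomputable def survivalLim (P : Measure Ω) (V : ℝ → ℝ → ℝ) (τ ξ : ℕ → Ω → ℝ) (x : ℝ) : ℝ :=
  ⨅ n, survival P V τ ξ n x

namespace IsRiskModel

omit [IsProbabilityMeasure P] in
lemma nonneg_ae (h : IsRiskModel P τ ξ v V) : ∀ᵐ ω ∂P, ∀ n, 0 ≤ τ n ω ∧ 0 ≤ ξ n ω := by
  rw [ae_all_iff]
  intro n
  filter_upwards [(h.time_ident n).symm.ae_snd (p := fun x => 0 ≤ x) measurableSet_Ici
    h.time_nonneg, (h.claim_ident n).symm.ae_snd (p := fun x => 0 ≤ x) measurableSet_Ici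
    h.claim_nonneg] with ω h1 h2 using ⟨h1, h2⟩

-- The Bochner integral of a nonintegrable function is `0`, so a positive mean already forces
-- integrability.
omit [IsProbabilityMeasure P] in
lemma integrable_time (h : IsRiskModel P τ ξ v V) : Integrable (τ 0) P := by
  by_contra hc
  have := h.time_pos
  rw [integral_undef hc] at this
  exact lt_irrefl _ this

-- Strong law of large numbers with positive mean. It is needed because `claimCount` is an `sSup` in
-- `ℕ`, which is a maximum only if the set of epochs before `t` is bounded.
omit [IsProbabilityMeasure P] in
lemma claimEpoch_tendsto (h : IsRiskModel P τ ξ v V) :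
    ∀ᵐ ω ∂P, Filter.Tendsto (fun n => claimEpoch τ n ω) Filter.atTop Filter.atTop := by
  have hp : Pairwise (Function.onFun (fun f g : Ω → ℝ => IndepFun f g P) τ) := fun i j hij =>
    h.indep.indepFun (i := Sum.inl i) (j := Sum.inl j) (by simpa using hij)
  filter_upwards [strong_law_ae_real τ h.integrable_time hp h.time_ident] with ω hω
  have h1 := (hω.pos_mul_atTop h.time_pos tendsto_natCast_atTop_atTop)
  refine h1.congr' ?_
  filter_upwards [Filter.eventually_gt_atTop 0] with n hn
  have : (n : ℝ) ≠ 0 := by positivity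
  simp only [claimEpoch]
  field_simp

-- Between claims the reserve does not decrease, so a negative value at time `t` forces a negative
-- value just after the preceding claim. Conversely, a negative post-claim reserve is seen at its
-- own epoch, up to simultaneous claims.
omit [IsProbabilityMeasure P] in
lemma ruin_iff (h : IsRiskModel P τ ξ v V) (x : ℝ) :
    ∀ᵐ ω ∂P, (∃ t : ℝ, 0 ≤ t ∧ riskReserve V τ ξ x t ω < 0) ↔
      ∃ n, reserveAtClaim V τ ξ x n ω < 0 := by
  filter_upwards [h.nonneg_ae, h.claimEpoch_tendsto] with ω h0 hT
  have hτ0 : ∀ n, 0 ≤ τ n ω := fun n => (h0 n).1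
  have hmono := claimEpoch_mono hτ0
  have hbdd : ∀ t : ℝ, BddAbove {n : ℕ | claimEpoch τ n ω ≤ t} := fun t => by
    obtain ⟨N, hN⟩ := (hT.eventually_gt_atTop t).exists
    refine ⟨N, fun m hm => ?_⟩
    by_contra hlt
    have h1 : claimEpoch τ N ω ≤ claimEpoch τ m ω := hmono (by omega)
    have h2 : claimEpoch τ m ω ≤ t := hm
    linarith
  constructor
  · rintro ⟨t, ht, hR⟩
    have hmem : claimEpoch τ (claimCount τ t ω) ω ≤ t :=
      Nat.sSup_mem (s := {n : ℕ | claimEpoch τ n ω ≤ t}) ⟨0, by simpa [claimEpoch] using ht⟩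
        (hbdd t)
    refine ⟨claimCount τ t ω, lt_of_le_of_lt ?_ hR⟩
    exact h.flow.le h.rate_nonneg _ (by linarith)
  · rintro ⟨n, hn⟩
    have hT0 : 0 ≤ claimEpoch τ n ω := Finset.sum_nonneg fun i _ => hτ0 i
    refine ⟨claimEpoch τ n ω, hT0, ?_⟩
    -- Inter-claim times may vanish, so `m` can exceed `n`. The claims between them then fall at the
    -- same instant: the flow does not move and the reserve can only drop further.
    set m := claimCount τ (claimEpoch τ n ω) ω with hm
    have hnm : n ≤ m := le_csSup (hbdd _) (le_refl (claimEpoch τ n ω))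
    have hmem : claimEpoch τ m ω ≤ claimEpoch τ n ω :=
      Nat.sSup_mem (s := {k : ℕ | claimEpoch τ k ω ≤ claimEpoch τ n ω}) ⟨n, le_refl (claimEpoch τ n ω)⟩ (hbdd _)
    have heq : ∀ k, n ≤ k → k ≤ m → claimEpoch τ k ω = claimEpoch τ n ω := fun k h1 h2 =>
      le_antisymm ((hmono h2).trans hmem) (hmono h1)
    have hX : ∀ k, n ≤ k → k ≤ m → reserveAtClaim V τ ξ x k ω < 0 := by
      intro k hk
      induction k, hk using Nat.le_induction with
      | base => exact fun _ => hn
      | succ k hk ih =>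
        intro hkm
        have e1 := heq k hk (by omega)
        have e2 := heq (k + 1) (by omega) hkm
        have e3 : τ k ω = 0 := by
          simp only [claimEpoch, Finset.sum_range_succ] at e1 e2 ⊢
          linarith
        have := ih (by omega)
        simp only [reserveAtClaim, e3, h.flow.zero]
        linarith [(h0 k).2]
    simp only [riskReserve]
    rw [← hm, heq m hnm le_rfl, sub_self, h.flow.zero]
    exact hX m hnm le_rfl

lemma survival_spec (h : IsRiskModel P τ ξ v V) (n : ℕ) :
    Measurable (survival P V τ ξ n) ∧ ∀ x, survival P V τ ξ n x ∈ Icc (0 : ℝ) 1 :=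
  killedOp_iterate h.flow.measurable (h.measurable_time 0) (h.measurable_claim 0)
    measurable_one (fun _ => ⟨zero_le_one, le_refl (1 : ℝ)⟩) n

omit [IsProbabilityMeasure P] in
lemma survival_succ (n : ℕ) (x : ℝ) :
    survival P V τ ξ (n + 1) x =
      stepOp P V (τ 0) (ξ 0) ((Ici 0).indicator (survival P V τ ξ n)) x := by
  rw [survival, Function.iterate_succ_apply']; rfl

lemma integrable_killed (h : IsRiskModel P τ ξ v V) {f : ℝ → ℝ} (hf : Measurable f)
    (hf1 : ∀ x, f x ∈ Icc (0 : ℝ) 1) (x : ℝ) :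
    Integrable (fun ω => (Ici 0).indicator f (V x (τ 0 ω) - ξ 0 ω)) P :=
  integrable_step h.flow.measurable (h.measurable_time 0) (h.measurable_claim 0)
    (hf.indicator measurableSet_Ici) (indicator_mem_Icc hf1) x

lemma survival_antitone (h : IsRiskModel P τ ξ v V) (x : ℝ) :
    Antitone fun n => survival P V τ ξ n x := by
  refine antitone_nat_of_succ_le fun n => ?_
  induction n generalizing x with
  | zero => exact ((h.survival_spec 1).2 x).2
  | succ n ih =>
    rw [survival_succ (n + 1), survival_succ n]
    exact integral_mono (h.integrable_killed (h.survival_spec _).1 (h.survival_spec _).2 x)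
      (h.integrable_killed (h.survival_spec _).1 (h.survival_spec _).2 x)
      fun ω => indicator_le_indicator (ih _)

lemma survival_tendsto (h : IsRiskModel P τ ξ v V) (x : ℝ) :
    Filter.Tendsto (fun n => survival P V τ ξ n x) Filter.atTop
      (nhds (survivalLim P V τ ξ x)) :=
  tendsto_atTop_ciInf (h.survival_antitone x)
    ⟨0, by rintro _ ⟨n, rfl⟩; exact ((h.survival_spec n).2 x).1⟩

lemma measurable_survivalLim (h : IsRiskModel P τ ξ v V) : Measurable (survivalLim P V τ ξ) :=
  measurable_of_tendsto_metrizable (fun n => (h.survival_spec n).1)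
    (tendsto_pi_nhds.2 h.survival_tendsto)

lemma survivalLim_mem_Icc (h : IsRiskModel P τ ξ v V) (x : ℝ) :
    survivalLim P V τ ξ x ∈ Icc (0 : ℝ) 1 :=
  isClosed_Icc.mem_of_tendsto (h.survival_tendsto x)
    (Filter.Eventually.of_forall fun n => (h.survival_spec n).2 x)

lemma survivalLim_eq (h : IsRiskModel P τ ξ v V) (x : ℝ) :
    survivalLim P V τ ξ x =
      stepOp P V (τ 0) (ξ 0) ((Ici 0).indicator (survivalLim P V τ ξ)) x := by
  have h1 : Filter.Tendsto (fun n => survival P V τ ξ (n + 1) x) Filter.atTop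
      (nhds (survivalLim P V τ ξ x)) := (Filter.tendsto_add_atTop_iff_nat 1).2 (h.survival_tendsto x)
  refine tendsto_nhds_unique h1 ?_
  simp only [survival_succ, stepOp]
  refine tendsto_integral_of_dominated_convergence (fun _ => (1 : ℝ))
    (fun n => (h.integrable_killed (h.survival_spec n).1 (h.survival_spec n).2 x).1)
    (integrable_const _) (fun n => Filter.Eventually.of_forall fun ω => ?_)
    (Filter.Eventually.of_forall fun ω => ?_)
  · have := indicator_mem_Icc (h.survival_spec n).2 (V x (τ 0 ω) - ξ 0 ω)
    rw [Real.norm_eq_abs, abs_of_nonneg this.1]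
    exact this.2
  · by_cases hω : V x (τ 0 ω) - ξ 0 ω ∈ Ici (0 : ℝ)
    · simp only [indicator_of_mem hω]; exact h.survival_tendsto _
    · simp only [indicator_of_notMem hω]; exact tendsto_const_nhds

/-- The restriction to `0 ≤ x` matters: `killedOp` kills only after a step and does not see a
negative starting point, whereas `alive` also tests index `0`. -/
lemma survival_eq_alive (h : IsRiskModel P τ ξ v V) {x : ℝ} (hx : 0 ≤ x) (n : ℕ) :
    survival P V τ ξ n x = P.real (alive V τ ξ x n) := by
  have := integral_alive (P := P) h.flow.measurable h.measurable_time h.measurable_claim h.indep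
    h.time_ident h.claim_ident hx n (f := 1) measurable_const (fun _ => by simp)
  rw [survival, ← this]
  have hm : MeasurableSet (alive V τ ξ x n) :=
    pastAlgebra_le h.measurable_time h.measurable_claim n _
      (measurableSet_alive_past h.flow.measurable x n)
  rw [integral_indicator hm]
  simp

lemma ruinProb_eq (h : IsRiskModel P τ ξ v V) {x : ℝ} (hx : 0 ≤ x) :
    ruinProb P V τ ξ x = 1 - survivalLim P V τ ξ x := by
  have hm : ∀ n, MeasurableSet (alive V τ ξ x n) := fun n =>
    pastAlgebra_le h.measurable_time h.measurable_claim n _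
      (measurableSet_alive_past h.flow.measurable x n)
  have hmI : MeasurableSet (⋂ n, alive V τ ξ x n) := MeasurableSet.iInter hm
  have h1 : ruinProb P V τ ξ x = P.real (⋂ n, alive V τ ξ x n)ᶜ := by
    refine measureReal_congr ?_
    filter_upwards [h.ruin_iff x] with ω hω
    refine propext (hω.trans ?_)
    change _ ↔ ω ∈ (⋂ n, alive V τ ξ x n)ᶜ
    simp only [alive, mem_compl_iff, mem_iInter, mem_ofPred_eq, not_forall, not_le]
    exact ⟨fun ⟨n, hn⟩ => ⟨n, n, le_rfl, hn⟩, fun ⟨_, k, _, hk⟩ => ⟨k, hk⟩⟩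
  rw [h1, probReal_compl_eq_one_sub hmI]
  congr 1
  have ht : Filter.Tendsto (fun n => P.real (alive V τ ξ x n)) Filter.atTop
      (nhds (P.real (⋂ n, alive V τ ξ x n))) := by
    refine (ENNReal.tendsto_toReal (measure_ne_top _ _)).comp
      (tendsto_measure_iInter_atTop (fun n => (hm n).nullMeasurableSet) ?_ ⟨0, measure_ne_top _ _⟩)
    intro m n hmn ω hω k hk
    exact hω k (hk.trans hmn)
  refine tendsto_nhds_unique ht ?_
  simpa only [h.survival_eq_alive hx] using h.survival_tendsto x

/-! ### Comparison of the ruin probability with superharmonic and subharmonic functions. -/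

/-- A nonincreasing test function that is superharmonic far away bounds the ruin probability. -/
theorem ruinProb_le_of_stepOp_le (h : IsRiskModel P τ ξ v V) {W : ℝ → ℝ} (hW : Antitone W)
    (hW1 : ∀ x, W x ∈ Icc (0 : ℝ) 1) {x₂ : ℝ} (hx₂ : 0 ≤ x₂) (hpos : 0 < W x₂)
    (hstep : ∀ x, x₂ ≤ x → stepOp P V (τ 0) (ξ 0) W x ≤ W x) {x : ℝ} (hx : 0 ≤ x) :
    ruinProb P V τ ξ x ≤ W x / W x₂ := by
  -- Here `1 - survival` is the probability of ruin within `n` claims. Below `x₂` monotonicity of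
  -- `W` is enough; above it one averages over a step, and a ruined reserve is negative, hence at a
  -- point where `W` is at least `W x₂`.
  have key : ∀ n x, 0 ≤ x → W x₂ * (1 - survival P V τ ξ n x) ≤ W x := by
    intro n
    induction n with
    | zero =>
      intro x _
      simpa [survival] using (hW1 x).1
    | succ n ih =>
      intro x hx
      have hS := (h.survival_spec (n + 1)).2 x
      rcases lt_or_ge x x₂ with hlt | hge
      · have := hW hlt.le
        nlinarith [hS.1]
      refine le_trans ?_ (hstep x hge)
      have hk := h.integrable_killed (h.survival_spec n).1 (h.survival_spec n).2 x
      have e : W x₂ * (1 - survival P V τ ξ (n + 1) x) = ∫ ω, W x₂ *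
          (1 - (Ici 0).indicator (survival P V τ ξ n) (V x (τ 0 ω) - ξ 0 ω)) ∂P := by
        rw [integral_const_mul, integral_sub (integrable_const _) hk, survival_succ]
        simp [stepOp]
      rw [e]
      refine integral_mono (((integrable_const _).sub hk).const_mul _)
        (integrable_step h.flow.measurable (h.measurable_time 0) (h.measurable_claim 0)
          hW.measurable hW1 x) fun ω => ?_
      simp only
      by_cases hω : V x (τ 0 ω) - ξ 0 ω ∈ Ici (0 : ℝ)
      · rw [indicator_of_mem hω]; exact ih _ hω
      · rw [indicator_of_notMem hω, sub_zero, mul_one]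
        exact hW ((not_le.1 hω).le.trans hx₂)
  rw [h.ruinProb_eq hx, le_div_iff₀ hpos, mul_comm]
  refine le_of_tendsto' (((h.survival_tendsto x).const_sub 1).const_mul _) fun n => key n x hx

/-- A nonincreasing test function that vanishes at infinity and is subharmonic far away is, up to
a constant, a lower bound for the ruin probability. -/
theorem exists_mul_le_ruinProb (h : IsRiskModel P τ ξ v V)
    (hruin : ∀ x₀ : ℝ, ∃ ε > 0, ∀ x, 0 ≤ x → x ≤ x₀ → ε ≤ ruinProb P V τ ξ x)
    {W : ℝ → ℝ} (hW : Antitone W) (hW1 : ∀ x, W x ∈ Icc (0 : ℝ) 1)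
    (hW0 : Filter.Tendsto W Filter.atTop (nhds 0)) {x₂ : ℝ} (hx₂ : 0 ≤ x₂)
    (hstep : ∀ x, x₂ ≤ x → W x ≤ stepOp P V (τ 0) (ξ 0) W x) :
    ∃ c > 0, ∀ x, 0 ≤ x → c * W x ≤ ruinProb P V τ ξ x := by
  obtain ⟨ε, hε, hεψ⟩ := hruin x₂
  set φ := survivalLim P V τ ξ
  have hφ1 := h.survivalLim_mem_Icc
  have hψ : ∀ x, 0 ≤ x → ruinProb P V τ ξ x = 1 - φ x := fun x hx => h.ruinProb_eq hx
  have hε1 : ε ≤ 1 := by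
    have := hεψ 0 le_rfl hx₂
    rw [hψ 0 le_rfl] at this
    linarith [(hφ1 0).1]
  -- A uniform defect `d` may be multiplied by the probability of surviving `n` claims: up to `x₂`
  -- the ruin probability already exceeds `ε`, and beyond it the defect is averaged over one step
  -- and disappears on ruin.
  have iter : ∀ d, 0 ≤ d → (∀ x, 0 ≤ x → ε * W x ≤ 1 - φ x + d) →
      ∀ n x, 0 ≤ x → ε * W x ≤ 1 - φ x + d * survival P V τ ξ n x := by
    intro d hd hyp n
    induction n with
    | zero => intro x hx; simpa [survival] using hyp x hx
    | succ n ih =>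
      intro x hx
      have hS := (h.survival_spec (n + 1)).2 x
      rcases lt_or_ge x x₂ with hlt | hge
      · have h1 := hεψ x hx hlt.le
        rw [hψ x hx] at h1
        nlinarith [hS.1, (hW1 x).2]
      have hk := h.integrable_killed (h.survival_spec n).1 (h.survival_spec n).2 x
      have hkφ := h.integrable_killed h.measurable_survivalLim hφ1 x
      have e : 1 - φ x + d * survival P V τ ξ (n + 1) x = ∫ ω,
          ((1 - (Ici 0).indicator φ (V x (τ 0 ω) - ξ 0 ω)) +
          d * (Ici 0).indicator (survival P V τ ξ n) (V x (τ 0 ω) - ξ 0 ω)) ∂P := by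
        have hkφ' : Integrable
            (fun ω => 1 - (Ici 0).indicator φ (V x (τ 0 ω) - ξ 0 ω)) P :=
          (integrable_const _).sub hkφ
        rw [integral_add hkφ' (hk.const_mul d), integral_sub (integrable_const _) hkφ, integral_const_mul, survival_succ,
          show φ x = _ from h.survivalLim_eq x]
        simp [stepOp]
      have hWi := integrable_step (P := P) h.flow.measurable (h.measurable_time 0)
        (h.measurable_claim 0) hW.measurable hW1 x
      calc ε * W x ≤ ε * stepOp P V (τ 0) (ξ 0) W x := by gcongr; exact hstep x hge
        _ = ∫ ω, ε * W (V x (τ 0 ω) - ξ 0 ω) ∂P := by rw [integral_const_mul]; rfl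
        _ ≤ _ := by
          rw [e]
          refine integral_mono (hWi.const_mul _)
            (((integrable_const _).sub hkφ).add (hk.const_mul d)) fun ω => ?_
          simp only
          by_cases hω : V x (τ 0 ω) - ξ 0 ω ∈ Ici (0 : ℝ)
          · simp only [indicator_of_mem hω]; exact ih _ hω
          · simp only [indicator_of_notMem hω]
            nlinarith [(hW1 (V x (τ 0 ω) - ξ 0 ω)).2]
  -- The least admissible defect is attained, and a contraction shows that it is `0`. No convergence
  -- of the surviving reserve to infinity is needed.
  let D : Set ℝ := {d | 0 ≤ d ∧ ∀ x, 0 ≤ x → ε * W x ≤ 1 - φ x + d}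
  have hDne : D.Nonempty := ⟨1, zero_le_one, fun x _ => by nlinarith [(hW1 x).2, (hφ1 x).2]⟩
  have hDbdd : BddBelow D := ⟨0, fun d hd => hd.1⟩
  have hDcl : IsClosed D := by
    have : D = Ici 0 ∩ ⋂ x ∈ Ici (0 : ℝ), {d | ε * W x ≤ 1 - φ x + d} := by
      ext d; simp [D]
    rw [this]
    exact isClosed_Ici.inter (isClosed_biInter fun x _ =>
      isClosed_le continuous_const (continuous_const.add continuous_id))
  have hd := hDcl.csInf_mem hDne hDbdd
  set d := sInf D with hd_def
  have hd0 : d = 0 := by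
    by_contra hne
    have hdpos : 0 < d := lt_of_le_of_ne hd.1 (Ne.symm hne)
    obtain ⟨K, hK⟩ := ((hW0.eventually_lt_const (half_pos hdpos)).and
      (Filter.eventually_ge_atTop 0)).exists
    obtain ⟨κ, hκ, hκψ⟩ := hruin K
    -- Letting `n` tend to infinity replaces `d` by `d * φ x`. On `[0, K]` survival has probability
    -- at most `1 - κ`; beyond `K` the left side is itself below `d / 2`. A positive `d` could
    -- therefore be reduced.
    have hmem : max (d * (1 - κ)) (d / 2) ∈ D := by
      refine ⟨le_max_of_le_right (by linarith), fun x hx => ?_⟩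
      rcases le_or_gt x K with hxK | hxK
      · have h1 := hκψ x hx hxK
        rw [hψ x hx] at h1
        have h2 : ε * W x ≤ 1 - φ x + d * φ x :=
          ge_of_tendsto' (((h.survival_tendsto x).const_mul d).const_add _)
            fun n => iter d hd.1 hd.2 n x hx
        have h3 : d * φ x ≤ d * (1 - κ) := by gcongr; linarith
        linarith [le_max_left (d * (1 - κ)) (d / 2)]
      · have h1 := hW hxK.le
        have h2 := (hW1 x).1
        have h3 := le_max_right (d * (1 - κ)) (d / 2)
        have h4 := (hφ1 x).2
        nlinarith [hK.1]
    have hle := csInf_le hDbdd hmem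
    rw [← hd_def] at hle
    rcases le_max_iff.1 hle with h1 | h1
    · nlinarith
    · linarith
  refine ⟨ε, hε, fun x hx => ?_⟩
  have := hd.2 x hx
  rw [hψ x hx]
  linarith

/-- If the reserve almost surely does not decrease at claims from level `x` onwards, then ruin
is impossible from `x`. -/
theorem ruinProb_eq_zero (h : IsRiskModel P τ ξ v V) {x₁ : ℝ} (hx₁ : 0 ≤ x₁)
    (hstep : ∀ x, x₁ ≤ x → ∀ᵐ ω ∂P, x ≤ V x (τ 0 ω) - ξ 0 ω) :
    ruinProb P V τ ξ x₁ = 0 := by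
  have key : ∀ n x, x₁ ≤ x → survival P V τ ξ n x = 1 := by
    intro n
    induction n with
    | zero => intro x _; simp [survival]
    | succ n ih =>
      intro x hx
      rw [survival_succ, stepOp]
      have : (fun ω => (Ici 0).indicator (survival P V τ ξ n) (V x (τ 0 ω) - ξ 0 ω)) =ᵐ[P]
          fun _ => (1 : ℝ) := by
        filter_upwards [hstep x hx] with ω hω
        rw [indicator_of_mem (mem_Ici.2 (by linarith)), ih _ (hx.trans hω)]
      rw [integral_congr_ae this]
      simp
  rw [h.ruinProb_eq hx₁]
  have := h.survival_tendsto x₁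
  simp only [key _ x₁ le_rfl] at this
  rw [← tendsto_nhds_unique this tendsto_const_nhds]
  simp

end IsRiskModel
end
end LevelDependentRisk

/-! ### The polynomial `Q`: solving the drift equation to finite order. -/

namespace LevelDependentRisk

section formal

open Polynomial

/-- Polynomial approximations of the root of `F(·, u) = 0` that vanishes at `u = 0`. -/
lemma exists_X_pow_dvd_eval {K : Type*} [Field K] (F : K[X][X]) (h0 : (F.coeff 0).coeff 0 = 0)
    (h1 : (F.coeff 1).coeff 0 ≠ 0) (n : ℕ) :
    ∃ Q : K[X], Q.natDegree ≤ n ∧ Q.coeff 0 = 0 ∧ X ^ (n + 1) ∣ F.eval Q := by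
  induction n with
  | zero =>
    refine ⟨0, by simp, by simp, ?_⟩
    rw [zero_add, pow_one, X_dvd_iff, ← coeff_zero_eq_eval_zero]
    exact h0
  | succ n ih =>
    obtain ⟨Q, hdeg, hQ0, g, hg⟩ := ih
    set a := (F.derivative.eval Q).coeff 0 with ha
    have ha1 : a = (F.coeff 1).coeff 0 := by
      obtain ⟨k, hk⟩ := Polynomial.evalSubFactor F.derivative Q 0
      have h2 : F.derivative.eval 0 = F.coeff 1 := by
        rw [← coeff_zero_eq_eval_zero, coeff_derivative]; simp
      have h3 : F.derivative.eval Q = F.coeff 1 + k * Q := by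
        rw [h2, sub_zero] at hk
        linear_combination hk
      rw [ha, h3, coeff_add, mul_coeff_zero, hQ0]
      simp
    -- One step of undetermined coefficients: `c` cancels the leading coefficient of the remainder,
    -- while the quadratic term is divisible by `X ^ (2 * (n + 1))` and is harmless.
    set c := -g.coeff 0 / a with hc
    obtain ⟨k, hk⟩ := Polynomial.binomExpansion F Q (C c * X ^ (n + 1))
    refine ⟨Q + C c * X ^ (n + 1), ?_, ?_, ?_⟩
    · exact natDegree_add_le_of_degree_le (hdeg.trans n.le_succ) (natDegree_C_mul_X_pow_le c _)
    · simp [hQ0]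
    · rw [hk, hg]
      have h4 : X ∣ g + F.derivative.eval Q * C c := by
        rw [X_dvd_iff, coeff_add, mul_coeff_zero, ← ha, coeff_C_zero, hc]
        have : a ≠ 0 := ha1 ▸ h1
        field_simp
        ring
      obtain ⟨w, hw⟩ := h4
      refine ⟨w + k * C c ^ 2 * X ^ n, ?_⟩
      have : X ^ (n + 1) * g + eval Q (derivative F) * (C c * X ^ (n + 1)) +
          k * (C c * X ^ (n + 1)) ^ 2 =
          X ^ (n + 1) * (g + eval Q (derivative F) * C c) + k * C c ^ 2 * X ^ (2 * (n + 1)) := by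
        ring
      rw [this, hw]
      ring

/-- Linearization at the origin: the term of `F.eval Q` quadratic in `Q` is divisible by `X ^ 2`.
This fixes the slope of `Q`, and thereby `r₁`. -/
lemma coeff_one_of_X_sq_dvd_eval {K : Type*} [Field K] {F : K[X][X]} {Q : K[X]}
    (hQ : Q.coeff 0 = 0) (h : X ^ 2 ∣ F.eval Q) :
    (F.coeff 0).coeff 1 + (F.coeff 1).coeff 0 * Q.coeff 1 = 0 := by
  obtain ⟨k, hk⟩ := Polynomial.binomExpansion F 0 Q
  have h2 : F.derivative.eval 0 = F.coeff 1 := by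
    rw [← coeff_zero_eq_eval_zero, coeff_derivative]; simp
  rw [zero_add, h2, ← coeff_zero_eq_eval_zero] at hk
  obtain ⟨q, rfl⟩ := X_dvd_iff.2 hQ
  have h3 : (F.eval (X * q)).coeff 1 = 0 := X_pow_dvd_iff.1 h 1 (by norm_num)
  rw [hk, show F.coeff 0 + F.coeff 1 * (X * q) + k * (X * q) ^ 2 =
    F.coeff 0 + X * (F.coeff 1 * q) + X * (X * (k * q ^ 2)) by ring] at h3
  simpa [coeff_X_mul, mul_coeff_zero] using h3

lemma exists_abs_eval_le (p : ℝ[X]) : ∃ C, 0 ≤ C ∧ ∀ u ∈ Icc (0 : ℝ) 1, |p.eval u| ≤ C := by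
  obtain ⟨C, hC⟩ := isCompact_Icc.exists_bound_of_continuousOn (s := Icc (0 : ℝ) 1)
    p.continuous.continuousOn
  exact ⟨C, (norm_nonneg _).trans (hC 0 (by simp)), fun u hu => hC u hu⟩

end formal

section moments

open Polynomial

variable {Ω : Type*} [mΩ : MeasurableSpace Ω] {P : Measure Ω}

/-- The polynomial `u ↦ E (A + B u) ^ k`. -/
noncomputable def momentPoly (P : Measure Ω) (A B : Ω → ℝ) (k : ℕ) : ℝ[X] :=
  ∑ j ∈ Finset.range (k + 1), C (k.choose j * ∫ ω, A ω ^ j * B ω ^ (k - j) ∂P) * X ^ (k - j)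

lemma integrable_add_mul_pow {A B : Ω → ℝ} {k : ℕ}
    (h : ∀ i j, i + j = k → Integrable (fun ω => A ω ^ i * B ω ^ j) P) (u : ℝ) :
    Integrable (fun ω => (A ω + B ω * u) ^ k) P := by
  simp only [add_pow]
  refine integrable_finsetSum _ fun j hj => ?_
  have := (h j (k - j) (by have := Finset.mem_range.1 hj; omega)).mul_const
    (u ^ (k - j) * k.choose j)
  refine this.congr (Filter.Eventually.of_forall fun ω => ?_)
  simp only; ring

lemma integral_add_mul_pow {A B : Ω → ℝ} {k : ℕ}
    (h : ∀ i j, i + j = k → Integrable (fun ω => A ω ^ i * B ω ^ j) P) (u : ℝ) :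
    ∫ ω, (A ω + B ω * u) ^ k ∂P = (momentPoly P A B k).eval u := by
  have e : ∀ ω, (A ω + B ω * u) ^ k = ∑ j ∈ Finset.range (k + 1),
      (A ω ^ j * B ω ^ (k - j)) * (u ^ (k - j) * k.choose j) := fun ω => by
    rw [add_pow]
    exact Finset.sum_congr rfl fun j _ => by ring
  simp only [e]
  rw [integral_finsetSum _ fun j hj => (h j (k - j)
    (by have := Finset.mem_range.1 hj; omega)).mul_const _, momentPoly, eval_finsetSum]
  refine Finset.sum_congr rfl fun j _ => ?_
  rw [integral_mul_const]
  simp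
  ring

/-- The `n`-th Taylor polynomial of `(exp (-ρ D) - 1) / ρ` in `D`. -/
noncomputable def taylorIncrement (n : ℕ) (ρ D : ℝ) : ℝ :=
  ∑ k ∈ Finset.range n, -(-ρ) ^ k * D ^ (k + 1) / (k + 1).factorial

/-- A polynomial `Q` for which the Taylor polynomial of `(exp (-Q(u) D) - 1) / Q(u)`, with
`D = A + B u`, has mean of order `u ^ n`. -/
theorem exists_poly_taylorIncrement {A B : Ω → ℝ} {n : ℕ} (hn : 2 ≤ n)
    (h : ∀ i j, i + j ≤ n → Integrable (fun ω => A ω ^ i * B ω ^ j) P)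
    (hA : ∫ ω, A ω ∂P = 0) (hA2 : ∫ ω, A ω ^ 2 ∂P ≠ 0) :
    ∃ Q : ℝ[X], Q.natDegree ≤ n - 1 ∧ Q.coeff 0 = 0 ∧
      Q.coeff 1 = 2 * (∫ ω, B ω ∂P) / ∫ ω, A ω ^ 2 ∂P ∧
      ∃ K, 0 ≤ K ∧ ∀ u ∈ Icc (0 : ℝ) 1,
        |∫ ω, taylorIncrement n (Q.eval u) (A ω + B ω * u) ∂P| ≤ K * u ^ n := by
  -- `F` is the mean of `taylorIncrement` as a polynomial in `ρ` over polynomials in `u`. As `A` is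
  -- centred, its order-zero coefficient is `-(∫ B) u`, and its first coefficient at `u = 0` is half
  -- the second moment of `A`, so the root is simple.
  set F : ℝ[X][X] := ∑ k ∈ Finset.range n,
    C (C (-(-1) ^ k / ((k + 1).factorial : ℝ)) * momentPoly P A B (k + 1)) * X ^ k with hF
  have hc : ∀ k < n, F.coeff k = C (-(-1) ^ k / ((k + 1).factorial : ℝ)) *
      momentPoly P A B (k + 1) := fun k hk => by
    rw [hF, finsetSum_coeff]
    simp only [coeff_C_mul_X_pow]
    rw [Finset.sum_ite_eq, if_pos (Finset.mem_range.2 hk)]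
  have hc0 : F.coeff 0 = -C (∫ ω, B ω ∂P) * X := by
    rw [hc 0 (by omega)]
    simp [momentPoly, Finset.sum_range_succ, hA]
  have hc1 : (F.coeff 1).coeff 0 = (∫ ω, A ω ^ 2 ∂P) / 2 := by
    rw [hc 1 (by omega)]
    simp [momentPoly, Finset.sum_range_succ, coeff_X]
    ring
  obtain ⟨Q, hdeg, hQ0, hdvd⟩ := exists_X_pow_dvd_eval F (by rw [hc0]; simp)
    (by rw [hc1]; simpa using hA2) (n - 1)
  rw [show n - 1 + 1 = n by omega] at hdvd
  refine ⟨Q, hdeg, hQ0, ?_, ?_⟩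
  · have := coeff_one_of_X_sq_dvd_eval hQ0 ((pow_dvd_pow X hn).trans hdvd)
    rw [hc0, hc1] at this
    simp at this
    field_simp
    linarith
  · obtain ⟨w, hw⟩ := hdvd
    obtain ⟨K, hK0, hK⟩ := exists_abs_eval_le w
    refine ⟨K, hK0, fun u hu => ?_⟩
    have e : ∫ ω, taylorIncrement n (Q.eval u) (A ω + B ω * u) ∂P = (F.eval Q).eval u := by
      have hi : ∀ k ∈ Finset.range n, Integrable (fun ω => (A ω + B ω * u) ^ (k + 1)) P :=
        fun k hk => integrable_add_mul_pow
          (fun i j hij => h i j (by have := Finset.mem_range.1 hk; omega)) u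
      simp only [taylorIncrement]
      rw [integral_finsetSum _ fun k hk => ((hi k hk).const_mul _).div_const _, hF,
        eval_finsetSum, eval_finsetSum]
      refine Finset.sum_congr rfl fun k hk => ?_
      rw [integral_div, integral_const_mul, integral_add_mul_pow
        (fun i j hij => h i j (by have := Finset.mem_range.1 hk; omega)) u]
      simp only [eval_mul, eval_C, eval_pow, eval_X]
      rw [neg_pow (Q.eval u)]
      ring
    rw [e, hw, eval_mul, eval_pow, eval_X, abs_mul, abs_of_nonneg (pow_nonneg hu.1 n), mul_comm]
    exact mul_le_mul_of_nonneg_right (hK u hu) (pow_nonneg hu.1 n)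

end moments
end LevelDependentRisk

/-! ### Deterministic estimates for one step of the test function. -/

namespace LevelDependentRisk

lemma abs_exp_sub_exp_le {a b c : ℝ} (ha : a ≤ c) (hb : b ≤ c) :
    |Real.exp a - Real.exp b| ≤ Real.exp c * |a - b| := by
  wlog h : b ≤ a generalizing a b
  · rw [abs_sub_comm, abs_sub_comm a b]
    exact this hb ha (le_of_not_ge h)
  rw [abs_of_nonneg (sub_nonneg.2 (Real.exp_le_exp.2 h)), abs_of_nonneg (sub_nonneg.2 h)]
  have h1 := Real.add_one_le_exp (b - a)
  have h2 : Real.exp b = Real.exp a * Real.exp (b - a) := by rw [← Real.exp_add]; ring_nf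
  calc Real.exp a - Real.exp b = Real.exp a * (1 - Real.exp (b - a)) := by rw [h2]; ring
    _ ≤ Real.exp a * (a - b) :=
      mul_le_mul_of_nonneg_left (by linarith) (Real.exp_pos a).le
    _ ≤ Real.exp c * (a - b) := by
      have := Real.exp_le_exp.2 ha
      exact mul_le_mul_of_nonneg_right this (by linarith)

lemma abs_exp_sub_taylor_le {a b c : ℝ} (ha : |a| ≤ c) (hb : |b| ≤ c) (n : ℕ) :
    |Real.exp a - ∑ k ∈ Finset.range n, b ^ k / k.factorial| ≤
      Real.exp c * (|a - b| + |b| ^ n) := by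
  have h1 := abs_exp_sub_exp_le ((le_abs_self a).trans ha) ((le_abs_self b).trans hb)
  have h2 : |Real.exp b - ∑ k ∈ Finset.range n, b ^ k / k.factorial| ≤
      |b| ^ n * Real.exp |b| := by
    have := Complex.norm_exp_sub_sum_le_norm_mul_exp (b : ℂ) n
    rw [show Complex.exp b - ∑ m ∈ Finset.range n, (b : ℂ) ^ m / (m.factorial : ℂ) =
      ((Real.exp b - ∑ k ∈ Finset.range n, b ^ k / k.factorial : ℝ) : ℂ) by push_cast; rfl,
      Complex.norm_real, Complex.norm_real] at this
    simpa using this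
  have h3 : |b| ^ n * Real.exp |b| ≤ Real.exp c * |b| ^ n := by
    rw [mul_comm]; gcongr
  calc _ ≤ |Real.exp a - Real.exp b| +
        |Real.exp b - ∑ k ∈ Finset.range n, b ^ k / k.factorial| := abs_sub_le _ _ _
    _ ≤ _ := by rw [mul_add]; exact add_le_add h1 (h2.trans h3)

/-- Termwise integration. The sign is negative because `taylorIncrement` models the change of a tail
integral, which decreases as its lower limit moves up. -/
lemma integral_taylor_exp (n : ℕ) (ρ x D : ℝ) :
    ∫ z in x..(x + D), ∑ k ∈ Finset.range n, (-(ρ * (z - x))) ^ k / k.factorial =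
      -taylorIncrement n ρ D := by
  have h := intervalIntegral.integral_comp_sub_right (a := x) (b := x + D)
    (fun y => ∑ k ∈ Finset.range n, (-(ρ * y)) ^ k / k.factorial) x
  rw [h, sub_self, add_sub_cancel_left, intervalIntegral.integral_finsetSum
    (fun k _ => Continuous.intervalIntegrable (by fun_prop) _ _), taylorIncrement,
    ← Finset.sum_neg_distrib]
  refine Finset.sum_congr rfl fun k _ => ?_
  have e : ∀ y : ℝ, (-(ρ * y)) ^ k / (k.factorial : ℝ) = (-ρ) ^ k / k.factorial * y ^ k := fun y => by
    rw [← neg_mul, mul_pow]; ring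
  simp only [e]
  rw [intervalIntegral.integral_const_mul, integral_pow, Nat.factorial_succ]
  push_cast
  field_simp
  simp

/-- Two replacements under the integral: `R` by its tangent line at `x`, costing `L * D ^ 2`, then
the exponential by its Taylor polynomial, costing `(ρ * |D|) ^ n`. The interval contributes the
factor `|D|`. -/
lemma abs_integral_exp_add_taylorIncrement_le {R : ℝ → ℝ} {n : ℕ} {ρ x D c L : ℝ}
    (hR : ContinuousOn R (uIcc x (x + D))) (hρ : 0 ≤ ρ) (hL : 0 ≤ L)
    (hloc : ∀ z ∈ uIcc x (x + D), |R z - R x - ρ * (z - x)| ≤ L * (z - x) ^ 2)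
    (hc : ρ * |D| + L * D ^ 2 ≤ c) :
    |(∫ z in x..(x + D), Real.exp (-(R z - R x))) + taylorIncrement n ρ D| ≤
      Real.exp c * (L * D ^ 2 + (ρ * |D|) ^ n) * |D| := by
  have hi1 : IntervalIntegrable (fun z => Real.exp (-(R z - R x))) volume x (x + D) :=
    ContinuousOn.intervalIntegrable (by fun_prop)
  have hi2 : IntervalIntegrable
      (fun z => ∑ k ∈ Finset.range n, (-(ρ * (z - x))) ^ k / (k.factorial : ℝ)) volume x (x + D) :=
    Continuous.intervalIntegrable (by fun_prop) _ _
  have e : (∫ z in x..(x + D), Real.exp (-(R z - R x))) + taylorIncrement n ρ D =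
      ∫ z in x..(x + D), (Real.exp (-(R z - R x)) -
        ∑ k ∈ Finset.range n, (-(ρ * (z - x))) ^ k / (k.factorial : ℝ)) := by
    rw [intervalIntegral.integral_sub hi1 hi2, integral_taylor_exp, sub_neg_eq_add]
  rw [e, ← Real.norm_eq_abs]
  have := intervalIntegral.norm_integral_le_of_norm_le_const (a := x) (b := x + D)
    (C := Real.exp c * (L * D ^ 2 + (ρ * |D|) ^ n))
    (f := fun z => (Real.exp (-(R z - R x)) -
        ∑ k ∈ Finset.range n, (-(ρ * (z - x))) ^ k / (k.factorial : ℝ))) ?_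
  · simpa using this
  intro z hz
  have hz' := uIoc_subset_uIcc hz
  have hzD : |z - x| ≤ |D| := by
    have := abs_sub_left_of_mem_uIcc hz'
    simpa using this
  have h1 := hloc z hz'
  have hsq : (z - x) ^ 2 ≤ D ^ 2 := sq_le_sq.2 hzD
  have h2 : L * (z - x) ^ 2 ≤ L * D ^ 2 := by gcongr
  have h3 : |ρ * (z - x)| ≤ ρ * |D| := by rw [abs_mul, abs_of_nonneg hρ]; gcongr
  have hb : |-(ρ * (z - x))| ≤ c := by
    rw [abs_neg]; have := mul_nonneg hL (sq_nonneg D); linarith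
  have ha : |-(R z - R x)| ≤ c := by
    rw [abs_neg]
    calc |R z - R x| = |(R z - R x - ρ * (z - x)) + ρ * (z - x)| := by ring_nf
      _ ≤ _ := abs_add_le _ _
      _ ≤ c := by linarith
  refine (abs_exp_sub_taylor_le ha hb n).trans ?_
  have h4 : |-(R z - R x) - -(ρ * (z - x))| ≤ L * D ^ 2 := by
    rw [show -(R z - R x) - -(ρ * (z - x)) = -(R z - R x - ρ * (z - x)) by ring, abs_neg]
    linarith
  have h5 : |-(ρ * (z - x))| ^ n ≤ (ρ * |D|) ^ n := by rw [abs_neg]; gcongr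
  gcongr

/-- A Lipschitz bound, used to exchange the true step for its affine model `A + B u`. -/
lemma abs_taylorIncrement_sub_le {n : ℕ} {ρ c D D' Y : ℝ} (hρ : 0 ≤ ρ) (hρc : ρ ≤ c)
    (hD : |D| ≤ Y) (hD' : |D'| ≤ Y) :
    |taylorIncrement n ρ D - taylorIncrement n ρ D'| ≤
      n * ((1 + c) ^ n * (1 + Y) ^ (n - 1)) * |D - D'| := by
  have hY : 0 ≤ Y := (abs_nonneg _).trans hD
  rw [taylorIncrement, taylorIncrement, ← Finset.sum_sub_distrib]
  refine (Finset.abs_sum_le_sum_abs _ _).trans ?_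
  have : ∀ k ∈ Finset.range n, |-(-ρ) ^ k * D ^ (k + 1) / ((k + 1).factorial : ℝ) -
      -(-ρ) ^ k * D' ^ (k + 1) / ((k + 1).factorial : ℝ)| ≤
      (1 + c) ^ n * (1 + Y) ^ (n - 1) * |D - D'| := fun k hk => by
    have hk' := Finset.mem_range.1 hk
    have h1 := abs_pow_sub_pow_le D D' (k + 1)
    rw [← sub_div, ← mul_sub, abs_div, abs_mul, abs_neg, abs_pow, abs_neg, abs_of_nonneg hρ,
      Nat.abs_cast, div_le_iff₀ (by positivity)]
    have hf : ((k + 1 : ℕ) : ℝ) ≤ ((k + 1).factorial : ℝ) := by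
      exact_mod_cast Nat.self_le_factorial (k + 1)
    have h2 : ρ ^ k ≤ (1 + c) ^ n := by
      calc ρ ^ k ≤ (1 + c) ^ k := by gcongr; linarith
        _ ≤ (1 + c) ^ n := pow_le_pow_right₀ (by linarith) hk'.le
    have h3 : max |D| |D'| ^ (k + 1 - 1) ≤ (1 + Y) ^ (n - 1) := by
      calc max |D| |D'| ^ (k + 1 - 1) ≤ (1 + Y) ^ k := by
            rw [Nat.add_sub_cancel]
            gcongr
            exact (max_le hD hD').trans (by linarith)
        _ ≤ (1 + Y) ^ (n - 1) := pow_le_pow_right₀ (by linarith) (by omega)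
    have hc0 : 0 ≤ c := hρ.trans hρc
    calc ρ ^ k * |D ^ (k + 1) - D' ^ (k + 1)|
        ≤ (1 + c) ^ n * (|D - D'| * ((k + 1 : ℕ) : ℝ) * max |D| |D'| ^ (k + 1 - 1)) := by
          gcongr
      _ ≤ (1 + c) ^ n * (|D - D'| * ((k + 1).factorial : ℝ) * (1 + Y) ^ (n - 1)) := by
          gcongr
      _ = _ := by ring
  refine (Finset.sum_le_sum this).trans ?_
  rw [Finset.sum_const, Finset.card_range, nsmul_eq_mul]
  linarith

/-- When `u * Z` is at least `1`, multiplying a lower-order term by powers of it raises the term to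
top order, so on large steps even the main term has the size of the error. -/
lemma abs_taylorIncrement_le {n : ℕ} {ρ c u b Z D : ℝ} (hρ : 0 ≤ ρ) (hρc : ρ ≤ c * u)
    (hc : 0 ≤ c) (hu : 0 ≤ u) (hb : 0 ≤ b) (hZ : 0 ≤ Z) (hD : |D| ≤ b * Z) (huZ : 1 ≤ u * Z) :
    |taylorIncrement n ρ D| ≤ n * ((1 + c) ^ n * (1 + b) ^ (n + 1)) * (u ^ n * Z ^ (n + 1)) := by
  rw [taylorIncrement]
  refine (Finset.abs_sum_le_sum_abs _ _).trans ?_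
  have : ∀ k ∈ Finset.range n, |-(-ρ) ^ k * D ^ (k + 1) / ((k + 1).factorial : ℝ)| ≤
      (1 + c) ^ n * (1 + b) ^ (n + 1) * (u ^ n * Z ^ (n + 1)) := fun k hk => by
    have hk' := Finset.mem_range.1 hk
    rw [abs_div, abs_mul, abs_neg, abs_pow, abs_neg, abs_of_nonneg hρ, Nat.abs_cast, abs_pow]
    have hf : (1 : ℝ) ≤ ((k + 1).factorial : ℝ) := by
      exact_mod_cast Nat.one_le_iff_ne_zero.2 (Nat.factorial_ne_zero _)
    have h2 : c ^ k ≤ (1 + c) ^ n := by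
      calc c ^ k ≤ (1 + c) ^ k := by gcongr; linarith
        _ ≤ (1 + c) ^ n := pow_le_pow_right₀ (by linarith) hk'.le
    have h3 : b ^ (k + 1) ≤ (1 + b) ^ (n + 1) := by
      calc b ^ (k + 1) ≤ (1 + b) ^ (k + 1) := by gcongr; linarith
        _ ≤ (1 + b) ^ (n + 1) := pow_le_pow_right₀ (by linarith) (by omega)
    have h4 : u ^ k * Z ^ (k + 1) ≤ u ^ n * Z ^ (n + 1) := by
      have h5 : (1 : ℝ) ≤ (u * Z) ^ (n - k) := one_le_pow₀ huZ
      calc u ^ k * Z ^ (k + 1) ≤ u ^ k * Z ^ (k + 1) * (u * Z) ^ (n - k) :=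
            le_mul_of_one_le_right (by positivity) h5
        _ = u ^ (k + (n - k)) * Z ^ (k + (n - k) + 1) := by rw [mul_pow]; ring
        _ = _ := by rw [show k + (n - k) = n by omega]
    calc ρ ^ k * |D| ^ (k + 1) / ((k + 1).factorial : ℝ) ≤ ρ ^ k * |D| ^ (k + 1) :=
          div_le_self (by positivity) hf
      _ ≤ (c * u) ^ k * (b * Z) ^ (k + 1) := by gcongr
      _ = c ^ k * b ^ (k + 1) * (u ^ k * Z ^ (k + 1)) := by rw [mul_pow, mul_pow]; ring
      _ ≤ _ := by gcongr
  refine (Finset.sum_le_sum this).trans ?_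
  rw [Finset.sum_const, Finset.card_range, nsmul_eq_mul]
  linarith

lemma pow_le_one_add_pow_mul {Z E : ℝ} (hZ : 0 ≤ Z) (hE : 1 ≤ E) {k n : ℕ} (hk : k ≤ n) :
    Z ^ k ≤ (1 + Z) ^ n * E := by
  calc Z ^ k ≤ (1 + Z) ^ k := by gcongr; linarith
    _ ≤ (1 + Z) ^ n := pow_le_pow_right₀ (by linarith) hk
    _ ≤ (1 + Z) ^ n * E := le_mul_of_one_le_right (by positivity) hE

lemma exp_error_le {n : ℕ} (hn : 2 ≤ n) {K c b x u ρ e Z Δ G : ℝ} (hK : 0 ≤ K) (hc : 0 ≤ c)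
    (hx : 0 < x) (hu : 0 < u) (hρ : 0 ≤ ρ) (hρc : ρ ≤ c * u) (hb : 0 ≤ b) (hZ : 0 ≤ Z)
    (hune : u ^ n ≤ e) (huxe : u / x ≤ e) (hΔ : |Δ| ≤ b * Z)
    (hZG : ∀ k ≤ n + 1, Z ^ k ≤ G) :
    (K * (u / x) * Δ ^ 2 + (ρ * |Δ|) ^ n) * |Δ| ≤ (K * b ^ 3 + (c * b) ^ n * b) * (G * e) := by
  have he : 0 ≤ e := le_trans (by positivity) huxe
  have hG0 : 0 ≤ G := le_trans (by positivity) (hZG 0 (by omega))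
  have hΔ2 : Δ ^ 2 ≤ (b * Z) ^ 2 := by rw [← sq_abs Δ]; gcongr
  have ha : K * (u / x) * Δ ^ 2 * |Δ| ≤ K * b ^ 3 * (G * e) := by
    calc K * (u / x) * Δ ^ 2 * |Δ| ≤ K * e * (b * Z) ^ 2 * (b * Z) := by gcongr
      _ = K * b ^ 3 * (Z ^ 3 * e) := by ring
      _ ≤ K * b ^ 3 * (G * e) := by
        have := hZG 3 (by omega)
        gcongr
  have hb' : (ρ * |Δ|) ^ n * |Δ| ≤ (c * b) ^ n * b * (G * e) := by
    calc (ρ * |Δ|) ^ n * |Δ| ≤ (c * u * (b * Z)) ^ n * (b * Z) := by gcongr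
      _ = (c * b) ^ n * b * (Z ^ (n + 1) * u ^ n) := by
        rw [show c * u * (b * Z) = (c * b) * (Z * u) by ring, mul_pow, mul_pow Z]; ring
      _ ≤ (c * b) ^ n * b * (G * e) := by
        have := hZG (n + 1) le_rfl
        gcongr
  rw [add_mul, add_mul]
  exact add_le_add ha hb'

lemma increment_error_le {n : ℕ} (hn : 2 ≤ n) {K₂ c b e Z d E : ℝ} (hc : 0 ≤ c) (hb : 0 ≤ b)
    (hZ : 0 ≤ Z) (hE : 1 ≤ E) (hK₂ : 0 ≤ K₂) (he : 0 ≤ e) (hd : d ≤ K₂ * (1 + Z) ^ 2 * e) :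
    n * ((1 + c) ^ n * (1 + b * Z) ^ (n - 1)) * d ≤
      n * ((1 + c) ^ n * (1 + b) ^ (n - 1)) * K₂ * ((1 + Z) ^ (n + 1) * E * e) := by
  have ha : (1 + b * Z) ^ (n - 1) * (1 + Z) ^ 2 ≤ (1 + b) ^ (n - 1) * ((1 + Z) ^ (n + 1) * E) := by
    calc (1 + b * Z) ^ (n - 1) * (1 + Z) ^ 2 ≤
          ((1 + b) * (1 + Z)) ^ (n - 1) * (1 + Z) ^ 2 := by gcongr; nlinarith
      _ = (1 + b) ^ (n - 1) * (1 + Z) ^ (n - 1 + 2) := by rw [mul_pow]; ring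
      _ = (1 + b) ^ (n - 1) * (1 + Z) ^ (n + 1) := by
        rw [show n - 1 + 2 = n + 1 by omega]
      _ ≤ (1 + b) ^ (n - 1) * ((1 + Z) ^ (n + 1) * E) := by
        gcongr; exact le_mul_of_one_le_right (by positivity) hE
  calc n * ((1 + c) ^ n * (1 + b * Z) ^ (n - 1)) * d
      ≤ n * ((1 + c) ^ n * (1 + b * Z) ^ (n - 1)) * (K₂ * (1 + Z) ^ 2 * e) := by gcongr
    _ = n * (1 + c) ^ n * K₂ * e * ((1 + b * Z) ^ (n - 1) * (1 + Z) ^ 2) := by ring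
    _ ≤ n * (1 + c) ^ n * K₂ * e * ((1 + b) ^ (n - 1) * ((1 + Z) ^ (n + 1) * E)) := by gcongr
    _ = _ := by ring

/-- Expansion of the increment of `∫ exp (-R)` over a small step of the reserve. -/
lemma abs_increment_le_of_small {n : ℕ} (hn : 2 ≤ n) {K K₂ c b E : ℝ} (hK : 0 ≤ K)
    (hK₂ : 0 ≤ K₂) (hc : 0 ≤ c) (hb : 0 ≤ b) (hE : 1 ≤ E) {R : ℝ → ℝ} {x₁ x u ρ e Z Δ D : ℝ}
    (hx : 0 < x) (hx₁ : x₁ ≤ x / 2) (hu : 0 < u) (hu1 : u ≤ 1) (hρ : 0 ≤ ρ) (hρc : ρ ≤ c * u)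
    (hRc : ContinuousOn R (Ici x₁))
    (hloc : ∀ z, x / 2 ≤ z → |R z - R x - ρ * (z - x)| ≤ K * (u / x) * (z - x) ^ 2)
    (hbu : b ≤ u * (x / 2)) (hune : u ^ n ≤ e) (huxe : u / x ≤ e) (hZ : 0 ≤ Z)
    (hΔ : |Δ| ≤ b * Z) (hD : |D| ≤ b * Z) (hΔD : |Δ - D| ≤ K₂ * (1 + Z) ^ 2 * e)
    (hA : u * Z ≤ 1) :
    |-(∫ z in x..(max (x + Δ) x₁), Real.exp (-(R z - R x))) - taylorIncrement n ρ D| ≤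
      (Real.exp (c * b + K * b) * (K * b ^ 3 + (c * b) ^ n * b) +
        n * ((1 + c) ^ n * (1 + b) ^ (n - 1)) * K₂) * ((1 + Z) ^ (n + 1) * E * e) := by
  have he : 0 ≤ e := le_trans (by positivity) huxe
  -- The step is at most `x / 2`: it stays where the quadratic bound on `R` holds, and the
  -- truncation at `x₁` is inactive.
  have hbZ : b * Z ≤ x / 2 := by
    have h1 : b * Z ≤ u * (x / 2) * Z := by gcongr
    have h2 : u * (x / 2) * Z = (u * Z) * (x / 2) := by ring
    nlinarith
  have hΔ1 := abs_le.1 hΔ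
  rw [max_eq_left (show x₁ ≤ x + Δ by linarith)]
  have hsub : uIcc x (x + Δ) ⊆ Ici (x / 2) := by
    intro z hz
    have := abs_sub_left_of_mem_uIcc hz
    have h2 := abs_le.1 (this.trans (by simpa using hΔ : |x + Δ - x| ≤ b * Z))
    simp only [mem_Ici]; linarith
  have hΔ2 : Δ ^ 2 ≤ (b * Z) ^ 2 := by rw [← sq_abs Δ]; gcongr
  have ha : ρ * |Δ| ≤ c * b := by
    calc ρ * |Δ| ≤ c * u * (b * Z) := by gcongr
      _ = c * b * (u * Z) := by ring
      _ ≤ c * b := mul_le_of_le_one_right (by positivity) hA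
  have hb' : K * (u / x) * Δ ^ 2 ≤ K * b := by
    calc K * (u / x) * Δ ^ 2 ≤ K * (u / x) * (b * Z) ^ 2 := by gcongr
      _ = K * b * (u * Z) * (b * Z / x) := by ring
      _ ≤ K * b * 1 * 1 := by
        gcongr
        rw [div_le_one hx]; linarith
      _ = K * b := by ring
  have h1 := abs_integral_exp_add_taylorIncrement_le (n := n) (ρ := ρ) (x := x) (D := Δ)
    (c := c * b + K * b) (L := K * (u / x)) (hRc.mono (hsub.trans (Ici_subset_Ici.2 hx₁))) hρ
    (by positivity) (fun z hz => hloc z (hsub hz)) (by linarith)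
  have h2 := abs_taylorIncrement_sub_le (n := n) hρ
    (hρc.trans (mul_le_of_le_one_right hc hu1)) hΔ hD
  have h3 := exp_error_le hn hK hc hx hu hρ hρc hb hZ hune huxe hΔ
    (fun k hk => pow_le_one_add_pow_mul hZ hE hk)
  have h4 := increment_error_le hn hc hb hZ hE hK₂ he hΔD
  have h5 := mul_le_mul_of_nonneg_left h3 (Real.exp_pos (c * b + K * b)).le
  rw [mul_assoc] at h1
  have h6 := (abs_le.1 (h1.trans h5))
  have h7 := (abs_le.1 (h2.trans h4))
  rw [← mul_assoc] at h6
  rw [add_mul, abs_le]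
  constructor <;> linarith [h6.1, h6.2, h7.1, h7.2]

/-- Bound for the increment of `∫ exp (-R)` over a large step of the reserve. -/
lemma abs_increment_le_of_large {n : ℕ} {c b κ β : ℝ} (hc : 0 ≤ c) (hb : 0 ≤ b) (hκ : 0 ≤ κ)
    (hβ : 0 ≤ β) {R : ℝ → ℝ} {x₁ x u ρ e Z s Δ D : ℝ} (hx₁ : x₁ ≤ x) (hu : 0 < u)
    (hρ : 0 ≤ ρ) (hρc : ρ ≤ c * u) (hRm : MonotoneOn R (Ici x₁))
    (hup : ∀ z, x₁ ≤ z → z ≤ x → R x - R z ≤ κ * (x - z) ^ β) (hune : u ^ n ≤ e) (hZ : 0 ≤ Z)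
    (hs : 0 ≤ s) (hΔs : -s ≤ Δ) (hΔ : |Δ| ≤ b * Z) (hD : |D| ≤ b * Z) (hA : 1 ≤ u * Z) :
    |-(∫ z in x..(max (x + Δ) x₁), Real.exp (-(R z - R x))) - taylorIncrement n ρ D| ≤
      (b + n * ((1 + c) ^ n * (1 + b) ^ (n + 1))) *
        ((1 + Z) ^ (n + 1) * Real.exp (κ * s ^ β) * e) := by
  have he : 0 ≤ e := le_trans (by positivity) hune
  have hexp1 : 1 ≤ Real.exp (κ * s ^ β) := Real.one_le_exp (by positivity)
  have hm : |max (x + Δ) x₁ - x| ≤ b * Z := by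
    refine le_trans ?_ hΔ
    rcases le_total (x + Δ) x₁ with h | h
    · rw [max_eq_right h, abs_of_nonpos (by linarith)]
      exact le_trans (by linarith) (neg_le_abs Δ)
    · rw [max_eq_left h]; simp
  -- This factor supplies the missing `u ^ n` at the price of `n` extra powers of `Z`, which the
  -- moment assumptions pay for.
  have hpow : (1 : ℝ) ≤ (u * Z) ^ n := one_le_pow₀ hA
  have h1 : |∫ z in x..(max (x + Δ) x₁), Real.exp (-(R z - R x))| ≤
      b * ((1 + Z) ^ (n + 1) * Real.exp (κ * s ^ β) * e) := by
    have h2 : |∫ z in x..(max (x + Δ) x₁), Real.exp (-(R z - R x))| ≤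
        Real.exp (κ * s ^ β) * |max (x + Δ) x₁ - x| := by
      rw [← Real.norm_eq_abs]
      refine intervalIntegral.norm_integral_le_of_norm_le_const fun z hz => ?_
      rw [Real.norm_eq_abs, abs_of_pos (Real.exp_pos _)]
      refine Real.exp_le_exp.2 ?_
      rcases le_total x z with hxz | hxz
      · have := hRm (mem_Ici.2 hx₁) (mem_Ici.2 (hx₁.trans hxz)) hxz
        have : 0 ≤ κ * s ^ β := by positivity
        linarith
      · have hz1 : max (x + Δ) x₁ ≤ z := by
          rcases (mem_uIoc.1 hz) with h | h
          · exact absurd h.1 (not_lt.2 hxz)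
          · exact h.1.le
        have h3 := hup z ((le_max_right _ _).trans hz1) hxz
        have h4 : x - z ≤ s := by
          have := (le_max_left _ _).trans hz1
          linarith
        have h5 : κ * (x - z) ^ β ≤ κ * s ^ β :=
          mul_le_mul_of_nonneg_left (Real.rpow_le_rpow (by linarith) h4 hβ) hκ
        linarith
    calc _ ≤ Real.exp (κ * s ^ β) * (b * Z) := h2.trans (by gcongr)
      _ ≤ Real.exp (κ * s ^ β) * (b * Z) * (u * Z) ^ n :=
        le_mul_of_one_le_right (by positivity) hpow
      _ = b * (Z ^ (n + 1) * Real.exp (κ * s ^ β) * u ^ n) := by rw [mul_pow]; ring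
      _ ≤ b * ((1 + Z) ^ (n + 1) * Real.exp (κ * s ^ β) * e) := by
        have : Z ^ (n + 1) ≤ (1 + Z) ^ (n + 1) := by gcongr; linarith
        gcongr
  have h2 := abs_taylorIncrement_le (n := n) hρ hρc hc hu.le hb hZ hD hA
  have h3 : u ^ n * Z ^ (n + 1) ≤ (1 + Z) ^ (n + 1) * Real.exp (κ * s ^ β) * e := by
    rw [mul_comm]
    exact mul_le_mul (pow_le_one_add_pow_mul hZ hexp1 le_rfl) hune (by positivity) (by positivity)
  have h4 := h2.trans (mul_le_mul_of_nonneg_left h3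
    (show (0 : ℝ) ≤ n * ((1 + c) ^ n * (1 + b) ^ (n + 1)) by positivity))
  have h6 := abs_le.1 h1
  have h7 := abs_le.1 h4
  rw [add_mul, abs_le]
  constructor <;> linarith [h6.1, h6.2, h7.1, h7.2]

/-- Uniform expansion of the increment of `∫ exp (-R)` over one step of the reserve. -/
lemma exists_abs_increment_le (n : ℕ) (hn : 2 ≤ n) {K K₂ c b κ β : ℝ} (hK : 0 ≤ K)
    (hK₂ : 0 ≤ K₂) (hc : 0 ≤ c) (hb : 0 ≤ b) (hκ : 0 ≤ κ) (hβ : 0 ≤ β) :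
    ∃ C, 0 ≤ C ∧ ∀ (R : ℝ → ℝ) (x₁ x u ρ e t s Δ D : ℝ), 0 < x → x₁ ≤ x / 2 → 0 < u → u ≤ 1 →
      0 ≤ ρ → ρ ≤ c * u → ContinuousOn R (Ici x₁) → MonotoneOn R (Ici x₁) →
      (∀ z, x / 2 ≤ z → |R z - R x - ρ * (z - x)| ≤ K * (u / x) * (z - x) ^ 2) →
      (∀ z, x₁ ≤ z → z ≤ x → R x - R z ≤ κ * (x - z) ^ β) →
      b ≤ u * (x / 2) → u ^ n ≤ e → u / x ≤ e → 0 ≤ t → 0 ≤ s → -s ≤ Δ →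
      |Δ| ≤ b * (t + s) → |D| ≤ b * (t + s) → |Δ - D| ≤ K₂ * (1 + (t + s)) ^ 2 * e →
      |-(∫ z in x..(max (x + Δ) x₁), Real.exp (-(R z - R x))) - taylorIncrement n ρ D| ≤
        C * ((1 + (t + s)) ^ (n + 1) * Real.exp (κ * s ^ β) * e) := by
  refine ⟨(Real.exp (c * b + K * b) * (K * b ^ 3 + (c * b) ^ n * b) +
        n * ((1 + c) ^ n * (1 + b) ^ (n - 1)) * K₂) +
        (b + n * ((1 + c) ^ n * (1 + b) ^ (n + 1))), by positivity, ?_⟩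
  intro R x₁ x u ρ e t s Δ D hx hx₁ hu hu1 hρ hρc hRc hRm hloc hup hbu hune huxe ht hs hΔs hΔ hD hΔD
  have hZ : 0 ≤ t + s := by positivity
  have he : 0 ≤ e := le_trans (by positivity) huxe
  have hexp1 : 1 ≤ Real.exp (κ * s ^ β) := Real.one_le_exp (by positivity)
  -- Below this threshold the exponents `ρ * |Δ|` and `K * (u / x) * Δ ^ 2` are bounded and the
  -- expansion applies; above it crude bounds already have the right order.
  rcases le_total (u * (t + s)) 1 with hA | hA
  · refine (abs_increment_le_of_small hn hK hK₂ hc hb hexp1 hx hx₁ hu hu1 hρ hρc hRc hloc hbu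
      hune huxe hZ hΔ hD hΔD hA).trans (mul_le_mul_of_nonneg_right ?_ (by positivity))
    exact le_add_of_nonneg_right (by positivity)
  · refine (abs_increment_le_of_large hc hb hκ hβ (by linarith) hu hρ hρc hRm hup hune hZ hs hΔs
      hΔ hD hA).trans (mul_le_mul_of_nonneg_right ?_ (by positivity))
    exact le_add_of_nonneg_left (by positivity)

/-- `k` stands for the difference of a perturbed and an unperturbed integrand. Its sign makes steps
in both directions contribute nonnegatively, and a step below `x - δ` covers the whole triangle over
`[x - δ, x]`, of area `q * δ ^ 2 / 4`. The margin `x₁ + 1 ≤ x` keeps this triangle above the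
cut-off. -/
lemma gain_le_neg_integral {k : ℝ → ℝ} {x₁ x Δ δ q : ℝ} (hk : ContinuousOn k (Ici x₁))
    (hx : x₁ + 1 ≤ x) (hδ : 0 ≤ δ) (hδ1 : δ ≤ 1)
    (hneg : ∀ z, x ≤ z → k z ≤ 0) (hpos : ∀ z, x₁ ≤ z → z ≤ x → 0 ≤ k z)
    (hq : ∀ z, x - δ ≤ z → z ≤ x → q * (x - z) / 2 ≤ k z) :
    (if Δ < -δ then q * δ ^ 2 / 4 else 0) ≤ -∫ z in x..(max (x + Δ) x₁), k z := by
  have hi : ∀ a b, x₁ ≤ a → x₁ ≤ b → IntervalIntegrable k volume a b := fun a b ha hb =>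
    (hk.mono fun z hz => (le_min ha hb).trans hz.1).intervalIntegrable
  rcases le_total 0 Δ with h0 | h0
  · rw [if_neg (by linarith), max_eq_left (by linarith), ← intervalIntegral.integral_neg]
    exact intervalIntegral.integral_nonneg (by linarith)
      fun z hz => by have := hneg z hz.1; linarith
  set m := max (x + Δ) x₁ with hm
  have hmx : m ≤ x := max_le (by linarith) (by linarith)
  have hxm : x₁ ≤ m := le_max_right _ _
  rw [← intervalIntegral.integral_symm]
  split_ifs with hΔ
  · have hmδ : m ≤ x - δ := max_le (by linarith) (by linarith)
    rw [← intervalIntegral.integral_add_adjacent_intervals (hi m (x - δ) hxm (by linarith))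
      (hi (x - δ) x (by linarith) (by linarith))]
    have h1 : 0 ≤ ∫ z in m..(x - δ), k z := intervalIntegral.integral_nonneg hmδ
      fun z hz => hpos z (hxm.trans hz.1) (by linarith [hz.2])
    have h2 : ∫ z in (x - δ)..x, q * (x - z) / 2 ≤ ∫ z in (x - δ)..x, k z :=
      intervalIntegral.integral_mono_on (by linarith)
        (Continuous.intervalIntegrable (by fun_prop) _ _)
        (hi (x - δ) x (by linarith) (by linarith)) fun z hz => hq z hz.1 hz.2
    have h3 : ∫ z in (x - δ)..x, q * (x - z) / 2 = q * δ ^ 2 / 4 := by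
      have := intervalIntegral.integral_comp_sub_left (a := x - δ) (b := x)
        (fun y : ℝ => q * y / 2) x
      rw [this, sub_self, sub_sub_cancel, intervalIntegral.integral_div,
        intervalIntegral.integral_const_mul, integral_id]
      ring
    linarith
  · exact intervalIntegral.integral_nonneg hmx fun z hz => hpos z (hxm.trans hz.1) hz.2

end LevelDependentRisk

/-! ### The exponent `R` and its tail integral. -/

namespace LevelDependentRisk

section rpow

variable {α : ℝ}

lemma hasDerivAt_rpow_neg {z : ℝ} (hz : 0 < z) :
    HasDerivAt (fun y : ℝ => y ^ (-α)) (-α * (z ^ (-α) / z)) z := by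
  have := Real.hasDerivAt_rpow_const (x := z) (p := -α) (Or.inl hz.ne')
  rwa [Real.rpow_sub_one hz.ne'] at this

lemma rpow_neg_div_antitone (hα : 0 < α) {x z : ℝ} (hx : 0 < x) (hxz : x ≤ z) :
    z ^ (-α) / z ≤ x ^ (-α) / x := by
  have h1 : z ^ (-α) ≤ x ^ (-α) := Real.rpow_le_rpow_of_nonpos hx hxz (by linarith)
  have h2 : 0 ≤ x ^ (-α) := by positivity
  gcongr

lemma abs_rpow_neg_sub_le (hα : 0 < α) {x z : ℝ} (hx : 0 < x) (hxz : x ≤ z) :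
    |z ^ (-α) - x ^ (-α)| ≤ α * (x ^ (-α) / x) * (z - x) := by
  have := Convex.norm_image_sub_le_of_norm_hasDerivWithin_le (s := Ici x)
    (f := fun y : ℝ => y ^ (-α)) (f' := fun y => -α * (y ^ (-α) / y))
    (C := α * (x ^ (-α) / x)) (x := x) (y := z)
    (fun y hy => (hasDerivAt_rpow_neg (hx.trans_le hy)).hasDerivWithinAt) ?_ (convex_Ici x)
    self_mem_Ici hxz
  · rwa [Real.norm_eq_abs, Real.norm_eq_abs, abs_of_nonneg (sub_nonneg.2 hxz)] at this
  · intro y hy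
    have hy0 : 0 < y := hx.trans_le hy
    rw [Real.norm_eq_abs, abs_mul, abs_neg, abs_of_pos hα, abs_of_pos (by positivity)]
    exact mul_le_mul_of_nonneg_left (rpow_neg_div_antitone hα hx hy) hα.le

lemma rpow_neg_le_one (hα : 0 < α) {x : ℝ} (hx : 1 ≤ x) : x ^ (-α) ≤ 1 :=
  Real.rpow_le_one_of_one_le_of_nonpos hx (by linarith)

lemma tendsto_rpow_neg (hα : 0 < α) :
    Filter.Tendsto (fun x : ℝ => x ^ (-α)) Filter.atTop (nhds 0) := tendsto_rpow_neg_atTop hα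

end rpow

section exponent

open Polynomial

variable {α : ℝ} {Q : ℝ[X]} {R : ℝ → ℝ}

/-- Near infinity `Q (x ^ (-α))` is equivalent to its leading term. -/
lemma eventually_eval_rpow_neg (hα : 0 < α) (hQ : Q.coeff 0 = 0) {δ : ℝ} (hδ : 0 < δ) :
    ∀ᶠ x : ℝ in Filter.atTop, (Q.coeff 1 - δ) * x ^ (-α) ≤ Q.eval (x ^ (-α)) ∧
      Q.eval (x ^ (-α)) ≤ (Q.coeff 1 + δ) * x ^ (-α) := by
  obtain ⟨q, rfl⟩ := X_dvd_iff.2 hQ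
  have hq : Filter.Tendsto (fun x : ℝ => q.eval (x ^ (-α))) Filter.atTop (nhds (q.coeff 0)) := by
    rw [coeff_zero_eq_eval_zero]
    exact (q.continuous.tendsto 0).comp (tendsto_rpow_neg hα)
  have h1 : (X * q).coeff 1 = q.coeff 0 := by simp [coeff_X_mul]
  rw [h1]
  filter_upwards [hq.eventually (Icc_mem_nhds (sub_lt_self _ hδ) (lt_add_of_pos_right _ hδ)),
    Filter.eventually_gt_atTop 0] with x hx hx0
  rw [eval_mul, eval_X, mul_comm (x ^ (-α))]
  have : 0 ≤ x ^ (-α) := by positivity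
  exact ⟨mul_le_mul_of_nonneg_right hx.1 this, mul_le_mul_of_nonneg_right hx.2 this⟩

/-- The second derivative of `R` is of order `x ^ (-α) / x`; two mean value inequalities give the
quadratic remainder. The factor `2 ^ α * 2` comes from evaluating this order at `x / 2`, and `2 ≤ x`
keeps `y ^ (-α)` in `[0, 1]`, where `Q'` is bounded. -/
lemma exists_local_expansion (hα : 0 < α)
    (hR : ∀ x, 0 < x → HasDerivAt R (Q.eval (x ^ (-α))) x) :
    ∃ K, 0 ≤ K ∧ ∀ x, 2 ≤ x → ∀ z, x / 2 ≤ z →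
      |R z - R x - Q.eval (x ^ (-α)) * (z - x)| ≤ K * (x ^ (-α) / x) * (z - x) ^ 2 := by
  obtain ⟨C, hC0, hC⟩ := exists_abs_eval_le Q.derivative
  refine ⟨C * α * (2 ^ α * 2), by positivity, fun x hx z hz => ?_⟩
  have hx0 : 0 < x := by linarith
  have hhalf : (x / 2) ^ (-α) / (x / 2) = 2 ^ α * 2 * (x ^ (-α) / x) := by
    rw [Real.div_rpow hx0.le (by norm_num), Real.rpow_neg (by norm_num : (0 : ℝ) ≤ 2)]
    field_simp
  have hr : ∀ w, x / 2 ≤ w → |Q.eval (w ^ (-α)) - Q.eval (x ^ (-α))| ≤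
      C * α * (2 ^ α * 2) * (x ^ (-α) / x) * |w - x| := by
    intro w hw
    have := Convex.norm_image_sub_le_of_norm_hasDerivWithin_le (s := Ici (x / 2))
      (f := fun y : ℝ => Q.eval (y ^ (-α)))
      (f' := fun y => Q.derivative.eval (y ^ (-α)) * (-α * (y ^ (-α) / y)))
      (C := C * α * (2 ^ α * 2) * (x ^ (-α) / x)) (x := x) (y := w)
      (fun y hy => ?_) ?_ (convex_Ici _) (by simp only [mem_Ici]; linarith) hw
    · simpa [Real.norm_eq_abs] using this
    · have hy0 : 0 < y := by have : x / 2 ≤ y := hy; linarith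
      exact ((Q.hasDerivAt _).comp y (hasDerivAt_rpow_neg hy0)).hasDerivWithinAt
    · intro y hy
      have hy1 : x / 2 ≤ y := hy
      have hy0 : 0 < y := by linarith
      rw [Real.norm_eq_abs, abs_mul, abs_mul, abs_neg, abs_of_pos hα,
        abs_of_pos (show 0 < y ^ (-α) / y by positivity)]
      have h1 := hC (y ^ (-α)) ⟨by positivity, rpow_neg_le_one hα (by linarith)⟩
      have h2 := rpow_neg_div_antitone hα (by linarith) hy1
      rw [hhalf] at h2
      calc _ ≤ C * (α * (2 ^ α * 2 * (x ^ (-α) / x))) := by gcongr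
        _ = _ := by ring
  have := Convex.norm_image_sub_le_of_norm_hasDerivWithin_le (s := uIcc x z)
    (f := fun y : ℝ => R y - Q.eval (x ^ (-α)) * y)
    (f' := fun y => Q.eval (y ^ (-α)) - Q.eval (x ^ (-α)))
    (C := C * α * (2 ^ α * 2) * (x ^ (-α) / x) * |z - x|) (x := x) (y := z)
    (fun y hy => ?_) ?_ (convex_uIcc _ _) left_mem_uIcc right_mem_uIcc
  · rw [Real.norm_eq_abs, Real.norm_eq_abs, mul_assoc _ |z - x|, abs_mul_abs_self] at this
    rw [show R z - R x - Q.eval (x ^ (-α)) * (z - x) = R z - Q.eval (x ^ (-α)) * z -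
      (R x - Q.eval (x ^ (-α)) * x) by ring, pow_two]
    exact this
  · have hy0 : 0 < y := by
      have : min x z ≤ y := hy.1
      have : 0 < min x z := lt_min hx0 (by linarith)
      linarith
    have h1 := (hR y hy0).sub ((hasDerivAt_id y).const_mul (Q.eval (x ^ (-α))))
    rw [mul_one] at h1
    exact h1.hasDerivWithinAt
  · intro y hy
    have hy1 : x / 2 ≤ y := le_trans (le_min (by linarith) hz) hy.1
    refine (hr y hy1).trans ?_
    have : |y - x| ≤ |z - x| := abs_sub_left_of_mem_uIcc hy
    gcongr

lemma monotoneOn_of_hasDerivAt_nonneg {f f' : ℝ → ℝ} {x₁ : ℝ}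
    (hf : ∀ x, x₁ ≤ x → HasDerivAt f (f' x) x) (hf' : ∀ x, x₁ ≤ x → 0 ≤ f' x) :
    MonotoneOn f (Ici x₁) :=
  monotoneOn_of_hasDerivWithinAt_nonneg (convex_Ici x₁)
    (fun x hx => (hf x hx).continuousAt.continuousWithinAt)
    (fun x hx => (hf x (interior_subset hx)).hasDerivWithinAt)
    fun x hx => hf' x (interior_subset hx)

lemma hasDerivAt_rpow_one_sub {c y : ℝ} (hα' : α < 1) (hy : 0 < y) :
    HasDerivAt (fun y : ℝ => c / (1 - α) * y ^ (1 - α)) (c * y ^ (-α)) y := by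
  have := (Real.hasDerivAt_rpow_const (x := y) (p := 1 - α) (Or.inl hy.ne')).const_mul (c / (1 - α))
  refine this.congr_deriv ?_
  have : 1 - α ≠ 0 := by linarith
  rw [show 1 - α - 1 = -α by ring]
  field_simp

/-- Integrate the bound on `R'` and use subadditivity of `y ↦ y ^ (1 - α)`. This is why the claims
need an exponential moment of `ξ ^ (1 - α)`. -/
lemma sub_le_of_eval_le (hα : 0 < α) (hα' : α < 1)
    (hR : ∀ x, 0 < x → HasDerivAt R (Q.eval (x ^ (-α))) x) {x₁ c : ℝ} (hx₁ : 0 < x₁) (hc : 0 ≤ c)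
    (hup : ∀ x, x₁ ≤ x → Q.eval (x ^ (-α)) ≤ c * x ^ (-α)) {x z : ℝ} (hz : x₁ ≤ z) (hzx : z ≤ x) :
    R x - R z ≤ c / (1 - α) * (x - z) ^ (1 - α) := by
  have hmono : MonotoneOn (fun y => c / (1 - α) * y ^ (1 - α) - R y) (Ici x₁) :=
    monotoneOn_of_hasDerivAt_nonneg
      (fun y hy => (hasDerivAt_rpow_one_sub hα' (hx₁.trans_le hy)).sub (hR y (hx₁.trans_le hy)))
      fun y hy => by have := hup y hy; linarith
  have h1 := hmono (mem_Ici.2 hz) (mem_Ici.2 (hz.trans hzx)) hzx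
  have h2 := Real.rpow_add_le_add_rpow (a := x - z) (b := z) (p := 1 - α) (by linarith)
    (by linarith) (by linarith) (by linarith)
  rw [sub_add_cancel] at h2
  have h3 : 0 ≤ c / (1 - α) := div_nonneg hc (by linarith)
  have h4 := mul_le_mul_of_nonneg_left h2 h3
  rw [mul_add] at h4
  simp only at h1
  linarith

lemma tendsto_rpow_mul_exp_neg {a c β : ℝ} (hβ : 0 < β) (hc : 0 < c) :
    Filter.Tendsto (fun y : ℝ => y ^ a * Real.exp (-(c * y ^ β))) Filter.atTop (nhds 0) := by
  have h := (tendsto_rpow_mul_exp_neg_mul_atTop_nhds_zero (a / β) c hc).comp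
    (tendsto_rpow_atTop hβ)
  refine h.congr' ?_
  filter_upwards [Filter.eventually_gt_atTop 0] with y hy
  simp only [Function.comp]
  rw [← Real.rpow_mul hy.le, mul_div_cancel₀ _ hβ.ne', neg_mul]

/-- `∫ₓ^∞ exp (-R)` is comparable with `x ^ α * exp (-R x)`. -/
lemma exists_tail_integral_bounds (hα : 0 < α) (hα' : α < 1) (hQ : Q.coeff 0 = 0)
    (hQ1 : 0 < Q.coeff 1) (hR : ∀ x, 0 < x → HasDerivAt R (Q.eval (x ^ (-α))) x) :
    ∀ᶠ x₁ : ℝ in Filter.atTop, IntegrableOn (fun y => Real.exp (-R y)) (Ioi x₁) ∧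
      Filter.Tendsto (fun x => ∫ y in Ioi x, Real.exp (-R y)) Filter.atTop (nhds 0) ∧
      ∀ x, x₁ ≤ x → Q.coeff 1 / 2 * ∫ y in Ioi x, Real.exp (-R y) ≤ x ^ α * Real.exp (-R x) ∧
        x ^ α * Real.exp (-R x) ≤ 2 * Q.coeff 1 * ∫ y in Ioi x, Real.exp (-R y) := by
  set r := Q.coeff 1 with hr
  have hsmall : ∀ᶠ x : ℝ in Filter.atTop, α * x ^ (α - 1) ≤ r / 4 := by
    have h1 : Filter.Tendsto (fun x : ℝ => α * x ^ (-(1 - α))) Filter.atTop (nhds (α * 0)) :=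
      (tendsto_rpow_neg_atTop (by linarith)).const_mul α
    rw [mul_zero] at h1
    filter_upwards [h1.eventually_le_const (show 0 < r / 4 by positivity)] with x hx
    rwa [neg_sub] at hx
  have hall := ((eventually_eval_rpow_neg hα hQ (show 0 < r / 4 by positivity)).and hsmall).and
    (Filter.eventually_ge_atTop 1)
  rw [← hr] at hall
  obtain ⟨a, ha⟩ := Filter.eventually_atTop.1 hall
  have ha1 : 1 ≤ a := (ha a le_rfl).2
  -- The derivative of `f` is `exp (-R)` times a factor tending to `r`, because `y ^ α * Q (y ^
  -- (-α))` tends to `r` and `α * y ^ (α - 1)` to `0`. Integrating between `r / 2` and `2 * r`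
  -- yields the comparison.
  set f : ℝ → ℝ := fun y => -(y ^ α * Real.exp (-R y)) with hf
  set f' : ℝ → ℝ := fun y => (Q.eval (y ^ (-α)) * y ^ α - α * y ^ (α - 1)) * Real.exp (-R y) with hf'
  have hderiv : ∀ y, a ≤ y → HasDerivAt f (f' y) y := fun y hy => by
    have hy0 : 0 < y := by linarith
    have h1 := ((Real.hasDerivAt_rpow_const (x := y) (p := α) (Or.inl hy0.ne')).mul
      ((hR y hy0).neg.exp)).neg
    refine h1.congr_deriv ?_
    simp only [hf', Pi.neg_apply]; ring
  have hbd : ∀ y, a ≤ y → r / 2 * Real.exp (-R y) ≤ f' y ∧ f' y ≤ 2 * r * Real.exp (-R y) := by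
    intro y hy
    have hy0 : 0 < y := by linarith
    obtain ⟨⟨⟨h1, h2⟩, h3⟩, -⟩ := ha y hy
    have hinv : y ^ (-α) * y ^ α = 1 := by rw [← Real.rpow_add hy0]; simp
    have hp : 0 ≤ y ^ α := by positivity
    have h4 := mul_le_mul_of_nonneg_right h1 hp
    have h5 := mul_le_mul_of_nonneg_right h2 hp
    rw [mul_assoc, hinv] at h4 h5
    have h6 : 0 ≤ α * y ^ (α - 1) := by positivity
    exact ⟨mul_le_mul_of_nonneg_right (by linarith) (Real.exp_pos _).le,
      mul_le_mul_of_nonneg_right (by linarith) (Real.exp_pos _).le⟩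
  have hlim : Filter.Tendsto f Filter.atTop (nhds 0) := by
    have hmono : MonotoneOn (fun y => R y - (r / 2) / (1 - α) * y ^ (1 - α)) (Ici a) :=
      monotoneOn_of_hasDerivAt_nonneg (fun y hy => (hR y (by linarith)).sub
        (hasDerivAt_rpow_one_sub hα' (by linarith))) fun y hy => by
          have h1 := (ha y hy).1.1.1
          have : 0 ≤ y ^ (-α) := by have : 0 < y := by linarith
                                    positivity
          nlinarith
    set m := R a - (r / 2) / (1 - α) * a ^ (1 - α)
    have h1 := (tendsto_rpow_mul_exp_neg (a := α) (c := (r / 2) / (1 - α)) (β := 1 - α)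
      (by linarith) (div_pos (by positivity) (by linarith))).const_mul (Real.exp (-m))
    rw [mul_zero] at h1
    rw [← neg_zero]
    refine Filter.Tendsto.neg (squeeze_zero' ?_ ?_ h1)
    · filter_upwards [Filter.eventually_ge_atTop a] with y hy
      have : 0 < y := by linarith
      positivity
    · filter_upwards [Filter.eventually_ge_atTop a] with y hy
      have h2 := hmono self_mem_Ici hy hy
      have hy0 : 0 < y := by linarith
      have h3 : Real.exp (-R y) ≤ Real.exp (-m) * Real.exp (-((r / 2) / (1 - α) * y ^ (1 - α))) := by
        rw [← Real.exp_add]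
        refine Real.exp_le_exp.2 ?_
        simp only at h2
        linarith
      calc _ ≤ y ^ α * (Real.exp (-m) * Real.exp (-((r / 2) / (1 - α) * y ^ (1 - α)))) := by gcongr
        _ = _ := by ring
  have hcont : ∀ x, a ≤ x → ContinuousWithinAt f (Ici x) x := fun x hx =>
    (hderiv x hx).continuousAt.continuousWithinAt
  have hint' : ∀ x, a ≤ x → IntegrableOn f' (Ioi x) := fun x hx =>
    integrableOn_Ioi_deriv_of_nonneg (hcont x hx)
      (fun y hy => hderiv y (hx.trans (le_of_lt hy)))
      (fun y hy => le_trans (by positivity) (hbd y (hx.trans (le_of_lt hy))).1) hlim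
  have hval : ∀ x, a ≤ x → ∫ y in Ioi x, f' y = x ^ α * Real.exp (-R x) := fun x hx => by
    rw [integral_Ioi_of_hasDerivAt_of_tendsto (hcont x hx)
      (fun y hy => hderiv y (hx.trans (le_of_lt hy))) (hint' x hx) hlim, hf]
    ring
  have hint : ∀ x, a ≤ x → IntegrableOn (fun y => Real.exp (-R y)) (Ioi x) := fun x hx => by
    refine Integrable.mono' ((hint' x hx).const_mul (2 / r)) ?_ ?_
    · refine ContinuousOn.aestronglyMeasurable (fun y hy => ?_) measurableSet_Ioi
      have hy' : x < y := hy
      exact ((hR y (by linarith)).neg.exp).continuousAt.continuousWithinAt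
    · refine (ae_restrict_iff' measurableSet_Ioi).2 (Filter.Eventually.of_forall fun y hy => ?_)
      rw [Real.norm_eq_abs, abs_of_pos (Real.exp_pos _), div_mul_eq_mul_div, le_div_iff₀ hQ1]
      linarith [(hbd y (hx.trans (le_of_lt hy))).1]
  have hcmp : ∀ x, a ≤ x →
      r / 2 * ∫ y in Ioi x, Real.exp (-R y) ≤ x ^ α * Real.exp (-R x) ∧
        x ^ α * Real.exp (-R x) ≤ 2 * r * ∫ y in Ioi x, Real.exp (-R y) := by
    intro x hx
    rw [← hval x hx, ← integral_const_mul, ← integral_const_mul]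
    exact ⟨setIntegral_mono_on ((hint x hx).const_mul _) (hint' x hx) measurableSet_Ioi
        fun y hy => (hbd y (hx.trans (le_of_lt hy))).1,
      setIntegral_mono_on (hint' x hx) ((hint x hx).const_mul _) measurableSet_Ioi
        fun y hy => (hbd y (hx.trans (le_of_lt hy))).2⟩
  have htend : Filter.Tendsto (fun x => ∫ y in Ioi x, Real.exp (-R y)) Filter.atTop (nhds 0) := by
    have h1 : Filter.Tendsto (fun x => 2 / r * -f x) Filter.atTop (nhds (2 / r * -0)) :=
      hlim.neg.const_mul _
    rw [neg_zero, mul_zero] at h1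
    refine squeeze_zero' (Filter.Eventually.of_forall fun x =>
      integral_nonneg fun y => (Real.exp_pos _).le) ?_ h1
    filter_upwards [Filter.eventually_ge_atTop a] with x hx
    rw [div_mul_eq_mul_div, le_div_iff₀ hQ1, hf, neg_neg]
    linarith [(hcmp x hx).1]
  filter_upwards [Filter.eventually_ge_atTop a] with x₁ hx₁
  exact ⟨hint x₁ hx₁, htend, fun x hx => hcmp x (hx₁.trans hx)⟩

end exponent

/-! ### The decreasing integrable error term and its primitive. -/

section error

/-- On the upper half of `[a, z]` the function is at least `e z`, so half of `(z - a) * e z` is at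
most a tail of a convergent integral. -/
lemma tendsto_zero_of_antitoneOn {e : ℝ → ℝ} {a : ℝ} (hpos : ∀ z, a < z → 0 ≤ e z)
    (hanti : AntitoneOn e (Ioi a)) (hint : IntegrableOn e (Ioi a)) :
    Filter.Tendsto (fun z => (z - a) * e z) Filter.atTop
      (nhds 0) := by
  have hI : Filter.Tendsto (fun z => 2 * ∫ y in Ioi ((z + a) / 2), e y) Filter.atTop
      (nhds (2 * 0)) := by
    have ht : Filter.Tendsto (fun z : ℝ => (z + a) / 2) Filter.atTop Filter.atTop :=
      (Filter.tendsto_atTop_add_const_right _ a Filter.tendsto_id).atTop_div_const (by norm_num)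
    have h0 : Filter.Tendsto (fun x => ∫ y in Ioi x, e y) Filter.atTop (nhds 0) := by
      have h1 := intervalIntegral_tendsto_integral_Ioi a hint Filter.tendsto_id
      have h2 : Filter.Tendsto (fun x => (∫ y in Ioi a, e y) - ∫ y in a..x, e y) Filter.atTop
        (nhds ((∫ y in Ioi a, e y) - ∫ y in Ioi a, e y)) := h1.const_sub _
      rw [sub_self] at h2
      refine h2.congr' ?_
      filter_upwards [Filter.eventually_ge_atTop a] with x hx
      have := intervalIntegral.integral_interval_add_Ioi hint (hint.mono_set (Ioi_subset_Ioi hx))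
      linarith
    exact (h0.comp ht).const_mul 2
  rw [mul_zero] at hI
  refine squeeze_zero' ?_ ?_ hI
  · filter_upwards [Filter.eventually_gt_atTop a] with z hz
    exact mul_nonneg (by linarith) (hpos z hz)
  · filter_upwards [Filter.eventually_gt_atTop a] with z hz
    have hm : a < (z + a) / 2 := by linarith
    have h1 : (z - (z + a) / 2) * e z ≤ ∫ y in Ioc ((z + a) / 2) z, e y := by
      have := setIntegral_mono_on (s := Ioc ((z + a) / 2) z) (f := fun _ => e z) (g := e)
        (μ := volume) (by simp) (hint.mono_set fun y hy => hm.trans hy.1) measurableSet_Ioc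
        fun y hy => hanti (mem_Ioi.2 (hm.trans hy.1)) (mem_Ioi.2 hz) hy.2
      rw [setIntegral_const] at this
      rw [Measure.real, Real.volume_Ioc, ENNReal.toReal_ofReal (by linarith)] at this
      simpa using this
    have h2 : ∫ y in Ioc ((z + a) / 2) z, e y ≤ ∫ y in Ioi ((z + a) / 2), e y :=
      setIntegral_mono_set (hint.mono_set (Ioi_subset_Ioi hm.le))
        ((ae_restrict_iff' measurableSet_Ioi).2
          (Filter.Eventually.of_forall fun y hy => hpos y (hm.trans hy)))
        (Filter.Eventually.of_forall fun y hy => hy.1)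
    linarith

/-- A primitive of an integrable nonincreasing function. -/
lemma exists_bounded_primitive {e : ℝ → ℝ} {a : ℝ} (hpos : ∀ z, a < z → 0 ≤ e z)
    (hanti : AntitoneOn e (Ioi a)) (hint : IntegrableOn e (Ioi a)) :
    ∃ (E : ℝ → ℝ) (L : ℝ), Continuous E ∧ 0 ≤ L ∧ (∀ x, a ≤ x → 0 ≤ E x ∧ E x ≤ L) ∧
      (∀ z x, a ≤ z → z ≤ x → E z ≤ E x) ∧
      ∀ z x, a ≤ z → z ≤ x → a < x → e x * (x - z) ≤ E x - E z := by
  set g := (Ioi a).indicator e with hg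
  have hgi : Integrable g := (integrable_indicator_iff measurableSet_Ioi).2 hint
  have hg0 : ∀ z, 0 ≤ g z := fun z => indicator_nonneg (fun y hy => hpos y hy) z
  have hii : ∀ b c, IntervalIntegrable g volume b c := fun b c => hgi.intervalIntegrable
  have hdiff : ∀ z x, (∫ y in a..x, g y) - ∫ y in a..z, g y = ∫ y in z..x, g y := fun z x =>
    intervalIntegral.integral_interval_sub_left (hii _ _) (hii _ _)
  have hmono : ∀ z x, z ≤ x → ∫ y in a..z, g y ≤ ∫ y in a..x, g y := fun z x hzx => by
    have := intervalIntegral.integral_nonneg (μ := volume) hzx (fun y _ => hg0 y)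
    linarith [hdiff z x]
  refine ⟨fun x => ∫ y in a..x, g y, ∫ y, g y, intervalIntegral.continuous_primitive hii a,
    integral_nonneg hg0, fun x hx => ⟨?_, ?_⟩, fun z x _ hzx => hmono z x hzx,
    fun z x hz hzx hx => ?_⟩
  · simpa using hmono a x hx
  · simp only
    rw [intervalIntegral.integral_of_le hx]
    exact setIntegral_le_integral hgi (Filter.Eventually.of_forall hg0)
  · rw [hdiff z x]
    have h1 : ∫ y in z..x, e x = e x * (x - z) := by simp [mul_comm]
    rw [← h1]
    refine intervalIntegral.integral_mono_on_of_le_Ioo hzx (by simp) (hii _ _) fun y hy => ?_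
    rw [hg, indicator_of_mem (mem_Ioi.2 (hz.trans_lt hy.1))]
    exact hanti (mem_Ioi.2 (hz.trans_lt hy.1)) (mem_Ioi.2 hx) hy.2.le

/-- The total error of the expansions at level `z`. -/
noncomputable def errFun (p : ℝ → ℝ) (α : ℝ) (n : ℕ) (z : ℝ) : ℝ :=
  p z + (z ^ (-α)) ^ n + z ^ (-α) / z

variable {p : ℝ → ℝ} {α : ℝ} {n : ℕ}

lemma errFun_bounds (hp : ∀ z, 1 < z → 0 < p z) {z : ℝ} (hz : 1 < z) :
    p z ≤ errFun p α n z ∧ (z ^ (-α)) ^ n ≤ errFun p α n z ∧ z ^ (-α) / z ≤ errFun p α n z ∧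
      0 < errFun p α n z := by
  have h0 : 0 < z := by linarith
  have h1 := hp z hz
  have h2 : 0 < (z ^ (-α)) ^ n := by positivity
  have h3 : 0 < z ^ (-α) / z := by positivity
  unfold errFun
  exact ⟨by linarith, by linarith, by linarith, by linarith⟩

lemma errFun_antitone (hα : 0 < α) (hp : AntitoneOn p (Ioi 1)) :
    AntitoneOn (errFun p α n) (Ioi 1) := by
  intro x hx z hz hxz
  have hx0 : 0 < x := by have : 1 < x := hx; linarith
  have hz0 : 0 < z := hx0.trans_le hxz
  have h1 := hp hx hz hxz
  have h2 := rpow_neg_div_antitone hα hx0 hxz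
  have h3 : z ^ (-α) ≤ x ^ (-α) := Real.rpow_le_rpow_of_nonpos hx0 hxz (by linarith)
  have h4 : (z ^ (-α)) ^ n ≤ (x ^ (-α)) ^ n := by gcongr
  unfold errFun
  linarith

lemma exists_integrableOn_errFun (hα : 0 < α) (hn : 1 < (n : ℝ) * α)
    (hp : IntegrableAtFilter p Filter.atTop volume) :
    ∃ a, 2 ≤ a ∧ IntegrableOn (errFun p α n) (Ioi a) := by
  obtain ⟨s, hs, hps⟩ := hp
  obtain ⟨a, ha⟩ := Filter.mem_atTop_sets.1 hs
  refine ⟨max a 2, le_max_right _ _, ?_⟩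
  have h2 : (0 : ℝ) < max a 2 := lt_of_lt_of_le (by norm_num) (le_max_right _ _)
  have e1 : IntegrableOn p (Ioi (max a 2)) := hps.mono_set fun y hy =>
    ha y ((le_max_left _ _).trans (le_of_lt hy))
  have e2 : IntegrableOn (fun z : ℝ => (z ^ (-α)) ^ n) (Ioi (max a 2)) := by
    refine (integrableOn_Ioi_rpow_of_lt (a := -(n * α)) (by linarith) h2).congr_fun
      (fun z hz => ?_) measurableSet_Ioi
    have hz0 : 0 < z := h2.trans hz
    simp only
    rw [← Real.rpow_natCast, ← Real.rpow_mul hz0.le]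
    ring_nf
  have e3 : IntegrableOn (fun z : ℝ => z ^ (-α) / z) (Ioi (max a 2)) := by
    refine (integrableOn_Ioi_rpow_of_lt (a := -α - 1) (by linarith) h2).congr_fun
      (fun z hz => ?_) measurableSet_Ioi
    have hz0 : 0 < z := h2.trans hz
    simp only
    rw [Real.rpow_sub_one hz0.ne']
  exact (e1.add e2).add e3

end error

/-! ### Expansion of the premium flow over one inter-claim time. -/

section flow

variable {v : ℝ → ℝ} {V : ℝ → ℝ → ℝ}

lemma IsPremiumFlow.le_add (hV : IsPremiumFlow v V) (hv : ∀ z, 0 ≤ v z) {M : ℝ}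
    (hM : ∀ z, v z ≤ M) (x : ℝ) {t : ℝ} (ht : 0 ≤ t) : V x t ≤ x + M * t := by
  rw [hV.integral_eq x t ht]
  have := intervalIntegral.norm_integral_le_of_norm_le_const (a := (0 : ℝ)) (b := t) (C := M)
    (f := fun s => v (V x s)) fun s _ => by
      rw [Real.norm_eq_abs, abs_of_nonneg (hv _)]; exact hM _
  rw [Real.norm_eq_abs, sub_zero, abs_of_nonneg ht] at this
  linarith [le_abs_self (∫ s in (0 : ℝ)..t, v (V x s))]

lemma IsPremiumFlow.intervalIntegrable (hV : IsPremiumFlow v V) (hvm : Measurable v)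
    (hv : ∀ z, 0 ≤ v z) {M : ℝ} (hM : ∀ z, v z ≤ M) (x a b : ℝ) :
    IntervalIntegrable (fun s => v (V x s)) volume a b := by
  have hm : Measurable (fun s => v (V x s)) :=
    hvm.comp (hV.measurable.comp (measurable_const.prodMk measurable_id))
  refine (intervalIntegrable_const (c := M)).mono_fun hm.aestronglyMeasurable
    (Filter.Eventually.of_forall fun s => ?_)
  simp only [Real.norm_eq_abs]
  rw [abs_of_nonneg (hv _)]
  exact (hM _).trans (le_abs_self M)

/-- Up to time `t` the flow stays in `[x, x + M * t]`. There `p` is at most `p x`, and `z ^ (-α)`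
differs from `x ^ (-α)` by at most its slope at `x` times `M * t`. -/
lemma IsPremiumFlow.abs_sub_le (hV : IsPremiumFlow v V) (hvm : Measurable v)
    (hv : ∀ z, 0 ≤ v z) {M : ℝ} (hM : ∀ z, v z ≤ M) {α θ vc : ℝ} (hα : 0 < α) (hθ : 0 < θ)
    {p : ℝ → ℝ} (hp : AntitoneOn p (Ioi 1))
    (hrate : ∀ z, 1 < z → |v z - vc - θ / z ^ α| ≤ p z) {x : ℝ} (hx : 1 < x) {t : ℝ}
    (ht : 0 ≤ t) :
    |V x t - x - (vc * t + θ * t * x ^ (-α))| ≤ t * p x + θ * α * M * t ^ 2 * (x ^ (-α) / x) := by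
  have hx0 : 0 < x := by linarith
  have hM0 : 0 ≤ M := (hv 0).trans (hM 0)
  have e : V x t - x - (vc * t + θ * t * x ^ (-α)) =
      ∫ s in (0 : ℝ)..t, (v (V x s) - (vc + θ * x ^ (-α))) := by
    rw [intervalIntegral.integral_sub (hV.intervalIntegrable hvm hv hM x 0 t) (by simp),
      hV.integral_eq x t ht]
    simp
    ring
  rw [e, ← Real.norm_eq_abs]
  have := intervalIntegral.norm_integral_le_of_norm_le_const (a := (0 : ℝ)) (b := t)
    (C := p x + θ * (α * (x ^ (-α) / x) * (M * t)))
    (f := fun s => v (V x s) - (vc + θ * x ^ (-α))) fun s hs => ?_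
  · rw [sub_zero, abs_of_nonneg ht] at this
    calc _ ≤ _ := this
      _ = _ := by ring
  · rw [uIoc_of_le ht] at hs
    have h1 := hV.le hv x hs.1.le
    have h2 := hV.le_add hv hM x hs.1.le
    have h3 := hrate (V x s) (by linarith)
    have h4 := hp (mem_Ioi.2 hx) (mem_Ioi.2 (hx.trans_le h1)) h1
    have h5 := abs_rpow_neg_sub_le hα hx0 h1
    have h6 : M * s ≤ M * t := by have := hs.2; gcongr
    have h7 : θ / V x s ^ α = θ * (V x s) ^ (-α) := by
      rw [Real.rpow_neg (by linarith), div_eq_mul_inv]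
    rw [h7] at h3
    have h8 : |V x s ^ (-α) - x ^ (-α)| ≤ α * (x ^ (-α) / x) * (M * t) := by
      refine h5.trans ?_
      have : V x s - x ≤ M * t := by linarith
      gcongr
    calc ‖v (V x s) - (vc + θ * x ^ (-α))‖
        = |(v (V x s) - vc - θ * V x s ^ (-α)) + θ * (V x s ^ (-α) - x ^ (-α))| := by
          rw [Real.norm_eq_abs]; ring_nf
      _ ≤ |v (V x s) - vc - θ * V x s ^ (-α)| + |θ * (V x s ^ (-α) - x ^ (-α))| := abs_add_le _ _
      _ ≤ p x + θ * (α * (x ^ (-α) / x) * (M * t)) := by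
        rw [abs_mul, abs_of_pos hθ]
        have := h3.trans h4
        gcongr

end flow

/-! ### Integrability of the random constant in the error. -/

section moments

variable {Ω : Type*} [mΩ : MeasurableSpace Ω] {P : Measure Ω} [IsProbabilityMeasure P]

lemma exists_pow_mul_exp_le {κ r β : ℝ} (hκ : κ < r) (hβ : 0 < β) (N : ℕ) :
    ∃ C, ∀ s : ℝ, 0 ≤ s → (1 + s) ^ N * Real.exp (κ * s ^ β) ≤ C * Real.exp (r * s ^ β) := by
  have h1 : Filter.Tendsto (fun s : ℝ => (2 * s) ^ N * Real.exp (-((r - κ) * s ^ β)))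
      Filter.atTop (nhds 0) := by
    have := (tendsto_rpow_mul_exp_neg (a := N) hβ (sub_pos.2 hκ)).const_mul ((2 : ℝ) ^ N)
    rw [mul_zero] at this
    refine this.congr fun s => ?_
    rw [Real.rpow_natCast, mul_pow]; ring
  obtain ⟨a, ha⟩ := Filter.eventually_atTop.1
    ((h1.eventually_le_const zero_lt_one).and (Filter.eventually_ge_atTop 1))
  have hcont : ContinuousOn (fun s : ℝ => (1 + s) ^ N * Real.exp (-((r - κ) * s ^ β)))
      (Icc 0 a) := by
    have : Continuous (fun s : ℝ => s ^ β) := Real.continuous_rpow_const hβ.le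
    fun_prop
  obtain ⟨C, hC⟩ := isCompact_Icc.exists_bound_of_continuousOn hcont
  refine ⟨max C 1, fun s hs => ?_⟩
  have h2 : (1 + s) ^ N * Real.exp (-((r - κ) * s ^ β)) ≤ max C 1 := by
    rcases le_total s a with h | h
    · exact le_max_of_le_left ((le_abs_self _).trans (hC s ⟨hs, h⟩))
    · obtain ⟨h3, h4⟩ := ha s h
      refine le_max_of_le_right (le_trans ?_ h3)
      gcongr
      linarith
  have h3 : Real.exp (κ * s ^ β) = Real.exp (-((r - κ) * s ^ β)) * Real.exp (r * s ^ β) := by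
    rw [← Real.exp_add]; ring_nf
  rw [h3, ← mul_assoc]
  exact mul_le_mul_of_nonneg_right h2 (Real.exp_pos _).le

/-- Since `1 + t + s ≤ (1 + t) * (1 + s)`, independence separates the factors; the gap `κ < r`
absorbs the power of `1 + s`, so only the `N`-th moment of `t` is required. -/
lemma integrable_weight {t s : Ω → ℝ} (ht : Measurable t) (hs : Measurable s)
    (hts : IndepFun t s P) (ht0 : ∀ᵐ ω ∂P, 0 ≤ t ω) (hs0 : ∀ᵐ ω ∂P, 0 ≤ s ω) {N : ℕ}
    (htN : Integrable (fun ω => t ω ^ N) P) {κ r β : ℝ} (hκ : κ < r) (hβ : 0 < β)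
    (hexp : Integrable (fun ω => Real.exp (r * s ω ^ β)) P) :
    Integrable (fun ω => (1 + (t ω + s ω)) ^ N * Real.exp (κ * s ω ^ β)) P := by
  obtain ⟨C, hC⟩ := exists_pow_mul_exp_le hκ hβ N
  have hsβ : Measurable fun ω => s ω ^ β := hs.pow_const β
  have i1 : Integrable (fun ω => (1 + t ω) ^ N) P := by
    refine Integrable.mono' (((integrable_const (1 : ℝ)).add htN).const_mul (2 ^ (N - 1)))
      (by fun_prop) ?_
    filter_upwards [ht0] with ω h0
    rw [Real.norm_eq_abs, abs_of_nonneg (by positivity)]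
    simpa using add_pow_le zero_le_one h0 N
  have i2 : Integrable (fun ω => (1 + s ω) ^ N * Real.exp (κ * s ω ^ β)) P := by
    refine Integrable.mono' (hexp.const_mul C) (by fun_prop) ?_
    filter_upwards [hs0] with ω h0
    rw [Real.norm_eq_abs, abs_of_nonneg (by positivity)]
    exact hC _ h0
  have hind := hts.comp (φ := fun a : ℝ => (1 + a) ^ N)
    (ψ := fun a : ℝ => (1 + a) ^ N * Real.exp (κ * a ^ β)) (by fun_prop)
    (by have : Measurable fun a : ℝ => a ^ β := measurable_id.pow_const β
        fun_prop)
  refine Integrable.mono' (hind.integrable_mul i1 i2) (by fun_prop) ?_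
  filter_upwards [ht0, hs0] with ω h0 h1
  rw [Real.norm_eq_abs, abs_of_nonneg (by positivity)]
  simp only [Pi.mul_apply, Function.comp]
  rw [← mul_assoc, ← mul_pow]
  gcongr
  nlinarith

end moments

end LevelDependentRisk

/-! ### Normalized tail integrals as test functions. -/

namespace LevelDependentRisk

section tail

/-- The function `x ↦ ∫ₓ^∞ exp (-R)`, frozen below the level `x₁`. -/
noncomputable def tailFun (R : ℝ → ℝ) (x₁ x : ℝ) : ℝ := ∫ y in Ioi (max x x₁), Real.exp (-R y)

variable {R : ℝ → ℝ} {x₁ : ℝ}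

lemma tailFun_antitone (hint : IntegrableOn (fun y => Real.exp (-R y)) (Ioi x₁)) :
    Antitone (tailFun R x₁) := fun _ _ hxy =>
  setIntegral_mono_set (hint.mono_set (Ioi_subset_Ioi (le_max_right _ _)))
    (Filter.Eventually.of_forall fun _ => (Real.exp_pos _).le)
    (Filter.Eventually.of_forall (Ioi_subset_Ioi (max_le_max_right x₁ hxy)))

lemma tailFun_pos (hint : IntegrableOn (fun y => Real.exp (-R y)) (Ioi x₁)) (x : ℝ) :
    0 < tailFun R x₁ x := by
  refine (setIntegral_pos_iff_support_of_nonneg_ae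
    (Filter.Eventually.of_forall fun _ => (Real.exp_pos _).le)
    (hint.mono_set (Ioi_subset_Ioi (le_max_right _ _)))).2 ?_
  have : Function.support (fun y => Real.exp (-R y)) = univ := by
    ext y; simp [Real.exp_ne_zero]
  simp [this]

/-- Factoring out `exp (-R x)` leaves an integral that depends only on increments of `R`, the
quantity estimated by `exists_abs_increment_le`. -/
lemma tailFun_sub (hint : IntegrableOn (fun y => Real.exp (-R y)) (Ioi x₁)) {x : ℝ} (hx : x₁ ≤ x) (y : ℝ) :
    tailFun R x₁ y - tailFun R x₁ x =
      Real.exp (-R x) * -∫ z in x..(max y x₁), Real.exp (-(R z - R x)) := by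
  have h1 := intervalIntegral.integral_interval_add_Ioi
    (hint.mono_set (Ioi_subset_Ioi hx)) (hint.mono_set (Ioi_subset_Ioi (le_max_right y x₁)))
  have h2 : ∫ z in x..(max y x₁), Real.exp (-R z) =
      Real.exp (-R x) * ∫ z in x..(max y x₁), Real.exp (-(R z - R x)) := by
    rw [← intervalIntegral.integral_const_mul]
    refine intervalIntegral.integral_congr fun z _ => ?_
    rw [← Real.exp_add]; ring_nf
  rw [tailFun, tailFun, max_eq_left hx, mul_neg, ← h2]
  linarith

/-- The function `tailFun`, normalized to take values in `[0, 1]`. -/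
noncomputable def tailRatio (R : ℝ → ℝ) (x₁ x : ℝ) : ℝ := tailFun R x₁ x / tailFun R x₁ x₁

lemma tailRatio_antitone (hint : IntegrableOn (fun y => Real.exp (-R y)) (Ioi x₁)) :
    Antitone (tailRatio R x₁) := fun _ _ hxy =>
  div_le_div_of_nonneg_right (tailFun_antitone hint hxy) (tailFun_pos hint x₁).le

lemma tailRatio_pos (hint : IntegrableOn (fun y => Real.exp (-R y)) (Ioi x₁)) (x : ℝ) :
    0 < tailRatio R x₁ x := div_pos (tailFun_pos hint x) (tailFun_pos hint x₁)

lemma tailRatio_mem_Icc (hint : IntegrableOn (fun y => Real.exp (-R y)) (Ioi x₁)) (x : ℝ) :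
    tailRatio R x₁ x ∈ Icc (0 : ℝ) 1 := by
  refine ⟨(tailRatio_pos hint x).le, (div_le_one (tailFun_pos hint x₁)).2 ?_⟩
  rcases le_total x₁ x with h | h
  · exact tailFun_antitone hint h
  · rw [tailFun, tailFun, max_eq_right h, max_self]

lemma tailRatio_sub (hint : IntegrableOn (fun y => Real.exp (-R y)) (Ioi x₁)) {x : ℝ} (hx : x₁ ≤ x) (y : ℝ) :
    tailRatio R x₁ y - tailRatio R x₁ x = Real.exp (-R x) / tailFun R x₁ x₁ *
      -∫ z in x..(max y x₁), Real.exp (-(R z - R x)) := by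
  rw [tailRatio, tailRatio, ← sub_div, tailFun_sub hint hx]
  ring

variable {Ω : Type*} [mΩ : MeasurableSpace Ω] {P : Measure Ω} [IsProbabilityMeasure P]
  {V : ℝ → ℝ → ℝ} {τ ξ : ℕ → Ω → ℝ} {v : ℝ → ℝ}

lemma IsRiskModel.tailRatio_le_stepOp (h : IsRiskModel P τ ξ v V)
    (hint : IntegrableOn (fun y => Real.exp (-R y)) (Ioi x₁)) {x : ℝ} (hx : x₁ ≤ x) {F : Ω → ℝ}
    (hF : Integrable F P) (hF0 : 0 ≤ ∫ ω, F ω ∂P)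
    (hle : ∀ᵐ ω ∂P, F ω ≤ -∫ z in x..(max (V x (τ 0 ω) - ξ 0 ω) x₁), Real.exp (-(R z - R x))) :
    tailRatio R x₁ x ≤ stepOp P V (τ 0) (ξ 0) (tailRatio R x₁) x := by
  have hc : 0 < Real.exp (-R x) / tailFun R x₁ x₁ :=
    div_pos (Real.exp_pos _) (tailFun_pos hint x₁)
  have hi := integrable_step (P := P) h.flow.measurable (h.measurable_time 0)
    (h.measurable_claim 0) (tailRatio_antitone hint).measurable (tailRatio_mem_Icc hint) x
  calc tailRatio R x₁ x
      ≤ ∫ ω, (tailRatio R x₁ x + Real.exp (-R x) / tailFun R x₁ x₁ * F ω) ∂P := by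
        rw [integral_add (integrable_const _) (hF.const_mul _), integral_const_mul]
        simpa using mul_nonneg hc.le hF0
    _ ≤ stepOp P V (τ 0) (ξ 0) (tailRatio R x₁) x := by
        refine integral_mono_ae ((integrable_const _).add (hF.const_mul _)) hi ?_
        filter_upwards [hle] with ω hω
        have h1 := tailRatio_sub hint hx (V x (τ 0 ω) - ξ 0 ω)
        have h2 := mul_le_mul_of_nonneg_left hω hc.le
        linarith

lemma IsRiskModel.stepOp_tailRatio_le (h : IsRiskModel P τ ξ v V)
    (hint : IntegrableOn (fun y => Real.exp (-R y)) (Ioi x₁)) {x : ℝ} (hx : x₁ ≤ x) {F : Ω → ℝ}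
    (hF : Integrable F P) (hF0 : ∫ ω, F ω ∂P ≤ 0)
    (hle : ∀ᵐ ω ∂P, -∫ z in x..(max (V x (τ 0 ω) - ξ 0 ω) x₁), Real.exp (-(R z - R x)) ≤ F ω) :
    stepOp P V (τ 0) (ξ 0) (tailRatio R x₁) x ≤ tailRatio R x₁ x := by
  have hc : 0 < Real.exp (-R x) / tailFun R x₁ x₁ :=
    div_pos (Real.exp_pos _) (tailFun_pos hint x₁)
  have hi := integrable_step (P := P) h.flow.measurable (h.measurable_time 0)
    (h.measurable_claim 0) (tailRatio_antitone hint).measurable (tailRatio_mem_Icc hint) x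
  calc stepOp P V (τ 0) (ξ 0) (tailRatio R x₁) x
      ≤ ∫ ω, (tailRatio R x₁ x + Real.exp (-R x) / tailFun R x₁ x₁ * F ω) ∂P := by
        refine integral_mono_ae hi ((integrable_const _).add (hF.const_mul _)) ?_
        filter_upwards [hle] with ω hω
        have h1 := tailRatio_sub hint hx (V x (τ 0 ω) - ξ 0 ω)
        have h2 := mul_le_mul_of_nonneg_left hω hc.le
        linarith
    _ ≤ tailRatio R x₁ x := by
        rw [integral_add (integrable_const _) (hF.const_mul _), integral_const_mul]
        simpa using mul_nonpos_of_nonneg_of_nonpos hc.le hF0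

end tail

/-! ### Drift gained by perturbing the exponent. -/

section perturbation

variable {R E : ℝ → ℝ} {x₁ x Δ δ q : ℝ}

/-- Adding an increasing function to the exponent increases the drift. -/
lemma gain_of_add (hR : ContinuousOn R (Ici x₁)) (hRm : MonotoneOn R (Ici x₁))
    (hE : ContinuousOn E (Ici x₁)) (hx : x₁ + 1 ≤ x) (hδ : 0 ≤ δ) (hδ1 : δ ≤ 1) (hq : 0 ≤ q)
    (hEx : ∀ z, x ≤ z → E x ≤ E z) (hEq : ∀ z, x₁ ≤ z → z ≤ x → q * (x - z) ≤ E x - E z) :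
    -(∫ z in x..(max (x + Δ) x₁), Real.exp (-(R z - R x))) +
        (if Δ < -δ then q * δ ^ 2 / 4 else 0) ≤
      -∫ z in x..(max (x + Δ) x₁), Real.exp (-((R z + E z) - (R x + E x))) := by
  have hsub : uIcc x (max (x + Δ) x₁) ⊆ Ici x₁ := fun z hz =>
    (le_min (by linarith) (le_max_right _ _)).trans hz.1
  have c1 : ContinuousOn (fun z => Real.exp (-(R z - R x))) (Ici x₁) := by fun_prop
  have c2 : ContinuousOn (fun z => Real.exp (-((R z + E z) - (R x + E x)))) (Ici x₁) := by fun_prop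
  have h := gain_le_neg_integral (q := q) (Δ := Δ) (k := fun z =>
    Real.exp (-((R z + E z) - (R x + E x))) - Real.exp (-(R z - R x))) (c2.sub c1) hx hδ hδ1 (fun z hz => ?_)
    (fun z hz hzx => ?_) (fun z hz hzx => ?_)
  · rw [intervalIntegral.integral_sub (c2.mono hsub).intervalIntegrable
      (c1.mono hsub).intervalIntegrable] at h
    linarith
  · rw [sub_nonpos]
    exact Real.exp_le_exp.2 (by linarith [hEx z hz])
  · rw [sub_nonneg]
    refine Real.exp_le_exp.2 ?_
    have := hEq z hz hzx
    have : 0 ≤ q * (x - z) := mul_nonneg hq (by linarith)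
    linarith
  · have hz1 : x₁ ≤ z := by linarith
    have h1 := hEq z hz1 hzx
    have h2 : 1 ≤ Real.exp (-(R z - R x)) :=
      Real.one_le_exp (by linarith [hRm hz1 (hz1.trans hzx) hzx])
    have h3 : Real.exp (-((R z + E z) - (R x + E x))) =
        Real.exp (-(R z - R x)) * Real.exp (E x - E z) := by rw [← Real.exp_add]; ring_nf
    have h4 := Real.add_one_le_exp (E x - E z)
    have h5 : 0 ≤ q * (x - z) := mul_nonneg hq (by linarith)
    rw [h3]
    nlinarith

/-- Subtracting an increasing function from the exponent decreases the drift. -/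
lemma gain_of_sub (hR : ContinuousOn R (Ici x₁)) (hRm : MonotoneOn R (Ici x₁))
    (hE : ContinuousOn E (Ici x₁)) (hx : x₁ + 1 ≤ x) (hδ : 0 ≤ δ) (hδ1 : δ ≤ 1) (hq : 0 ≤ q)
    (hq1 : q ≤ 1)
    (hEx : ∀ z, x ≤ z → E x ≤ E z) (hEq : ∀ z, x₁ ≤ z → z ≤ x → q * (x - z) ≤ E x - E z) :
    -(∫ z in x..(max (x + Δ) x₁), Real.exp (-((R z - E z) - (R x - E x)))) ≤
      -(∫ z in x..(max (x + Δ) x₁), Real.exp (-(R z - R x))) -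
        (if Δ < -δ then q * δ ^ 2 / 4 else 0) := by
  have hsub : uIcc x (max (x + Δ) x₁) ⊆ Ici x₁ := fun z hz =>
    (le_min (by linarith) (le_max_right _ _)).trans hz.1
  have c1 : ContinuousOn (fun z => Real.exp (-(R z - R x))) (Ici x₁) := by fun_prop
  have c2 : ContinuousOn (fun z => Real.exp (-((R z - E z) - (R x - E x)))) (Ici x₁) := by fun_prop
  have h := gain_le_neg_integral (q := q) (Δ := Δ) (k := fun z =>
    Real.exp (-(R z - R x)) - Real.exp (-((R z - E z) - (R x - E x)))) (c1.sub c2) hx hδ hδ1 (fun z hz => ?_)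
    (fun z hz hzx => ?_) (fun z hz hzx => ?_)
  · rw [intervalIntegral.integral_sub (c1.mono hsub).intervalIntegrable
      (c2.mono hsub).intervalIntegrable] at h
    linarith
  · rw [sub_nonpos]
    exact Real.exp_le_exp.2 (by linarith [hEx z hz])
  · rw [sub_nonneg]
    refine Real.exp_le_exp.2 ?_
    have := hEq z hz hzx
    have : 0 ≤ q * (x - z) := mul_nonneg hq (by linarith)
    linarith
  · have hz1 : x₁ ≤ z := by linarith
    have h1 := hEq z hz1 hzx
    have h2 : 1 ≤ Real.exp (-(R z - R x)) :=
      Real.one_le_exp (by linarith [hRm hz1 (hz1.trans hzx) hzx])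
    have h3 : Real.exp (-((R z - E z) - (R x - E x))) =
        Real.exp (-(R z - R x)) * Real.exp (-(E x - E z)) := by rw [← Real.exp_add]; ring_nf
    set w := q * (x - z) with hw
    have h5 : 0 ≤ w := mul_nonneg hq (by linarith)
    have h6 : w ≤ 1 := mul_le_one₀ hq1 (by linarith) (by linarith)
    have h7 : Real.exp (-(E x - E z)) ≤ Real.exp (-w) := Real.exp_le_exp.2 (by linarith)
    -- From `exp (-w) ≤ 1 / (1 + w)` and `(1 + w) * (1 - w / 2) ≥ 1`; the latter uses `w ≤ 1`, hence
    -- the hypothesis `q ≤ 1`, which `gain_of_add` does not need.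
    have h8 : Real.exp (-w) ≤ 1 - w / 2 := by
      have h9 := Real.add_one_le_exp w
      have h10 : Real.exp (-w) * Real.exp w = 1 := by rw [← Real.exp_add]; simp
      have h11 := Real.exp_pos (-w)
      nlinarith
    rw [h3]
    nlinarith

end perturbation

/-! ### One-step drift under the near-critical assumptions. -/

open Polynomial in
/-- The assumptions under which the ruin probability has the order of `x ^ α * exp (-R x)`. -/
structure IsNearCritical {Ω : Type*} [MeasurableSpace Ω] (P : Measure Ω) (τ ξ : ℕ → Ω → ℝ)
    (v : ℝ → ℝ) (V : ℝ → ℝ → ℝ) (M vc α θ : ℝ) (p : ℝ → ℝ) (n : ℕ) (Q : ℝ[X]) (R : ℝ → ℝ) : Prop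
    extends IsRiskModel P τ ξ v V where
  measurable_rate : Measurable v
  rate_le : ∀ z, v z ≤ M
  ruin_pos : ∀ x₀ : ℝ, ∃ ε > 0, ∀ x, 0 ≤ x → x ≤ x₀ → ε ≤ ruinProb P V τ ξ x
  α_pos : 0 < α
  α_lt_one : α < 1
  θ_pos : 0 < θ
  p_pos : ∀ z, 1 < z → 0 < p z
  p_anti : AntitoneOn p (Ioi 1)
  p_int : IntegrableAtFilter p Filter.atTop volume
  rate_approx : ∀ z, 1 < z → |v z - vc - θ / z ^ α| ≤ p z
  two_le : 2 ≤ n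
  one_lt : 1 < (n : ℝ) * α
  time_moment : Integrable (fun ω => τ 0 ω ^ (n + 1)) P
  exp_moment : ∃ r : ℝ, Q.coeff 1 / (1 - α) < r ∧
    Integrable (fun ω => Real.exp (r * ξ 0 ω ^ (1 - α))) P
  centered : ∫ ω, (vc * τ 0 ω - ξ 0 ω) ∂P = 0
  nondegenerate : ∫ ω, (vc * τ 0 ω - ξ 0 ω) ^ 2 ∂P ≠ 0
  coeff_zero : Q.coeff 0 = 0
  coeff_one : 0 < Q.coeff 1
  drift : ∃ K, 0 ≤ K ∧ ∀ u ∈ Icc (0 : ℝ) 1, |∫ ω, taylorIncrement n (Q.eval u)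
    ((vc * τ 0 ω - ξ 0 ω) + θ * τ 0 ω * u) ∂P| ≤ K * u ^ n
  deriv : ∀ x, 0 < x → HasDerivAt R (Q.eval (x ^ (-α))) x

namespace IsNearCritical

open Polynomial

variable {Ω : Type*} [mΩ : MeasurableSpace Ω] {P : Measure Ω} [IsProbabilityMeasure P]
  {τ ξ : ℕ → Ω → ℝ} {v : ℝ → ℝ} {V : ℝ → ℝ → ℝ} {M vc α θ : ℝ} {p : ℝ → ℝ} {n : ℕ} {Q : ℝ[X]}
  {R : ℝ → ℝ}

omit [IsProbabilityMeasure P] in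
lemma errFun_tendsto (h : IsNearCritical P τ ξ v V M vc α θ p n Q R) :
    Filter.Tendsto (errFun p α n) Filter.atTop (nhds 0) := by
  obtain ⟨a, ha2, hint⟩ := exists_integrableOn_errFun h.α_pos h.one_lt h.p_int
  have h1 := tendsto_zero_of_antitoneOn
    (fun z hz => (errFun_bounds (n := n) (α := α) h.p_pos (by linarith)).2.2.2.le)
    ((errFun_antitone h.α_pos h.p_anti).mono (Ioi_subset_Ioi (by linarith))) hint
  refine squeeze_zero' ?_ ?_ h1
  · filter_upwards [Filter.eventually_gt_atTop 1] with z hz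
      using (errFun_bounds h.p_pos hz).2.2.2.le
  · filter_upwards [Filter.eventually_gt_atTop (a + 1)] with z hz
    exact le_mul_of_one_le_left (errFun_bounds h.p_pos (by linarith)).2.2.2.le (by linarith)

/-- The expansion of the one-step increment, with an integrable random constant. -/
lemma exists_increment_bound (h : IsNearCritical P τ ξ v V M vc α θ p n Q R) :
    ∃ G : Ω → ℝ, Integrable G P ∧ (0 ≤ ∫ ω, G ω ∂P) ∧ ∀ᶠ x₁ : ℝ in Filter.atTop,
      MonotoneOn R (Ici x₁) ∧ ∀ᶠ x : ℝ in Filter.atTop, ∀ᵐ ω ∂P,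
        |-(∫ z in x..(max (V x (τ 0 ω) - ξ 0 ω) x₁), Real.exp (-(R z - R x))) -
          taylorIncrement n (Q.eval (x ^ (-α)))
            ((vc * τ 0 ω - ξ 0 ω) + θ * τ 0 ω * x ^ (-α))| ≤ G ω * errFun p α n x := by
  have hα := h.α_pos
  have hα' := h.α_lt_one
  have hθ := h.θ_pos
  have hQ1 := h.coeff_one
  have hM0 : 0 ≤ M := (h.rate_nonneg 0).trans (h.rate_le 0)
  obtain ⟨r, hr, hexp⟩ := h.exp_moment
  have hα1 : 0 < 1 - α := by linarith
  -- Half the gap in the exponential moment condition: `c = Q.coeff 1 + δ₀` eventually dominates the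
  -- slope of `R`, and `c / (1 - α)` is still below `r`.
  set δ₀ := (r * (1 - α) - Q.coeff 1) / 2 with hδ₀
  have hδ₀pos : 0 < δ₀ := by
    rw [div_lt_iff₀ hα1] at hr
    rw [hδ₀]; linarith
  set c := Q.coeff 1 + δ₀ with hc
  have hc0 : 0 < c := by positivity
  have hκr : c / (1 - α) < r := by
    rw [div_lt_iff₀ hα1, hc]; linarith
  set b := M + 1 + |vc| + θ with hb
  have hb0 : 0 ≤ b := by positivity
  obtain ⟨K, hK0, hK⟩ := exists_local_expansion hα h.deriv
  obtain ⟨C, hC0, hC⟩ := exists_abs_increment_le n h.two_le (K := K) (K₂ := 1 + θ * α * M) (c := c)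
    (b := b) (κ := c / (1 - α)) (β := 1 - α) hK0 (by positivity) hc0.le hb0
    (div_nonneg hc0.le hα1.le) hα1.le
  have hts : IndepFun (τ 0) (ξ 0) P :=
    h.indep.indepFun (i := Sum.inl 0) (j := Sum.inr 0) (by simp)
  refine ⟨fun ω => C * ((1 + (τ 0 ω + ξ 0 ω)) ^ (n + 1) *
    Real.exp (c / (1 - α) * ξ 0 ω ^ (1 - α))), (integrable_weight (h.measurable_time 0)
    (h.measurable_claim 0) hts h.time_nonneg h.claim_nonneg h.time_moment hκr hα1 hexp).const_mul C,
    integral_nonneg_of_ae ?_, ?_⟩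
  · filter_upwards [h.time_nonneg, h.claim_nonneg] with ω h0 h1
    simp only [Pi.zero_apply]
    positivity
  -- The first instance gives the upper bound with constant `c`; the second, with tolerance `Q.coeff
  -- 1` itself, is used only for nonnegativity of `R'`.
  obtain ⟨a, ha⟩ := Filter.eventually_atTop.1
    ((eventually_eval_rpow_neg hα h.coeff_zero hδ₀pos).and
      (eventually_eval_rpow_neg hα h.coeff_zero hQ1))
  filter_upwards [Filter.eventually_ge_atTop a, Filter.eventually_ge_atTop 1] with x₁ hx₁a hx₁1
  have hx₁0 : 0 < x₁ := by linarith
  have hup : ∀ x, x₁ ≤ x → Q.eval (x ^ (-α)) ≤ c * x ^ (-α) := fun x hx =>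
    (ha x (hx₁a.trans hx)).1.2
  have hlow : ∀ x, x₁ ≤ x → 0 ≤ Q.eval (x ^ (-α)) := fun x hx => by
    simpa using (ha x (hx₁a.trans hx)).2.1
  have hRm : MonotoneOn R (Ici x₁) := monotoneOn_of_hasDerivAt_nonneg
    (fun x hx => h.deriv x (by linarith)) hlow
  have hRc : ContinuousOn R (Ici x₁) := fun x hx =>
    (h.deriv x (hx₁0.trans_le hx)).continuousAt.continuousWithinAt
  refine ⟨hRm, ?_⟩
  have hbu : ∀ᶠ x : ℝ in Filter.atTop, b ≤ x ^ (-α) * (x / 2) := by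
    have h1 : Filter.Tendsto (fun x : ℝ => x ^ (1 - α) / 2) Filter.atTop Filter.atTop :=
      (tendsto_rpow_atTop hα1).atTop_div_const (by norm_num)
    filter_upwards [h1.eventually_ge_atTop b, Filter.eventually_gt_atTop 0] with x hx hx0
    refine hx.trans_eq ?_
    rw [show (1 : ℝ) - α = -α + 1 by ring, Real.rpow_add hx0, Real.rpow_one]
    ring
  filter_upwards [hbu, Filter.eventually_ge_atTop (2 * x₁), Filter.eventually_ge_atTop 2]
    with x hxb hxx₁ hx2
  filter_upwards [h.time_nonneg, h.claim_nonneg] with ω ht hs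
  have hx0 : 0 < x := by linarith
  have hx1 : 1 < x := by linarith
  obtain ⟨he1, he2, he3, he4⟩ := errFun_bounds (n := n) (α := α) h.p_pos hx1
  have hu1 := rpow_neg_le_one hα hx1.le
  have hu0 : 0 < x ^ (-α) := by positivity
  set u := x ^ (-α) with hu
  set e := errFun p α n x with he
  set t := τ 0 ω
  set s := ξ 0 ω
  have hV1 := h.flow.le h.rate_nonneg x ht
  have hV2 := h.flow.le_add h.rate_nonneg h.rate_le x ht
  have hV3 := h.flow.abs_sub_le h.measurable_rate h.rate_nonneg h.rate_le hα hθ h.p_anti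
    h.rate_approx hx1 ht
  have key := hC R x₁ x u (Q.eval u) e t s (V x t - s - x) ((vc * t - s) + θ * t * u) hx0
    (by linarith) hu0 hu1 (hlow x (by linarith)) (hup x (by linarith)) hRc hRm (hK x hx2)
    (fun z hz hzx => sub_le_of_eval_le hα hα' h.deriv hx₁0 hc0.le hup hz hzx) hxb he2 he3 ht hs
    (by linarith) ?_ ?_ ?_
  · rw [show x + (V x t - s - x) = V x t - s by ring] at key
    rw [← mul_assoc C] at key
    exact key
  · have h1 : 0 ≤ M * t := by positivity
    have h2 : 0 ≤ |vc| + θ := by positivity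
    rw [abs_le]
    constructor <;> nlinarith
  · have h1 : |vc * t| = |vc| * t := by rw [abs_mul, abs_of_nonneg ht]
    have h2 : |θ * t * u| ≤ θ * t := by
      rw [abs_of_nonneg (by positivity)]
      exact mul_le_of_le_one_right (by positivity) hu1
    have h3 : |vc * t - s + θ * t * u| ≤ |vc| * t + s + θ * t := by
      refine (abs_add_le _ _).trans (add_le_add ((abs_sub _ _).trans ?_) h2)
      rw [h1, abs_of_nonneg hs]
    refine h3.trans ?_
    have h4 : 0 ≤ |vc| := abs_nonneg _
    have h5 : 0 ≤ M * (t + s) := by positivity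
    have h6 : 0 ≤ |vc| * s := by positivity
    have h7 : 0 ≤ θ * s := by positivity
    rw [hb]
    linarith [show (M + 1 + |vc| + θ) * (t + s) = M * (t + s) + t + s + |vc| * t + |vc| * s +
      θ * t + θ * s by ring]
  · rw [show V x t - s - x - ((vc * t - s) + θ * t * u) =
      V x t - x - (vc * t + θ * t * u) by ring]
    refine hV3.trans ?_
    have h1 : t ≤ (1 + (t + s)) ^ 2 := by nlinarith
    have h2 : t ^ 2 ≤ (1 + (t + s)) ^ 2 := by gcongr; linarith
    have hp0 := (h.p_pos x hx1).le
    calc t * p x + θ * α * M * t ^ 2 * (u / x)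
        ≤ (1 + (t + s)) ^ 2 * e + θ * α * M * (1 + (t + s)) ^ 2 * e := by gcongr
      _ = _ := by ring

/-- Downward jumps of a fixed size have probability bounded away from zero. -/
lemma exists_prob_neg (h : IsNearCritical P τ ξ v V M vc α θ p n Q R)
    (hA : Integrable (fun ω => vc * τ 0 ω - ξ 0 ω) P) :
    ∃ δ κ, 0 < δ ∧ δ ≤ 1 ∧ 0 < κ ∧ ∀ᶠ x : ℝ in Filter.atTop,
      κ ≤ P.real {ω | V x (τ 0 ω) - ξ 0 ω - x < -δ} := by
  -- A centred variable that is not almost surely zero must take negative values.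
  have hneg : P {ω | vc * τ 0 ω - ξ 0 ω < 0} ≠ 0 := by
    intro h0
    have h1 : 0 ≤ᵐ[P] fun ω => vc * τ 0 ω - ξ 0 ω := by
      filter_upwards [measure_eq_zero_iff_ae_notMem.1 h0] with ω hω
      exact not_lt.1 hω
    have h2 := (integral_eq_zero_iff_of_nonneg_ae h1 hA).1 h.centered
    refine h.nondegenerate ?_
    rw [integral_congr_ae (g := fun _ => (0 : ℝ))]
    · simp
    · filter_upwards [h2] with ω hω
      simp only [Pi.zero_apply] at hω
      rw [hω]; norm_num
  -- Bounding `τ` on `S m` makes the flow error uniform in `ω`. The jump is required to exceed twice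
  -- the final `δ`, leaving room of one `δ` for that error at high levels.
  set S : ℕ → Set Ω := fun m =>
    {ω | vc * τ 0 ω - ξ 0 ω < -(2 * (1 / ((m : ℝ) + 1))) ∧ τ 0 ω ≤ (m : ℝ) + 1} with hS
  have hcover : {ω | vc * τ 0 ω - ξ 0 ω < 0} ⊆ ⋃ m, S m := by
    intro ω hω
    have hω' : 0 < -(vc * τ 0 ω - ξ 0 ω) / 2 := by
      have : vc * τ 0 ω - ξ 0 ω < 0 := hω
      linarith
    obtain ⟨m, hm⟩ := ((tendsto_one_div_add_atTop_nhds_zero_nat.eventually_lt_const hω').and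
      ((tendsto_natCast_atTop_atTop (R := ℝ)).eventually_ge_atTop (τ 0 ω))).exists
    exact mem_iUnion.2 ⟨m, by linarith [hm.1], by linarith [hm.2]⟩
  obtain ⟨m, hm⟩ : ∃ m, P (S m) ≠ 0 := by
    by_contra hcon
    push Not at hcon
    exact hneg (measure_mono_null hcover (measure_iUnion_null hcon))
  have hm1 : (0 : ℝ) < (m : ℝ) + 1 := by positivity
  set δ : ℝ := 1 / ((m : ℝ) + 1) with hδ
  have hδ0 : 0 < δ := by positivity
  refine ⟨δ, P.real (S m), hδ0, ?_, ?_, ?_⟩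
  · rw [hδ, div_le_one hm1]; linarith [(Nat.cast_nonneg m : (0 : ℝ) ≤ m)]
  · exact ENNReal.toReal_pos hm (measure_ne_top _ _)
  have hM0 : 0 ≤ M := (h.rate_nonneg 0).trans (h.rate_le 0)
  have hlim : Filter.Tendsto (fun x : ℝ => ((m : ℝ) + 1) * errFun p α n x +
      θ * α * M * ((m : ℝ) + 1) ^ 2 * errFun p α n x + θ * ((m : ℝ) + 1) * x ^ (-α))
      Filter.atTop (nhds 0) := by
    have h1 := ((h.errFun_tendsto.const_mul ((m : ℝ) + 1)).add
      (h.errFun_tendsto.const_mul (θ * α * M * ((m : ℝ) + 1) ^ 2))).add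
      ((tendsto_rpow_neg h.α_pos).const_mul (θ * ((m : ℝ) + 1)))
    simpa using h1
  filter_upwards [hlim.eventually_lt_const hδ0, Filter.eventually_gt_atTop 1] with x hx hx1
  have hx0 : 0 < x := by linarith
  refine ENNReal.toReal_mono (measure_ne_top _ _) (measure_mono_ae ?_)
  filter_upwards [h.time_nonneg] with ω ht hω
  obtain ⟨h1, h2⟩ : vc * τ 0 ω - ξ 0 ω < -(2 * δ) ∧ τ 0 ω ≤ (m : ℝ) + 1 := hω
  obtain ⟨he1, he2, he3, he4⟩ := errFun_bounds (n := n) (α := α) h.p_pos hx1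
  have hV3 := h.flow.abs_sub_le h.measurable_rate h.rate_nonneg h.rate_le h.α_pos h.θ_pos h.p_anti
    h.rate_approx hx1 ht
  have hθ := h.θ_pos
  have hα := h.α_pos
  have hp0 := (h.p_pos x hx1).le
  have h3 : τ 0 ω * p x ≤ ((m : ℝ) + 1) * errFun p α n x := by gcongr
  have h4 : θ * α * M * τ 0 ω ^ 2 * (x ^ (-α) / x) ≤
      θ * α * M * ((m : ℝ) + 1) ^ 2 * errFun p α n x := by gcongr
  have h5 : θ * τ 0 ω * x ^ (-α) ≤ θ * ((m : ℝ) + 1) * x ^ (-α) := by gcongr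
  have h6 := (le_abs_self _).trans hV3
  change V x (τ 0 ω) - ξ 0 ω - x < -δ
  linarith

end IsNearCritical
end LevelDependentRisk

/-! ### Construction of the two test functions and two-sided bounds. -/

namespace LevelDependentRisk

section moments

variable {Ω : Type*} [mΩ : MeasurableSpace Ω] {P : Measure Ω} [IsProbabilityMeasure P]

lemma integrable_pow_mul_pow {t s : Ω → ℝ} (ht : Measurable t) (hs : Measurable s)
    (hts : IndepFun t s P) (ht0 : ∀ᵐ ω ∂P, 0 ≤ t ω) (hs0 : ∀ᵐ ω ∂P, 0 ≤ s ω) {N : ℕ}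
    (htN : Integrable (fun ω => t ω ^ N) P) {r β : ℝ} (hr : 0 < r) (hβ : 0 < β)
    (hexp : Integrable (fun ω => Real.exp (r * s ω ^ β)) P) (c d : ℝ) {i j : ℕ}
    (hij : i + j ≤ N) :
    Integrable (fun ω => (c * t ω - s ω) ^ i * (d * t ω) ^ j) P := by
  have hw := integrable_weight ht hs hts ht0 hs0 htN hr hβ hexp
  refine Integrable.mono' (hw.const_mul ((1 + |c| + |d|) ^ (i + j))) (by fun_prop) ?_
  filter_upwards [ht0, hs0] with ω h0 h1
  set t' := t ω
  set s' := s ω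
  have e1 : |c * t' - s'| ≤ (1 + |c| + |d|) * (1 + (t' + s')) := by
    refine (abs_sub _ _).trans ?_
    rw [abs_mul, abs_of_nonneg h0, abs_of_nonneg h1]
    have := abs_nonneg c
    have := abs_nonneg d
    nlinarith [mul_nonneg (abs_nonneg c) h1, mul_nonneg (abs_nonneg d) h1,
      mul_nonneg (abs_nonneg d) h0]
  have e2 : |d * t'| ≤ (1 + |c| + |d|) * (1 + (t' + s')) := by
    rw [abs_mul, abs_of_nonneg h0]
    nlinarith [abs_nonneg c, abs_nonneg d, mul_nonneg (abs_nonneg c) h1,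
      mul_nonneg (abs_nonneg d) h1, mul_nonneg (abs_nonneg c) h0]
  rw [Real.norm_eq_abs, abs_mul, abs_pow, abs_pow, zero_mul, Real.exp_zero, mul_one]
  calc |c * t' - s'| ^ i * |d * t'| ^ j
      ≤ ((1 + |c| + |d|) * (1 + (t' + s'))) ^ i * ((1 + |c| + |d|) * (1 + (t' + s'))) ^ j := by
        gcongr
    _ = (1 + |c| + |d|) ^ (i + j) * (1 + (t' + s')) ^ (i + j) := by rw [← pow_add, mul_pow]
    _ ≤ _ := by
        gcongr
        linarith

end moments

namespace IsNearCritical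

open Polynomial

variable {Ω : Type*} [mΩ : MeasurableSpace Ω] {P : Measure Ω} [IsProbabilityMeasure P]
  {τ ξ : ℕ → Ω → ℝ} {v : ℝ → ℝ} {V : ℝ → ℝ → ℝ} {M vc α θ : ℝ} {p : ℝ → ℝ} {n : ℕ} {Q : ℝ[X]}
  {R : ℝ → ℝ}

lemma integrable_pow_mul_pow (h : IsNearCritical P τ ξ v V M vc α θ p n Q R) {i j : ℕ}
    (hij : i + j ≤ n) :
    Integrable (fun ω => (vc * τ 0 ω - ξ 0 ω) ^ i * (θ * τ 0 ω) ^ j) P := by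
  obtain ⟨r, hr, hexp⟩ := h.exp_moment
  have hα1 : 0 < 1 - α := by linarith [h.α_lt_one]
  exact LevelDependentRisk.integrable_pow_mul_pow (h.measurable_time 0) (h.measurable_claim 0)
    (h.indep.indepFun (i := Sum.inl 0) (j := Sum.inr 0) (by simp)) h.time_nonneg h.claim_nonneg
    h.time_moment ((div_pos h.coeff_one hα1).trans hr) hα1 hexp vc θ (by omega)

lemma integrable_taylorIncrement (h : IsNearCritical P τ ξ v V M vc α θ p n Q R) (ρ u : ℝ) :
    Integrable (fun ω => taylorIncrement n ρ ((vc * τ 0 ω - ξ 0 ω) + θ * τ 0 ω * u)) P := by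
  simp only [taylorIncrement]
  refine integrable_finsetSum _ fun k hk => Integrable.div_const (Integrable.const_mul ?_ _) _
  have hk' := Finset.mem_range.1 hk
  exact integrable_add_mul_pow (fun i j hij => h.integrable_pow_mul_pow (by omega)) u

/-- Perturbing the exponent by a bounded increasing function turns the test function into a
superharmonic or a subharmonic one. -/
lemma exists_perturbation (h : IsNearCritical P τ ξ v V M vc α θ p n Q R) :
    ∃ (E : ℝ → ℝ) (L x₁ x₂ : ℝ), Continuous E ∧ 1 ≤ x₁ ∧ x₁ ≤ x₂ ∧
      (∀ x, x₁ ≤ x → 0 ≤ E x ∧ E x ≤ L) ∧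
      IntegrableOn (fun y => Real.exp (-R y)) (Ioi x₁) ∧
      Filter.Tendsto (fun x => ∫ y in Ioi x, Real.exp (-R y)) Filter.atTop (nhds 0) ∧
      (∀ x, x₁ ≤ x → Q.coeff 1 / 2 * ∫ y in Ioi x, Real.exp (-R y) ≤ x ^ α * Real.exp (-R x) ∧
        x ^ α * Real.exp (-R x) ≤ 2 * Q.coeff 1 * ∫ y in Ioi x, Real.exp (-R y)) ∧
      (IntegrableOn (fun y => Real.exp (-(R y + E y))) (Ioi x₁) → ∀ x, x₂ ≤ x →
        tailRatio (fun y => R y + E y) x₁ x ≤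
          stepOp P V (τ 0) (ξ 0) (tailRatio (fun y => R y + E y) x₁) x) ∧
      (IntegrableOn (fun y => Real.exp (-(R y - E y))) (Ioi x₁) → ∀ x, x₂ ≤ x →
        stepOp P V (τ 0) (ξ 0) (tailRatio (fun y => R y - E y) x₁) x ≤
          tailRatio (fun y => R y - E y) x₁ x) := by
  obtain ⟨G, hG, hG0, hGx⟩ := h.exists_increment_bound
  have hA : Integrable (fun ω => vc * τ 0 ω - ξ 0 ω) P := by
    simpa using h.integrable_pow_mul_pow (i := 1) (j := 0) (by linarith [h.two_le])
  obtain ⟨δ, κ, hδ0, hδ1, hκ, hprob⟩ := h.exists_prob_neg hA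
  obtain ⟨K, hK0, hK⟩ := h.drift
  obtain ⟨a, ha2, hint⟩ := exists_integrableOn_errFun h.α_pos h.one_lt h.p_int
  obtain ⟨x₁, ⟨⟨hRm, hinc⟩, hRint, hRlim, hRcmp⟩, hax₁⟩ := ((hGx.and (exists_tail_integral_bounds
    h.α_pos h.α_lt_one h.coeff_zero h.coeff_one h.deriv)).and (Filter.eventually_ge_atTop a)).exists
  have hx₁2 : 2 ≤ x₁ := ha2.trans hax₁
  obtain ⟨E, L, hEc, hL0, hEL, hEm, hEe⟩ := exists_bounded_primitive
    (fun z hz => (errFun_bounds (n := n) (α := α) h.p_pos (by linarith)).2.2.2.le)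
    ((errFun_antitone h.α_pos h.p_anti).mono (Ioi_subset_Ioi (by linarith)))
    (hint.mono_set (Ioi_subset_Ioi hax₁))
  set EG := ∫ ω, G ω ∂P with hEG
  -- Chosen so that the guaranteed gain `B * e * δ ^ 2 / 4 * κ` equals `(K + EG) * e`, the sum of
  -- the Taylor drift error and the mean expansion error.
  set B := 4 * (K + EG) / (δ ^ 2 * κ) with hB
  have hB0 : 0 ≤ B := by positivity
  have hq1 : ∀ᶠ x in Filter.atTop, B * errFun p α n x ≤ 1 := by
    have := h.errFun_tendsto.const_mul B
    rw [mul_zero] at this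
    exact this.eventually_le_const zero_lt_one
  obtain ⟨x₂, hx₂⟩ := Filter.eventually_atTop.1 (((hinc.and hprob).and hq1).and
    (Filter.eventually_ge_atTop (x₁ + 1)))
  have hx₁2' : x₁ + 1 ≤ x₂ := (hx₂ x₂ le_rfl).2
  have hRc : ContinuousOn R (Ici x₁) := fun x hx =>
    (h.deriv x (by have : x₁ ≤ x := hx; linarith)).continuousAt.continuousWithinAt
  have hBEc : Continuous fun z => B * E z := continuous_const.mul hEc
  have hmeas : ∀ x, MeasurableSet {ω | V x (τ 0 ω) - ξ 0 ω - x < -δ} := fun x =>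
    measurableSet_lt ((measurable_step h.flow.measurable (h.measurable_time 0)
      (h.measurable_claim 0) x).sub measurable_const) measurable_const
  have hgain : ∀ (x q : ℝ), Integrable (fun ω =>
      if V x (τ 0 ω) - ξ 0 ω - x < -δ then q * δ ^ 2 / 4 else 0) P ∧
      ∫ ω, (if V x (τ 0 ω) - ξ 0 ω - x < -δ then q * δ ^ 2 / 4 else 0) ∂P =
        q * δ ^ 2 / 4 * P.real {ω | V x (τ 0 ω) - ξ 0 ω - x < -δ} := fun x q => by
    have e : (fun ω => if V x (τ 0 ω) - ξ 0 ω - x < -δ then q * δ ^ 2 / 4 else 0) =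
        {ω | V x (τ 0 ω) - ξ 0 ω - x < -δ}.indicator fun _ => q * δ ^ 2 / 4 := by
      ext ω
      simp only [indicator_apply, mem_ofPred_eq]
    rw [e]
    refine ⟨(integrable_const _).indicator (hmeas x), ?_⟩
    rw [integral_indicator (hmeas x), setIntegral_const, smul_eq_mul, mul_comm]
  have hbalance : ∀ x, x₂ ≤ x → |∫ ω, taylorIncrement n (Q.eval (x ^ (-α)))
        ((vc * τ 0 ω - ξ 0 ω) + θ * τ 0 ω * x ^ (-α)) ∂P| + EG * errFun p α n x ≤
      B * errFun p α n x * δ ^ 2 / 4 * P.real {ω | V x (τ 0 ω) - ξ 0 ω - x < -δ} := by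
    intro x hx
    have hx1 : 1 < x := by linarith
    have hx0 : 0 < x := by linarith
    obtain ⟨-, he2, -, he4⟩ := errFun_bounds (n := n) (α := α) h.p_pos hx1
    have h1 := hK (x ^ (-α)) ⟨by positivity, rpow_neg_le_one h.α_pos hx1.le⟩
    have h2 := (hx₂ x hx).1.1.2
    have h3 : B * errFun p α n x * δ ^ 2 / 4 * κ = (K + EG) * errFun p α n x := by
      rw [hB]; field_simp
    calc _ ≤ K * errFun p α n x + EG * errFun p α n x := by
          gcongr; exact h1.trans (by gcongr)
      _ = B * errFun p α n x * δ ^ 2 / 4 * κ := by rw [h3]; ring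
      _ ≤ _ := by gcongr
  refine ⟨fun z => B * E z, B * L, x₁, x₂, hBEc, by linarith, by linarith, fun x hx => ?_, hRint,
    hRlim, hRcmp, fun hi x hx => ?_, fun hi x hx => ?_⟩
  · exact ⟨mul_nonneg hB0 (hEL x hx).1, mul_le_mul_of_nonneg_left (hEL x hx).2 hB0⟩
  · obtain ⟨⟨⟨hx_inc, -⟩, hxq⟩, hxx₁⟩ := hx₂ x hx
    have he := (errFun_bounds (n := n) (α := α) h.p_pos (show 1 < x by linarith)).2.2.2.le
    have hT := h.integrable_taylorIncrement (Q.eval (x ^ (-α))) (x ^ (-α))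
    obtain ⟨hg1, hg2⟩ := hgain x (B * errFun p α n x)
    refine h.tailRatio_le_stepOp hi (by linarith)
      ((hT.sub (hG.mul_const (errFun p α n x))).add hg1) ?_ ?_
    · rw [integral_add' (hT.sub (hG.mul_const _)) hg1, integral_sub' hT (hG.mul_const _), hg2,
        integral_mul_const]
      have := hbalance x hx
      linarith [neg_abs_le (∫ ω, taylorIncrement n (Q.eval (x ^ (-α)))
        ((vc * τ 0 ω - ξ 0 ω) + θ * τ 0 ω * x ^ (-α)) ∂P)]
    · filter_upwards [hx_inc] with ω hω
      have h1 := gain_of_add (Δ := V x (τ 0 ω) - ξ 0 ω - x) hRc hRm hBEc.continuousOn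
        hxx₁ hδ0.le hδ1 (mul_nonneg hB0 he)
        (fun z hz => mul_le_mul_of_nonneg_left (hEm x z (by linarith) hz) hB0)
        (fun z hz hzx => by
          have := mul_le_mul_of_nonneg_left (hEe z x hz hzx (by linarith)) hB0
          linarith)
      rw [show x + (V x (τ 0 ω) - ξ 0 ω - x) = V x (τ 0 ω) - ξ 0 ω by ring] at h1
      refine le_trans ?_ h1
      simp only [Pi.add_apply, Pi.sub_apply]
      linarith [(abs_le.1 hω).1]
  · obtain ⟨⟨⟨hx_inc, -⟩, hxq⟩, hxx₁⟩ := hx₂ x hx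
    have he := (errFun_bounds (n := n) (α := α) h.p_pos (show 1 < x by linarith)).2.2.2.le
    have hT := h.integrable_taylorIncrement (Q.eval (x ^ (-α))) (x ^ (-α))
    obtain ⟨hg1, hg2⟩ := hgain x (B * errFun p α n x)
    refine h.stepOp_tailRatio_le hi (by linarith)
      ((hT.add (hG.mul_const (errFun p α n x))).sub hg1) ?_ ?_
    · rw [integral_sub' (hT.add (hG.mul_const _)) hg1, integral_add' hT (hG.mul_const _), hg2,
        integral_mul_const]
      have := hbalance x hx
      linarith [le_abs_self (∫ ω, taylorIncrement n (Q.eval (x ^ (-α)))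
        ((vc * τ 0 ω - ξ 0 ω) + θ * τ 0 ω * x ^ (-α)) ∂P)]
    · filter_upwards [hx_inc] with ω hω
      have h1 := gain_of_sub (Δ := V x (τ 0 ω) - ξ 0 ω - x) hRc hRm hBEc.continuousOn
        hxx₁ hδ0.le hδ1 (mul_nonneg hB0 he) hxq
        (fun z hz => mul_le_mul_of_nonneg_left (hEm x z (by linarith) hz) hB0)
        (fun z hz hzx => by
          have := mul_le_mul_of_nonneg_left (hEe z x hz hzx (by linarith)) hB0
          linarith)
      rw [show x + (V x (τ 0 ω) - ξ 0 ω - x) = V x (τ 0 ω) - ξ 0 ω by ring] at h1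
      refine h1.trans ?_
      simp only [Pi.add_apply, Pi.sub_apply]
      linarith [(abs_le.1 hω).2]

/-- The ruin probability has the order of `x ^ α * exp (-R x)`. -/
theorem ruinProb_bounds (h : IsNearCritical P τ ξ v V M vc α θ p n Q R) :
    ∃ C₁ C₂ : ℝ, 0 < C₁ ∧ C₁ < C₂ ∧ ∀ x, 1 < x →
      C₁ * (x ^ α * Real.exp (-R x)) ≤ ruinProb P V τ ξ x ∧
        ruinProb P V τ ξ x ≤ C₂ * (x ^ α * Real.exp (-R x)) := by
  obtain ⟨E, L, x₁, x₂, hEc, hx₁, hx₁₂, hEL, hRint, hRlim, hcmp, hsub, hsup⟩ :=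
    h.exists_perturbation
  have hr := h.coeff_one
  set f : ℝ → ℝ := fun x => x ^ α * Real.exp (-R x) with hf
  have hfpos : ∀ x, 1 ≤ x → 0 < f x := fun x hx => by
    have : 0 < x := by linarith
    positivity
  have hfc : ContinuousOn f (Icc 1 x₂) := fun x hx => by
    have hx0 : 0 < x := by linarith [hx.1]
    exact ((Real.continuousAt_rpow_const x α (Or.inl hx0.ne')).mul
      (h.deriv x hx0).continuousAt.neg.rexp).continuousWithinAt
  have hRc : ContinuousOn R (Ioi x₁) := fun x hx =>
    (h.deriv x (by have : x₁ < x := hx; linarith)).continuousAt.continuousWithinAt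
  have hip : IntegrableOn (fun y => Real.exp (-(R y + E y))) (Ioi x₁) := by
    refine Integrable.mono' hRint (ContinuousOn.aestronglyMeasurable
      (by have := hEc.continuousOn (s := Ioi x₁); fun_prop) measurableSet_Ioi) ?_
    refine (ae_restrict_iff' measurableSet_Ioi).2 (Filter.Eventually.of_forall fun y hy => ?_)
    rw [Real.norm_eq_abs, abs_of_pos (Real.exp_pos _)]
    exact Real.exp_le_exp.2 (by linarith [(hEL y (le_of_lt hy)).1])
  have him : IntegrableOn (fun y => Real.exp (-(R y - E y))) (Ioi x₁) := by
    refine Integrable.mono' (hRint.const_mul (Real.exp L)) (ContinuousOn.aestronglyMeasurable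
      (by have := hEc.continuousOn (s := Ioi x₁); fun_prop) measurableSet_Ioi) ?_
    refine (ae_restrict_iff' measurableSet_Ioi).2 (Filter.Eventually.of_forall fun y hy => ?_)
    rw [Real.norm_eq_abs, abs_of_pos (Real.exp_pos _), ← Real.exp_add]
    exact Real.exp_le_exp.2 (by linarith [(hEL y (le_of_lt hy)).2])
  have hmono : ∀ x, x₁ ≤ x → Ioi x ⊆ Ioi x₁ := fun x hx => Ioi_subset_Ioi hx
  -- As `E` takes values in `[0, L]`, the perturbed tails differ from the unperturbed one by a
  -- factor of at most `exp L`.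
  have hp1 : ∀ x, x₁ ≤ x → Real.exp (-L) * ∫ y in Ioi x, Real.exp (-R y) ≤
      tailFun (fun y => R y + E y) x₁ x := fun x hx => by
    rw [tailFun, max_eq_left hx, ← integral_const_mul]
    refine setIntegral_mono_on ((hRint.mono_set (hmono x hx)).const_mul _)
      (hip.mono_set (hmono x hx)) measurableSet_Ioi fun y hy => ?_
    rw [← Real.exp_add]
    exact Real.exp_le_exp.2 (by linarith [(hEL y (hx.trans (le_of_lt hy))).2])
  have hp2 : ∀ x, x₁ ≤ x → tailFun (fun y => R y + E y) x₁ x ≤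
      ∫ y in Ioi x, Real.exp (-R y) := fun x hx => by
    rw [tailFun, max_eq_left hx]
    exact setIntegral_mono_on (hip.mono_set (hmono x hx))
      (hRint.mono_set (hmono x hx)) measurableSet_Ioi fun y hy =>
        Real.exp_le_exp.2 (by linarith [(hEL y (hx.trans (le_of_lt hy))).1])
  have hm : ∀ x, x₁ ≤ x → tailFun (fun y => R y - E y) x₁ x ≤
      Real.exp L * ∫ y in Ioi x, Real.exp (-R y) := fun x hx => by
    rw [tailFun, max_eq_left hx, ← integral_const_mul]
    refine setIntegral_mono_on (him.mono_set (hmono x hx))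
      ((hRint.mono_set (hmono x hx)).const_mul _) measurableSet_Ioi fun y hy => ?_
    rw [← Real.exp_add]
    exact Real.exp_le_exp.2 (by linarith [(hEL y (hx.trans (le_of_lt hy))).2])
  have hx₂0 : 0 ≤ x₂ := by linarith
  have hwp := tailFun_pos (R := fun y => R y + E y) hip x₁
  have hwm := tailFun_pos (R := fun y => R y - E y) him x₁
  have hlim : Filter.Tendsto (tailRatio (fun y => R y + E y) x₁) Filter.atTop (nhds 0) := by
    have h1 := hRlim.div_const (tailFun (fun y => R y + E y) x₁ x₁)
    rw [zero_div] at h1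
    refine squeeze_zero' (Filter.Eventually.of_forall fun x =>
      (tailRatio_pos (R := fun y => R y + E y) hip x).le) ?_ h1
    filter_upwards [Filter.eventually_ge_atTop x₁] with x hx
    exact div_le_div_of_nonneg_right (hp2 x hx) hwp.le
  obtain ⟨c, hc, hcl⟩ := h.exists_mul_le_ruinProb h.ruin_pos (tailRatio_antitone hip)
    (tailRatio_mem_Icc hip) hlim hx₂0 (hsub hip)
  have hu := fun x hx => h.ruinProb_le_of_stepOp_le (tailRatio_antitone him)
    (tailRatio_mem_Icc him) hx₂0 (tailRatio_pos him x₂) (hsup him) (x := x) hx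
  have hψ1 : ∀ x, 0 ≤ x → ruinProb P V τ ξ x ≤ 1 := fun x hx => by
    rw [h.ruinProb_eq hx]; linarith [(h.survivalLim_mem_Icc x).1]
  obtain ⟨ε, hε, hεψ⟩ := h.ruin_pos x₂
  have hne : (Icc (1 : ℝ) x₂).Nonempty := ⟨1, left_mem_Icc.2 (hx₁.trans hx₁₂)⟩
  obtain ⟨y₁, hy₁, hmin⟩ := isCompact_Icc.exists_isMinOn hne hfc
  obtain ⟨y₂, hy₂, hmax⟩ := isCompact_Icc.exists_isMaxOn hne hfc
  have hf1 := hfpos y₁ hy₁.1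
  have hf2 := hfpos y₂ hy₂.1
  set a₁ := c * Real.exp (-L) / (2 * Q.coeff 1 * tailFun (fun y => R y + E y) x₁ x₁) with ha₁
  set a₂ := Real.exp L * 2 / (Q.coeff 1 * tailFun (fun y => R y - E y) x₁ x₁ *
    tailRatio (fun y => R y - E y) x₁ x₂) with ha₂
  have ha₁0 : 0 < a₁ := by positivity
  have hlow : ∀ x, x₂ ≤ x → a₁ * f x ≤ ruinProb P V τ ξ x := fun x hx => by
    have hx1 := hx₁₂.trans hx
    refine le_trans ?_ (hcl x (by linarith))
    have h1 := (hcmp x hx1).2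
    have h2 := hp1 x hx1
    rw [ha₁, tailRatio, div_mul_eq_mul_div, mul_div_assoc', div_le_div_iff₀ (by positivity) hwp]
    have h3 : f x * Real.exp (-L) ≤ 2 * Q.coeff 1 * tailFun (fun y => R y + E y) x₁ x := by
      calc f x * Real.exp (-L) ≤ (2 * Q.coeff 1 * ∫ y in Ioi x, Real.exp (-R y)) *
            Real.exp (-L) := mul_le_mul_of_nonneg_right h1 (Real.exp_pos _).le
        _ = 2 * Q.coeff 1 * (Real.exp (-L) * ∫ y in Ioi x, Real.exp (-R y)) := by ring
        _ ≤ _ := mul_le_mul_of_nonneg_left h2 (by positivity)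
    have h4 := mul_le_mul_of_nonneg_left h3
      (show 0 ≤ c * tailFun (fun y => R y + E y) x₁ x₁ by positivity)
    linarith
  have hup : ∀ x, x₂ ≤ x → ruinProb P V τ ξ x ≤ a₂ * f x := fun x hx => by
    have hx1 := hx₁₂.trans hx
    refine (hu x (by linarith)).trans ?_
    have h1 := (hcmp x hx1).1
    have h2 := hm x hx1
    have hw2 := tailRatio_pos (R := fun y => R y - E y) him x₂
    rw [ha₂, tailRatio, div_div, div_mul_eq_mul_div, div_le_div_iff₀ (by positivity)
      (by positivity)]
    have h3 : Q.coeff 1 * tailFun (fun y => R y - E y) x₁ x ≤ Real.exp L * 2 * f x := by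
      calc Q.coeff 1 * tailFun (fun y => R y - E y) x₁ x
          ≤ Q.coeff 1 * (Real.exp L * ∫ y in Ioi x, Real.exp (-R y)) :=
            mul_le_mul_of_nonneg_left h2 hr.le
        _ = Real.exp L * 2 * (Q.coeff 1 / 2 * ∫ y in Ioi x, Real.exp (-R y)) := by ring
        _ ≤ _ := mul_le_mul_of_nonneg_left h1 (by positivity)
    have h4 := mul_le_mul_of_nonneg_right h3 (show 0 ≤ tailFun (fun y => R y - E y) x₁ x₁ *
      tailRatio (fun y => R y - E y) x₁ x₂ by positivity)
    linarith
  -- On `[1, x₂]` the ruin probability lies in `[ε, 1]` and `f` between its extrema `f y₁` and `f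
  -- y₂`. The term `a₁ + 1` only makes the constants strictly ordered.
  refine ⟨min a₁ (ε / f y₂), max (max a₂ (1 / f y₁)) (a₁ + 1), lt_min ha₁0 (by positivity),
    lt_of_le_of_lt (min_le_left _ _) (lt_of_lt_of_le (lt_add_one a₁) (le_max_right _ _)),
    fun x hx => ?_⟩
  have hfx := hfpos x hx.le
  rcases le_total x₂ x with hx2 | hx2
  · refine ⟨le_trans ?_ (hlow x hx2), (hup x hx2).trans ?_⟩
    · exact mul_le_mul_of_nonneg_right (min_le_left _ _) hfx.le
    · exact mul_le_mul_of_nonneg_right ((le_max_left _ _).trans (le_max_left _ _)) hfx.le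
  · have hxm : x ∈ Icc 1 x₂ := ⟨hx.le, hx2⟩
    have h1 : f y₁ ≤ f x := hmin hxm
    have h2 : f x ≤ f y₂ := hmax hxm
    constructor
    · calc min a₁ (ε / f y₂) * f x ≤ ε / f y₂ * f y₂ :=
            mul_le_mul (min_le_right _ _) h2 hfx.le (by positivity)
        _ = ε := div_mul_cancel₀ _ hf2.ne'
        _ ≤ _ := hεψ x (by linarith) hx2
    · calc ruinProb P V τ ξ x ≤ 1 := hψ1 x (by linarith)
        _ = 1 / f y₁ * f y₁ := (div_mul_cancel₀ _ hf1.ne').symm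
        _ ≤ _ := mul_le_mul ((le_max_right _ _).trans (le_max_left _ _)) h1 hf1.le
          (le_trans (by positivity) (le_max_right _ _))

end IsNearCritical
end LevelDependentRisk

/-! ### The degenerate case, the variance, and the explicit exponents. -/

namespace LevelDependentRisk

section degenerate

variable {Ω : Type*} [mΩ : MeasurableSpace Ω] {P : Measure Ω} [IsProbabilityMeasure P]
  {τ ξ : ℕ → Ω → ℝ} {v : ℝ → ℝ} {V : ℝ → ℝ → ℝ} {α θ vc : ℝ} {p : ℝ → ℝ}

/-- A decreasing integrable `p` is `o(1 / z)`, hence eventually below `θ / z ^ α` as `α < 1`. -/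
lemma eventually_le_rate (hα' : α < 1) (hθ : 0 < θ)
    (hp : ∀ z, 1 < z → 0 < p z) (hanti : AntitoneOn p (Ioi 1))
    (hint : IntegrableAtFilter p Filter.atTop volume)
    (hrate : ∀ z, 1 < z → |v z - vc - θ / z ^ α| ≤ p z) :
    ∀ᶠ z in Filter.atTop, vc ≤ v z := by
  obtain ⟨s, hs, hps⟩ := hint
  obtain ⟨a, ha⟩ := Filter.mem_atTop_sets.1 hs
  set b := max a 1 with hb
  have hb1 : 1 ≤ b := le_max_right _ _
  have h1 := tendsto_zero_of_antitoneOn (a := b) (fun z hz => (hp z (by linarith)).le)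
    (hanti.mono (Ioi_subset_Ioi hb1))
    (hps.mono_set fun y hy => ha y ((le_max_left _ _).trans (le_of_lt hy)))
  have h2 : Filter.Tendsto (fun z : ℝ => θ * (z ^ (1 - α) / 2)) Filter.atTop Filter.atTop :=
    ((tendsto_rpow_atTop (by linarith)).atTop_div_const (by norm_num)).const_mul_atTop hθ
  filter_upwards [h1.eventually_le_const zero_lt_one, h2.eventually_ge_atTop 1,
    Filter.eventually_gt_atTop (2 * b)] with z hz1 hz2 hz3
  have hz0 : 0 < z := by linarith
  have h3 : θ * (z ^ (1 - α) / 2) ≤ θ / z ^ α * (z - b) := by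
    rw [Real.rpow_sub hz0, Real.rpow_one, div_mul_eq_mul_div, mul_div_assoc, div_div,
      mul_comm (z ^ α), ← div_div]
    have : z / 2 ≤ z - b := by linarith
    gcongr
  have h4 : p z ≤ θ / z ^ α := by
    by_contra hcon
    have : θ / z ^ α * (z - b) < p z * (z - b) :=
      mul_lt_mul_of_pos_right (not_le.1 hcon) (by linarith)
    linarith
  have := (abs_le.1 (hrate z (by linarith))).1
  linarith

/-- If each claim is a.s. compensated by the critical premium, then ruin is impossible from a
large initial reserve. -/
lemma IsRiskModel.exists_ruinProb_eq_zero (h : IsRiskModel P τ ξ v V) (hvm : Measurable v) {M : ℝ}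
    (hM : ∀ z, v z ≤ M) (hev : ∀ᶠ z in Filter.atTop, vc ≤ v z)
    (hdeg : ∀ᵐ ω ∂P, vc * τ 0 ω - ξ 0 ω = 0) :
    ∃ x, 0 ≤ x ∧ ruinProb P V τ ξ x = 0 := by
  obtain ⟨a, ha⟩ := Filter.eventually_atTop.1 hev
  refine ⟨max a 0, le_max_right _ _, h.ruinProb_eq_zero (le_max_right _ _) fun x hx => ?_⟩
  filter_upwards [hdeg, h.time_nonneg] with ω h1 ht
  have hxa : a ≤ x := (le_max_left _ _).trans hx
  have h2 : ∫ _ in (0 : ℝ)..(τ 0 ω), vc ≤ ∫ s in (0 : ℝ)..(τ 0 ω), v (V x s) :=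
    intervalIntegral.integral_mono_on ht (by simp)
      (h.flow.intervalIntegrable hvm h.rate_nonneg hM x _ _) fun s hs =>
        ha _ (hxa.trans (h.flow.le h.rate_nonneg x hs.1))
  rw [h.flow.integral_eq x _ ht]
  simp only [intervalIntegral.integral_const, sub_zero, smul_eq_mul] at h2
  linarith

end degenerate

section variance

variable {Ω : Type*} [mΩ : MeasurableSpace Ω] {P : Measure Ω}

/-- For a centred variable the second moment is the variance, which independence splits. This
identifies the slope of `Q` with `r₁`. -/
lemma integral_sq_sub_eq {t s : Ω → ℝ} (ht : MemLp t 2 P) (hs : MemLp s 2 P)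
    (hts : IndepFun t s P) {c : ℝ} (h0 : ∫ ω, (c * t ω - s ω) ∂P = 0) :
    ∫ ω, (c * t ω - s ω) ^ 2 ∂P = Var[s; P] + c ^ 2 * Var[t; P] := by
  have h1 : MemLp (fun ω => c * t ω) 2 P := ht.const_mul c
  have h2 : MemLp (fun ω => -s ω) 2 P := hs.neg
  have hind : IndepFun (fun ω => c * t ω) (fun ω => -s ω) P :=
    hts.comp (φ := fun a : ℝ => c * a) (ψ := fun a : ℝ => -a) (by fun_prop) (by fun_prop)
  have h3 := hind.variance_add h1 h2
  have h4 : Var[fun ω => -s ω; P] = Var[s; P] := variance_fun_neg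
  have h5 : Var[fun ω => c * t ω; P] = c ^ 2 * Var[t; P] := variance_const_mul c t P
  rw [h4, h5] at h3
  have e : ((fun ω => c * t ω) + fun ω => -s ω) = fun ω => c * t ω - s ω := by
    ext ω; simp [sub_eq_add_neg]
  have h6 := variance_of_integral_eq_zero (X := fun ω => c * t ω - s ω)
    (h1.sub hs).1.aemeasurable h0
  rw [e, h6] at h3
  linarith

end variance

section exponents

open Polynomial

variable {Q : ℝ[X]} {γ : ℕ} {α : ℝ}

lemma eval_rpow_neg_eq_sum (hdeg : Q.natDegree ≤ γ - 1) (hγ : 2 ≤ γ) (hQ0 : Q.coeff 0 = 0) {x : ℝ}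
    (hx : 0 < x) :
    Q.eval (x ^ (-α)) = ∑ j ∈ Finset.Icc 1 (γ - 1), Q.coeff j * x ^ (-(α * j)) := by
  rw [eval_eq_sum_range' (show Q.natDegree < γ by omega), Finset.range_eq_Ico,
    Finset.sum_eq_sum_Ico_succ_bot (by omega), hQ0, zero_mul, zero_add,
    show Finset.Ico (0 + 1) γ = Finset.Icc 1 (γ - 1) by ext j; simp; omega]
  refine Finset.sum_congr rfl fun j _ => ?_
  rw [← Real.rpow_natCast, ← Real.rpow_mul hx.le, neg_mul]

lemma hasDerivAt_sum_rpow (r : ℕ → ℝ) {m : ℕ} (hm : ∀ j ∈ Finset.Icc 1 m, α * j < 1) {x : ℝ}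
    (hx : 0 < x) :
    HasDerivAt (fun x : ℝ => ∑ j ∈ Finset.Icc 1 m, r j / (1 - α * j) * x ^ (1 - α * j))
      (∑ j ∈ Finset.Icc 1 m, r j * x ^ (-(α * j))) x :=
  HasDerivAt.fun_sum fun j hj => hasDerivAt_rpow_one_sub (hm j hj) hx

end exponents
end LevelDependentRisk

theorem mainTheorem4
    {Ω : Type*} [MeasurableSpace Ω] (P : Measure Ω) [IsProbabilityMeasure P]
    -- inter-claim times and claim sizes: two independent i.i.d. sequences of nonnegative variables
    (τ ξ : ℕ → Ω → ℝ)
    (hτ_meas : ∀ n, Measurable (τ n)) (hξ_meas : ∀ n, Measurable (ξ n))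
    (h_indep : iIndepFun (Sum.elim τ ξ) P)
    (hτ_ident : ∀ n, IdentDistrib (τ n) (τ 0) P P)
    (hξ_ident : ∀ n, IdentDistrib (ξ n) (ξ 0) P P)
    (hτ_nonneg : ∀ᵐ ω ∂P, 0 ≤ τ 0 ω) (hξ_nonneg : ∀ᵐ ω ∂P, 0 ≤ ξ 0 ω)
    (hτ_pos : 0 < ∫ ω, τ 0 ω ∂P)
    -- the premium rate and the solution of the premium equation
    (v : ℝ → ℝ) (hv_meas : Measurable v) (hv_nonneg : ∀ z, 0 ≤ v z) (hv_bdd : ∃ M, ∀ z, v z ≤ M)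
    (V : ℝ → ℝ → ℝ) (hV : LevelDependentRisk.IsPremiumFlow v V)
    -- ruin probabilities are bounded away from zero on bounded sets of initial reserves
    (h_ruin : ∀ x₀ : ℝ, ∃ ε > 0, ∀ x, 0 ≤ x → x ≤ x₀ →
      ε ≤ LevelDependentRisk.ruinProb P V τ ξ x)
    -- the critical premium rate and the rate of approach to it
    (v_c : ℝ) (hv_c : v_c = (∫ ω, ξ 0 ω ∂P) / ∫ ω, τ 0 ω ∂P)
    (α θ : ℝ) (hα : 0 < α) (hα' : α < 1) (hθ : 0 < θ)
    (p : ℝ → ℝ) (hp_pos : ∀ z, 1 < z → 0 < p z) (hp_anti : AntitoneOn p (Set.Ioi 1))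
    (hp_int : IntegrableAtFilter p Filter.atTop volume)
    (h_rate : ∀ z, 1 < z → |v z - v_c - θ / z ^ α| ≤ p z)
    (γ : ℕ) (hγ : IsLeast {k : ℕ | 1 ≤ k ∧ 1 < (k : ℝ) * α} γ)
    -- moment assumptions
    (hτ_mom : Integrable (fun ω => τ 0 ω ^ (γ + 1)) P)
    (r₁ : ℝ) (hr₁ : r₁ = 2 * θ * (∫ ω, τ 0 ω ∂P) / (Var[ξ 0; P] + v_c ^ 2 * Var[τ 0; P]))
    (h_exp : ∃ r : ℝ, r₁ / (1 - α) < r ∧ Integrable (fun ω => Real.exp (r * ξ 0 ω ^ (1 - α))) P) :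
    ∃ (r : ℕ → ℝ) (C₁ C₂ : ℝ), r 1 = r₁ ∧ 0 < C₁ ∧ C₁ < C₂ ∧
      (α = 1 / ((γ : ℝ) - 1) → ∀ x : ℝ, 1 < x →
        C₁ * x ^ α / x ^ r (γ - 1) *
            Real.exp (-∑ j ∈ Finset.Icc 1 (γ - 2), r j / (1 - α * j) * x ^ (1 - α * j))
          ≤ LevelDependentRisk.ruinProb P V τ ξ x ∧
        LevelDependentRisk.ruinProb P V τ ξ x ≤
          C₂ * x ^ α / x ^ r (γ - 1) *
            Real.exp (-∑ j ∈ Finset.Icc 1 (γ - 2), r j / (1 - α * j) * x ^ (1 - α * j))) ∧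
      (α < 1 / ((γ : ℝ) - 1) → ∀ x : ℝ, 1 < x →
        C₁ * x ^ α *
            Real.exp (-∑ j ∈ Finset.Icc 1 (γ - 1), r j / (1 - α * j) * x ^ (1 - α * j))
          ≤ LevelDependentRisk.ruinProb P V τ ξ x ∧
        LevelDependentRisk.ruinProb P V τ ξ x ≤
          C₂ * x ^ α *
            Real.exp (-∑ j ∈ Finset.Icc 1 (γ - 1), r j / (1 - α * j) * x ^ (1 - α * j))) := by
  obtain ⟨M, hM⟩ := hv_bdd
  have hα1 : 0 < 1 - α := by linarith
  have hmodel : LevelDependentRisk.IsRiskModel P τ ξ v V :=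
    ⟨hτ_meas, hξ_meas, h_indep, hτ_ident, hξ_ident, hτ_nonneg, hξ_nonneg, hτ_pos, hv_nonneg, hV⟩
  have hγ2 : 2 ≤ γ := by
    by_contra hcon
    have h1 : γ = 1 := by have := hγ.1.1; omega
    have h2 := hγ.1.2
    rw [h1] at h2
    norm_num at h2
    linarith
  have hγcast : ((γ - 1 : ℕ) : ℝ) = (γ : ℝ) - 1 := by
    rw [Nat.cast_sub (by omega)]; simp
  obtain ⟨r, hr, hexp⟩ := h_exp
  -- Nondegeneracy is not yet known; should the denominator of `r₁` vanish, division by zero gives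
  -- `0`, and `r₁ ≥ 0` still holds.
  have hr0 : 0 < r := by
    refine lt_of_le_of_lt (div_nonneg ?_ hα1.le) hr
    rw [hr₁]
    exact div_nonneg (by positivity) (add_nonneg (variance_nonneg _ _)
      (mul_nonneg (sq_nonneg _) (variance_nonneg _ _)))
  have hts : IndepFun (τ 0) (ξ 0) P :=
    h_indep.indepFun (i := Sum.inl 0) (j := Sum.inr 0) (by simp)
  have hmom : ∀ (c d : ℝ) (i j : ℕ), i + j ≤ γ + 1 →
      Integrable (fun ω => (c * τ 0 ω - ξ 0 ω) ^ i * (d * τ 0 ω) ^ j) P := fun c d i j hij =>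
    LevelDependentRisk.integrable_pow_mul_pow (hτ_meas 0) (hξ_meas 0) hts hτ_nonneg hξ_nonneg
      hτ_mom hr0 hα1 hexp c d hij
  have hτ2 : MemLp (τ 0) 2 P := by
    rw [memLp_two_iff_integrable_sq (hτ_meas 0).aestronglyMeasurable]
    simpa using hmom 0 1 0 2 (by omega)
  have hξ2 : MemLp (ξ 0) 2 P := by
    rw [memLp_two_iff_integrable_sq (hξ_meas 0).aestronglyMeasurable]
    simpa using hmom 0 0 2 0 (by omega)
  have hcent : ∫ ω, (v_c * τ 0 ω - ξ 0 ω) ∂P = 0 := by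
    rw [integral_sub ((hτ2.integrable one_le_two).const_mul _) (hξ2.integrable one_le_two),
      integral_const_mul, hv_c, div_mul_cancel₀ _ hτ_pos.ne', sub_self]
  have hvar := LevelDependentRisk.integral_sq_sub_eq hτ2 hξ2 hts hcent
  -- Otherwise every claim is exactly offset by premiums at the critical rate, ruin is impossible
  -- from a high level, and `h_ruin` fails there.
  have hnd : ∫ ω, (v_c * τ 0 ω - ξ 0 ω) ^ 2 ∂P ≠ 0 := by
    intro h0
    have hint2 : Integrable (fun ω => (v_c * τ 0 ω - ξ 0 ω) ^ 2) P := by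
      simpa using hmom v_c 0 2 0 (by omega)
    have hae := (integral_eq_zero_iff_of_nonneg (fun ω => sq_nonneg _) hint2).1 h0
    obtain ⟨x, hx0, hx⟩ := hmodel.exists_ruinProb_eq_zero hv_meas hM
      (LevelDependentRisk.eventually_le_rate hα' hθ hp_pos hp_anti hp_int h_rate)
      (hae.mono fun ω hω => by simpa using hω)
    obtain ⟨ε, hε, hεψ⟩ := h_ruin x
    have := hεψ x hx0 le_rfl
    linarith
  obtain ⟨Q, hdeg, hQ0, hQ1, hdrift⟩ := LevelDependentRisk.exists_poly_taylorIncrement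
    (A := fun ω => v_c * τ 0 ω - ξ 0 ω) (B := fun ω => θ * τ 0 ω) hγ2
    (fun i j hij => hmom v_c θ i j (by omega)) hcent hnd
  have hbpos : 0 < ∫ ω, (v_c * τ 0 ω - ξ 0 ω) ^ 2 ∂P :=
    lt_of_le_of_ne (integral_nonneg fun ω => sq_nonneg _) (Ne.symm hnd)
  have hQr : Q.coeff 1 = r₁ := by
    rw [hQ1, hr₁, hvar, integral_const_mul, mul_assoc]
  have hQpos : 0 < Q.coeff 1 := by
    rw [hQ1, integral_const_mul]; positivity
  -- Any antiderivative serves; the two cases of the theorem differ only in how the last term of `Q`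
  -- integrates.
  have core : ∀ R : ℝ → ℝ, (∀ x, 0 < x → HasDerivAt R (Q.eval (x ^ (-α))) x) →
      ∃ C₁ C₂ : ℝ, 0 < C₁ ∧ C₁ < C₂ ∧ ∀ x, 1 < x →
        C₁ * (x ^ α * Real.exp (-R x)) ≤ LevelDependentRisk.ruinProb P V τ ξ x ∧
        LevelDependentRisk.ruinProb P V τ ξ x ≤ C₂ * (x ^ α * Real.exp (-R x)) := fun R hR =>
    LevelDependentRisk.IsNearCritical.ruinProb_bounds (M := M) (vc := v_c) (θ := θ) (p := p)
      (n := γ) (Q := Q)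
      { hmodel with
        measurable_rate := hv_meas
        rate_le := hM
        ruin_pos := h_ruin
        α_pos := hα
        α_lt_one := hα'
        θ_pos := hθ
        p_pos := hp_pos
        p_anti := hp_anti
        p_int := hp_int
        rate_approx := h_rate
        two_le := hγ2
        one_lt := hγ.1.2
        time_moment := hτ_mom
        exp_moment := ⟨r, hQr ▸ hr, hexp⟩
        centered := hcent
        nondegenerate := hnd
        coeff_zero := hQ0
        coeff_one := hQpos
        drift := hdrift
        deriv := hR }
  have hγ1 : (0 : ℝ) < (γ : ℝ) - 1 := by
    have : (2 : ℝ) ≤ γ := by exact_mod_cast hγ2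
    linarith
  -- Minimality of `γ` gives `(γ - 1) * α ≤ 1`. Equality and strict inequality are the two cases of
  -- the theorem, and in each the other becomes vacuous.
  have hmle : (γ : ℝ) - 1 ≤ 1 / α := by
    rw [le_div_iff₀ hα]
    by_contra hcon
    have := hγ.2 (show γ - 1 ∈ {k : ℕ | 1 ≤ k ∧ 1 < (k : ℝ) * α} from
      ⟨by omega, by rw [hγcast]; exact not_le.1 hcon⟩)
    omega
  rcases eq_or_lt_of_le hmle with heq | hlt
  · have hαγ : α * ((γ - 1 : ℕ) : ℝ) = 1 := by
      rw [hγcast, heq]; field_simp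
    have hγ3 : γ - 1 = γ - 2 + 1 := by omega
    -- With `α * (γ - 1) = 1` the last term of `Q (x ^ (-α))` is a multiple of `1 / x`; its
    -- logarithm becomes the factor `x ^ (-Q.coeff (γ - 1))`.
    obtain ⟨C₁, C₂, hC₁, hC, hbd⟩ := core (fun x =>
      (∑ j ∈ Finset.Icc 1 (γ - 2), Q.coeff j / (1 - α * j) * x ^ (1 - α * j)) +
        Q.coeff (γ - 1) * Real.log x) (fun x hx => by
      rw [LevelDependentRisk.eval_rpow_neg_eq_sum hdeg hγ2 hQ0 hx]
      have h1 := (LevelDependentRisk.hasDerivAt_sum_rpow (α := α) Q.coeff (m := γ - 2)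
        (fun j hj => by
          rw [← hαγ]
          refine mul_lt_mul_of_pos_left ?_ hα
          have := (Finset.mem_Icc.1 hj).2
          exact_mod_cast (show j < γ - 1 by omega)) hx).add
        ((Real.hasDerivAt_log hx.ne').const_mul (Q.coeff (γ - 1)))
      refine h1.congr_deriv ?_
      rw [hγ3, Finset.sum_Icc_succ_top (by omega), ← hγ3, hαγ, Real.rpow_neg_one])
    refine ⟨Q.coeff, C₁, C₂, hQr, hC₁, hC, fun _ x hx => ?_, fun hcon => ?_⟩
    · have hx0 : 0 < x := by linarith
      have e : ∀ C : ℝ, C * x ^ α / x ^ Q.coeff (γ - 1) *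
          Real.exp (-∑ j ∈ Finset.Icc 1 (γ - 2), Q.coeff j / (1 - α * j) * x ^ (1 - α * j)) =
          C * (x ^ α * Real.exp (-((∑ j ∈ Finset.Icc 1 (γ - 2),
            Q.coeff j / (1 - α * j) * x ^ (1 - α * j)) + Q.coeff (γ - 1) * Real.log x))) := by
        intro C
        rw [neg_add, Real.exp_add, Real.exp_neg (Q.coeff (γ - 1) * Real.log x),
          mul_comm (Q.coeff (γ - 1)), ← Real.rpow_def_of_pos hx0]
        field_simp
      rw [e, e]
      exact hbd x hx
    · rw [heq] at hcon
      simp at hcon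
  · have hαγ : α * ((γ - 1 : ℕ) : ℝ) < 1 := by
      rw [lt_div_iff₀ hα] at hlt
      rw [hγcast]; linarith
    obtain ⟨C₁, C₂, hC₁, hC, hbd⟩ := core (fun x =>
      ∑ j ∈ Finset.Icc 1 (γ - 1), Q.coeff j / (1 - α * j) * x ^ (1 - α * j)) (fun x hx => by
      rw [LevelDependentRisk.eval_rpow_neg_eq_sum hdeg hγ2 hQ0 hx]
      refine LevelDependentRisk.hasDerivAt_sum_rpow Q.coeff (fun j hj => ?_) hx
      refine lt_of_le_of_lt (mul_le_mul_of_nonneg_left ?_ hα.le) hαγ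
      exact_mod_cast (Finset.mem_Icc.1 hj).2)
    refine ⟨Q.coeff, C₁, C₂, hQr, hC₁, hC, fun hcon => ?_, fun _ x hx => ?_⟩
    · exact absurd hlt (by rw [hcon]; simp)
    · rw [mul_assoc, mul_assoc]
      exact hbd x hx
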